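/- **Theorem (adversarial cycle).** *Setting.* Let $n\ge 3$ and let $G$ be the simple cycle on $n$ nodes. Every node $u$ carries a real number $x_u$ (its item; items at different nodes may coincide) and one of three request types: insert, delete, or query. Fix a start node $v^0$ and an initial active set $X^0\subseteq\{x_u : u\in G\}$ (for example $X^0=\emptyset$). An adversary chooses an arbitrary walk $v^0,v^1,v^2,\dots$ in $G$, where consecutive nodes are adjacent. For $t\ge 1$ put $X^t=X^{t-1}\cup\{x_{v^t}\}$ if $v^t$ is an insert node, $X^t=X^{t-1}\setminus\{x_{v^t}\}$ if it is a delete node, and $X^t=X^{t-1}$ if it is a query node. If $v^t$ is a query node, then the algorithm has to report $\mathrm{succ}_{X^t}(x_{v^t})=\min\{y\in X^t : y\ge x_{v^t}\}$, or $\infty$ if there is no such $y$, by giving a node whose item is this minimum, or a symbol for $\infty$. *Model.* The algorithm is a program for a unit-cost word RAM with words of $O(\log n)$ bits (constants, addition, truncated subtraction, multiplication, integer division, indirect load and store, jumps, comparison). The walk is revealed online: at time $t$ the machine receives the node $v^t$ and must finish this request before it learns $v^{t+1}$. Before the walk starts the storage may be initialized (preprocessed) depending on the labelled cycle, $v^0$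 and $X^0$, but not on the walk; the preprocessing time is not counted. *Claim.* For every fixed $\varepsilon>0$ there are a program and constants $T,c,K$, all depending only on $\varepsilon$, such that for every $n\ge 3$, every labelled $n$-node cycle, every start node and every initial active set, the storage, consisting of at most $K\,n^{1+\varepsilon}$ words of $c\lceil\log_2 n\rceil$ bits, can be initialized in such a way that, for every walk, each request is processed in at most $T$ steps, only these storage cells are accessed, and every query is answered correctly. -/

import Mathlib

namespace CycleSucc

/-! ### A word RAM with unit cost

A machine has word size `w` and a storage of `M` cells. Every register and every cell holds a word,
that is, a natural number below `2 ^ w`. A program is a finite list of instructions, so it mentions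
only finitely many registers. Each executed instruction costs one time unit. -/

/-- Instructions of the word RAM; `R[i]` is register `i` and `S[a]` is storage cell `a`. -/
inductive Instr where
  /-- `R[d] := k` (reduced to a word) -/
  | const (d k : ℕ)
  /-- `R[d] := R[a] + R[b]` (reduced to a word) -/
  | add (d a b : ℕ)
  /-- `R[d] := max (R[a] - R[b]) 0` -/
  | sub (d a b : ℕ)
  /-- `R[d] := R[a] * R[b]` (reduced to a word) -/
  | mul (d a b : ℕ)
  /-- `R[d] := ⌊R[a] / R[b]⌋` (and `0` if `R[b] = 0`) -/
  | div (d a b : ℕ)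
  /-- `R[d] := S[R[a]]` -/
  | load (d a : ℕ)
  /-- `S[R[a]] := R[b]` -/
  | store (a b : ℕ)
  /-- go to instruction `l` -/
  | jump (l : ℕ)
  /-- go to instruction `l` if `R[a] < R[b]` -/
  | jlt (a b l : ℕ)
  /-- stop -/
  | halt

/-- A program is a finite list of instructions, numbered from `0`. -/
abbrev Program := List Instr

/-- A configuration: program counter, registers, storage. Only the storage cells with address below
the storage bound `M` can ever be read or written, see `exec`. -/
structure Config where
  pc : ℕ
  reg : ℕ → ℕ
  mem : ℕ → ℕ

/-- Put the value `y`, reduced to a word of `w` bits, into register `d` and go to the next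
instruction. -/
def Config.setReg (w : ℕ) (s : Config) (d y : ℕ) : Config :=
  { s with pc := s.pc + 1, reg := Function.update s.reg d (y % 2 ^ w) }

/-- Execution of a single instruction, with word size `w` and `M` storage cells. The result is
`none` (a crash) if the instruction addresses a cell outside the storage. -/
def exec (w M : ℕ) (s : Config) : Instr → Option Config
  | .const d k => some (s.setReg w d k)
  | .add d a b => some (s.setReg w d (s.reg a + s.reg b))
  | .sub d a b => some (s.setReg w d (s.reg a - s.reg b))
  | .mul d a b => some (s.setReg w d (s.reg a * s.reg b))
  | .div d a b => some (s.setReg w d (s.reg a / s.reg b))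
  | .load d a => if s.reg a < M then some (s.setReg w d (s.mem (s.reg a))) else none
  | .store a b =>
      if s.reg a < M then
        some { s with pc := s.pc + 1, mem := Function.update s.mem (s.reg a) (s.reg b) }
      else none
  | .jump l => some { s with pc := l }
  | .jlt a b l => some { s with pc := if s.reg a < s.reg b then l else s.pc + 1 }
  | .halt => some s

/-- `run P w M T s` is the configuration in which the program `P`, started in `s`, halts, provided
that it halts after at most `T` instructions (the final `halt` included) and without a crash;
otherwise it is `none`. -/
def run (P : Program) (w M : ℕ) : ℕ → Config → Option Config
  | 0, _ => none
  | T + 1, s =>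
    match P[s.pc]? with
    | none => none
    | some .halt => some s
    | some i => (exec w M s i).bind (run P w M T)

/-- Processing of one request, in time at most `T`: the number `v` of the node that the walk enters
is put into register `0`, and the program is run from its first instruction. Registers and storage
are otherwise kept from the previous request. -/
def serve (P : Program) (w M T : ℕ) (s : Config) (v : ℕ) : Option Config :=
  run P w M T { s with pc := 0, reg := Function.update s.reg 0 (v % 2 ^ w) }

/-- The configuration with storage content `mem` and all registers `0`. -/
def Config.init (mem : ℕ → ℕ) : Config := { pc := 0, reg := fun _ => 0, mem := mem }

/-! ### Event graphs and successor searching -/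

/-- The three types of requests. -/
inductive Op where
  | insert
  | delete
  | query

/-- The active set `X^t` along the walk `v`, with initial active set `X₀ = X^0`. The node `u` carries
the operation `op u` and the item `x u`. -/
def activeSet {V : Type*} (op : V → Op) (x : V → ℝ) (v : ℕ → V) (X₀ : Set ℝ) : ℕ → Set ℝ
  | 0 => X₀
  | t + 1 =>
    match op (v (t + 1)) with
    | .insert => activeSet op x v X₀ t ∪ {x (v (t + 1))}
    | .delete => activeSet op x v X₀ t \ {x (v (t + 1))}
    | .query => activeSet op x v X₀ t

/-- The word `a` represents `succ_X(q) = min {y ∈ X | y ≥ q}` (or `∞`): either `a` is the number of a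
node whose item is this minimum, or there is no such `y` and `a = n`, which stands for `∞`. -/
def RepresentsSucc {n : ℕ} (x : Fin n → ℝ) (X : Set ℝ) (q : ℝ) (a : ℕ) : Prop :=
  (∃ k : Fin n, a = k ∧ IsLeast {y | y ∈ X ∧ q ≤ y} (x k)) ∨ (a = n ∧ ¬ ∃ y ∈ X, q ≤ y)

/-- The program `P` on a machine with word size `w` and `M` storage cells, started with storage
content `mem`, serves every request along the walk `v` in time at most `T` each, and after each query
register `1` represents the successor of the item at the current node in the current active set.
The machine learns the node `v (t + 1)` only after it has dealt with the requests before. -/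
def ServesWalk {n : ℕ} (P : Program) (w M T : ℕ) (mem : ℕ → ℕ) (op : Fin n → Op) (x : Fin n → ℝ)
    (X₀ : Set ℝ) (v : ℕ → Fin n) : Prop :=
  ∃ s : ℕ → Config, s 0 = Config.init mem ∧
    ∀ t : ℕ, serve P w M T (s t) (v (t + 1)) = some (s (t + 1)) ∧
      (op (v (t + 1)) = Op.query →
        RepresentsSucc x (activeSet op x v X₀ (t + 1)) (x (v (t + 1))) ((s (t + 1)).reg 1))

end CycleSucc

/-! Items are replaced by their ranks, so equal items share one key, and the cycle is unrolled to
the positions 0, …, 2n with the start node at n. A walker that reaches an end of this line is moved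
to the other copy of its node, at distance n, which is again position n.

A key that has been requested is active exactly if its latest update was an insertion. Suppose that
the walker left h to the left, has stayed left of h since, reached its leftmost point l, and is now
at p. Then the latest visits to [l, p] run from left to right, and those to (p, h] are older and run
from right to left. Hence a key occurring in [l, h] is decided by its last occurrence in [l, p] or,
failing that, by its first occurrence in (p, h]. The history is a stack of nested intervals of this
kind inside the visited range (`Claim`, `Good`, `Inv`). By `above_eq`, passing from one interval to
the next adds two sets of decided keys, and the least key of each above a threshold is a static
range minimum. Beyond the visited range the initial active set still holds.

The stack may be deep, so the answer beyond an interval is stored. No request inside an interval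
affects the keys that do not occur in it (`above_step`), so such a value stays valid while the
interval contains the walker. One value per interval and position would take too much space;
intervals are therefore identified when their left ends lie in the same block of length B^k, where k
is the coarsest level at which the position is at least two blocks away (`lev`). A slot then needs
only a block difference below 2B (`lev_diff_lt`), and it holds the answer beyond the outermost
interval of the block. `above_block` recovers the answer for an inner interval: keys absent from the
block are decided on the right, by one range query. For keys of the block, let r be the least one
above the threshold and o one of its positions in the block. The query with threshold r is stored at
the position o + B^k, which lies in the adjacent block and so has a lower level. The recursion thus
ends after at most K rounds (`Ev.eval`). A request writes K + 1 such values, and each is either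
copied from the second interval or computed beyond the first one (`Slots.write`).

Range minima are found by cutting coordinates into blocks (`exists_level`): each point enters O(B^3)
groups, for fixed K. In a group the least entry above a threshold is a piecewise constant function,
stored in a trie of constant depth (`exists_trie`). All tables together have O(n B^4) cells; B of
order n^(1/K) with K ≥ 4/ε gives the claim. -/

namespace CycleSucc

/-! ### Overview

The cycle is unrolled to a line of `2 n + 1` positions, on which the walker maintains the visited
range `[a, b]` and a stack of nested intervals around its position. The active keys that are not
decided by the innermost interval are found in stored values, one per interval and level of a
`B`-ary subdivision of the line with `B ^ K ≥ 2 n + 3`, and in a static trie that answers range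
minimum queries over the first and last occurrences of the keys. All tables have size `O(n B ^ 4)`,
and the number of machine steps per request depends only on `K`. -/

/-! ### Expressions and straight-line programs on the word RAM -/

/-- Expressions over the input register `0` and the storage. -/
inductive Ex where
  | inp
  | lit (k : ℕ)
  | add (a b : Ex)
  | sub (a b : Ex)
  | mul (a b : Ex)
  | div (a b : Ex)
  | load (a : Ex)
  /-- `if a < b then c else e` -/
  | ite (a b c e : Ex)

namespace Ex

/-- The number of instructions of the code of an expression. -/
def size : Ex → ℕ
  | inp => 2
  | lit _ => 1
  | add a b => a.size + b.size + 1
  | sub a b => a.size + b.size + 1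
  | mul a b => a.size + b.size + 1
  | div a b => a.size + b.size + 1
  | load a => a.size + 1
  | ite a b c e => a.size + b.size + 1 + e.size + 1 + c.size

/-- The code of an expression, placed at address `o`, with its value put into register `d`. The
registers below `d` are not changed. -/
def code : Ex → ℕ → ℕ → List Instr
  -- The machine has no move between registers; register 0 is copied by adding zero.
  | inp, d, _ => [.const d 0, .add d 0 d]
  | lit k, d, _ => [.const d k]
  | add a b, d, o => a.code d o ++ (b.code (d + 1) (o + a.size) ++ [.add d d (d + 1)])
  | sub a b, d, o => a.code d o ++ (b.code (d + 1) (o + a.size) ++ [.sub d d (d + 1)])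
  | mul a b, d, o => a.code d o ++ (b.code (d + 1) (o + a.size) ++ [.mul d d (d + 1)])
  | div a b, d, o => a.code d o ++ (b.code (d + 1) (o + a.size) ++ [.div d d (d + 1)])
  | load a, d, o => a.code d o ++ [.load d d]
  | ite a b c e, d, o =>
      a.code d o ++ (b.code (d + 1) (o + a.size) ++
        ([.jlt d (d + 1) (o + a.size + b.size + 1 + e.size + 1)] ++
          (e.code d (o + a.size + b.size + 1) ++
            ([.jump (o + a.size + b.size + 1 + e.size + 1 + c.size)] ++
              c.code d (o + a.size + b.size + 1 + e.size + 1)))))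

theorem length_code (e : Ex) : ∀ d o, (e.code d o).length = e.size := by
  induction e <;> intro d o <;> simp_all [code, size] <;> omega

end Ex

/-- `Ev w M mem x e v`: with input `x` and storage content `mem`, the expression `e` has the value
`v`, and its evaluation neither overflows nor leaves the storage. -/
inductive Ev (w M : ℕ) (mem : ℕ → ℕ) (x : ℕ) : Ex → ℕ → Prop
  | inp : x < 2 ^ w → Ev w M mem x .inp x
  | lit {k : ℕ} : k < 2 ^ w → Ev w M mem x (.lit k) k
  | add {a b : Ex} {y z : ℕ} : Ev w M mem x a y → Ev w M mem x b z → y + z < 2 ^ w →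
      Ev w M mem x (.add a b) (y + z)
  | sub {a b : Ex} {y z : ℕ} : Ev w M mem x a y → Ev w M mem x b z → y - z < 2 ^ w →
      Ev w M mem x (.sub a b) (y - z)
  | mul {a b : Ex} {y z : ℕ} : Ev w M mem x a y → Ev w M mem x b z → y * z < 2 ^ w →
      Ev w M mem x (.mul a b) (y * z)
  | div {a b : Ex} {y z : ℕ} : Ev w M mem x a y → Ev w M mem x b z → y / z < 2 ^ w →
      Ev w M mem x (.div a b) (y / z)
  | load {a : Ex} {y : ℕ} : Ev w M mem x a y → y < M → mem y < 2 ^ w →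
      Ev w M mem x (.load a) (mem y)
  | ite_pos {a b c e : Ex} {y z v : ℕ} : Ev w M mem x a y → Ev w M mem x b z → y < z →
      Ev w M mem x c v → Ev w M mem x (.ite a b c e) v
  | ite_neg {a b c e : Ex} {y z v : ℕ} : Ev w M mem x a y → Ev w M mem x b z → ¬ y < z →
      Ev w M mem x e v → Ev w M mem x (.ite a b c e) v

theorem Ev.lt {w M : ℕ} {mem : ℕ → ℕ} {x : ℕ} {e : Ex} {v : ℕ} (h : Ev w M mem x e v) :
    v < 2 ^ w := by
  induction h <;> assumption

/-- From `s` the program `P` gets to `s'` in exactly `t` instructions. -/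
def Reach (P : Program) (w M t : ℕ) (s s' : Config) : Prop :=
  ∀ T, run P w M (T + t) s = run P w M T s'

theorem Reach.refl (P : Program) (w M : ℕ) (s : Config) : Reach P w M 0 s s := fun _ => rfl

theorem Reach.trans {P : Program} {w M t u : ℕ} {s s' s'' : Config} (h : Reach P w M t s s')
    (h' : Reach P w M u s' s'') : Reach P w M (t + u) s s'' := by
  intro T
  rw [show T + (t + u) = (T + u) + t by omega, h, h']

theorem Reach.step {P : Program} {w M : ℕ} {s s' : Config} {i : Instr} (hP : P[s.pc]? = some i)
    (hi : i ≠ .halt) (h : exec w M s i = some s') : Reach P w M 1 s s' := by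
  intro T
  cases i <;> simp_all [run]

/-- The code `l` stands at address `o` of the program `P`. -/
def CodeAt (P : Program) (o : ℕ) (l : List Instr) : Prop :=
  ∀ k, k < l.length → P[o + k]? = l[k]?

theorem CodeAt.append {P : Program} {o : ℕ} {l l' : List Instr} (h : CodeAt P o (l ++ l')) :
    CodeAt P o l ∧ CodeAt P (o + l.length) l' := by
  constructor
  · intro k hk
    rw [h k (by simp; omega), List.getElem?_append_left hk]
  · intro k hk
    rw [add_assoc, h (l.length + k) (by simp; omega), List.getElem?_append_right (by omega)]
    simp

theorem CodeAt.head {P : Program} {o : ℕ} {i : Instr} {l : List Instr}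
    (h : CodeAt P o (i :: l)) : P[o]? = some i := by
  simpa using h 0 (by simp)

theorem CodeAt.tail {P : Program} {o : ℕ} {i : Instr} {l : List Instr}
    (h : CodeAt P o (i :: l)) : CodeAt P (o + 1) l := by
  have : CodeAt P o ([i] ++ l) := h
  simpa using this.append.2

/-- The effect of the code of an expression. -/
def Computes (P : Program) (w M : ℕ) (s : Config) (d n v : ℕ) : Prop :=
  ∃ t ≤ n, ∃ s', Reach P w M t s s' ∧ s'.pc = s.pc + n ∧ s'.mem = s.mem ∧ s'.reg d = v ∧
    ∀ i < d, s'.reg i = s.reg i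

/-- The second operand is computed with target d + 1 and leaves the registers up to d alone, so the
first operand survives in register d. -/
theorem Computes.binop {P : Program} {w M : ℕ} {s : Config} {d n m y z v : ℕ} {i : Instr}
    (ha : Computes P w M s d n y)
    (hb : ∀ s', s'.pc = s.pc + n → s'.mem = s.mem → (∀ i < d, s'.reg i = s.reg i) →
      Computes P w M s' (d + 1) m z)
    (hP : P[s.pc + n + m]? = some i) (hi : i ≠ .halt)
    (hex : ∀ s' : Config, s'.reg d = y → s'.reg (d + 1) = z →
      exec w M s' i = some (s'.setReg w d v)) (hv : v < 2 ^ w) :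
    Computes P w M s d (n + m + 1) v := by
  obtain ⟨t, ht, s1, r1, p1, m1, e1, k1⟩ := ha
  obtain ⟨u, hu, s2, r2, p2, m2, e2, k2⟩ := hb s1 p1 m1 k1
  have h3 : Reach P w M 1 s2 (s2.setReg w d v) := by
    refine Reach.step (i := i) ?_ hi (hex s2 ?_ e2)
    · rw [p2, p1, hP]
    · rw [k2 d (by omega), e1]
  refine ⟨t + u + 1, by omega, _, (r1.trans r2).trans h3, ?_, ?_, ?_, ?_⟩
  · simp [Config.setReg, p2, p1]; omega
  · simp [Config.setReg, m2, m1]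
  · simp [Config.setReg, Nat.mod_eq_of_lt hv]
  · intro i hid
    simp only [Config.setReg, Function.update_of_ne (ne_of_lt hid)]
    rw [k2 i (by omega), k1 i hid]

/-- Correctness of compilation, by induction on the evaluation. All jumps go forward, so the number
of steps is at most the length of the code, whichever branches are taken. -/
theorem Ev.computes {w M : ℕ} {mem : ℕ → ℕ} {x : ℕ} {P : Program} {e : Ex} {v : ℕ}
    (h : Ev w M mem x e v) : ∀ (d : ℕ) (s : Config), 0 < d → CodeAt P s.pc (e.code d s.pc) →
      s.mem = mem → s.reg 0 = x → Computes P w M s d e.size v := by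
  have lift : ∀ {d : ℕ} {s s' : Config} {y : ℕ}, 0 < d → s.reg 0 = y →
      (∀ i < d, s'.reg i = s.reg i) → s'.reg 0 = y := fun hd h0 hk => by rw [hk 0 hd, h0]
  induction h with
  | inp hx =>
    intro d s hd hc hm h0
    have h1 : Reach P w M 1 s (s.setReg w d 0) := Reach.step hc.head (by simp) rfl
    have h2 : Reach P w M 1 (s.setReg w d 0)
        ((s.setReg w d 0).setReg w d ((s.setReg w d 0).reg 0 + (s.setReg w d 0).reg d)) :=
      Reach.step (by simpa [Config.setReg] using hc.tail.head) (by simp) rfl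
    have hd' : (0 : ℕ) ≠ d := by omega
    refine ⟨2, le_rfl, _, h1.trans h2, ?_, ?_, ?_, ?_⟩
    · simp [Config.setReg, Ex.size]
    · simp [Config.setReg]
    · simp [Config.setReg, Function.update_of_ne hd', h0, Nat.mod_eq_of_lt hx]
    · intro i hi
      simp [Config.setReg, Function.update_of_ne (ne_of_lt hi)]
  | @lit k hk =>
    intro d s hd hc hm h0
    refine ⟨1, le_rfl, _, Reach.step hc.head (by simp) rfl, ?_, ?_, ?_, ?_⟩
    · simp [Config.setReg, Ex.size]
    · simp [Config.setReg]
    · simp [Config.setReg, Nat.mod_eq_of_lt hk]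
    · intro i hi
      simp [Config.setReg, Function.update_of_ne (ne_of_lt hi)]
  | @add a b y z _ _ hv iha ihb =>
    intro d s hd hc hm h0
    obtain ⟨ca, cb⟩ := CodeAt.append hc
    obtain ⟨cb, cc⟩ := CodeAt.append cb
    simp only [Ex.length_code] at cb cc
    refine Computes.binop (iha d s hd ca hm h0) (fun s' p m k => ihb (d + 1) s' (by omega) ?_
      (m.trans hm) (lift hd h0 k)) cc.head (by simp) (fun s' e1 e2 => ?_) hv
    · rw [p]; exact cb
    · simp [exec, e1, e2]
  | @sub a b y z _ _ hv iha ihb =>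
    intro d s hd hc hm h0
    obtain ⟨ca, cb⟩ := CodeAt.append hc
    obtain ⟨cb, cc⟩ := CodeAt.append cb
    simp only [Ex.length_code] at cb cc
    refine Computes.binop (iha d s hd ca hm h0) (fun s' p m k => ihb (d + 1) s' (by omega) ?_
      (m.trans hm) (lift hd h0 k)) cc.head (by simp) (fun s' e1 e2 => ?_) hv
    · rw [p]; exact cb
    · simp [exec, e1, e2]
  | @mul a b y z _ _ hv iha ihb =>
    intro d s hd hc hm h0
    obtain ⟨ca, cb⟩ := CodeAt.append hc
    obtain ⟨cb, cc⟩ := CodeAt.append cb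
    simp only [Ex.length_code] at cb cc
    refine Computes.binop (iha d s hd ca hm h0) (fun s' p m k => ihb (d + 1) s' (by omega) ?_
      (m.trans hm) (lift hd h0 k)) cc.head (by simp) (fun s' e1 e2 => ?_) hv
    · rw [p]; exact cb
    · simp [exec, e1, e2]
  | @div a b y z _ _ hv iha ihb =>
    intro d s hd hc hm h0
    obtain ⟨ca, cb⟩ := CodeAt.append hc
    obtain ⟨cb, cc⟩ := CodeAt.append cb
    simp only [Ex.length_code] at cb cc
    refine Computes.binop (iha d s hd ca hm h0) (fun s' p m k => ihb (d + 1) s' (by omega) ?_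
      (m.trans hm) (lift hd h0 k)) cc.head (by simp) (fun s' e1 e2 => ?_) hv
    · rw [p]; exact cb
    · simp [exec, e1, e2]
  | @load a y _ hy hv iha =>
    intro d s hd hc hm h0
    obtain ⟨ca, cb⟩ := CodeAt.append hc
    simp only [Ex.length_code] at cb
    obtain ⟨t, ht, s1, r1, p1, m1, e1, k1⟩ := iha d s hd ca hm h0
    have h3 : Reach P w M 1 s1 (s1.setReg w d (mem y)) := by
      refine Reach.step (i := .load d d) (by rw [p1]; exact cb.head) (by simp) ?_
      simp [exec, e1, hy, m1, hm]
    refine ⟨t + 1, by simp [Ex.size]; omega, _, r1.trans h3, ?_, ?_, ?_, ?_⟩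
    · simp [Config.setReg, p1, Ex.size]; omega
    · simp [Config.setReg, m1]
    · simp [Config.setReg, Nat.mod_eq_of_lt hv]
    · intro i hi
      simp only [Config.setReg, Function.update_of_ne (ne_of_lt hi)]
      exact k1 i hi
  | @ite_pos a b c e y z v _ _ hyz _ iha ihb ihc =>
    intro d s hd hc hm h0
    obtain ⟨ca, cb⟩ := CodeAt.append hc
    obtain ⟨cb, cj⟩ := CodeAt.append cb
    obtain ⟨cj, ce⟩ := CodeAt.append cj
    obtain ⟨ce, ck⟩ := CodeAt.append ce
    obtain ⟨ck, cl⟩ := CodeAt.append ck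
    simp only [Ex.length_code, List.length_singleton] at cb cj ce ck cl
    obtain ⟨t, ht, s1, r1, p1, m1, e1, k1⟩ := iha d s hd ca hm h0
    obtain ⟨u, hu, s2, r2, p2, m2, e2, k2⟩ := ihb (d + 1) s1 (by omega) (by rw [p1]; exact cb)
      (m1.trans hm) (lift hd h0 k1)
    have e1' : s2.reg d = y := by rw [k2 d (by omega), e1]
    let s3 : Config := { s2 with pc := s.pc + a.size + b.size + 1 + e.size + 1 }
    have h3 : Reach P w M 1 s2 s3 := by
      refine Reach.step (i := .jlt d (d + 1) (s.pc + a.size + b.size + 1 + e.size + 1))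
        (by rw [p2, p1]; exact cj.head) (by simp) ?_
      simp [exec, e1', e2, hyz, s3]
    obtain ⟨u', hu', s4, r4, p4, m4, e4, k4⟩ := ihc d s3 hd cl
      (m2.trans (m1.trans hm)) (by
        change s2.reg 0 = _
        rw [k2 0 (by omega), k1 0 hd, h0])
    refine ⟨t + u + 1 + u', by simp [Ex.size]; omega, s4, ((r1.trans r2).trans h3).trans r4,
      ?_, ?_, e4, ?_⟩
    · rw [p4]; simp [s3, Ex.size]; omega
    · rw [m4]; exact m2.trans m1
    · intro i hi
      rw [k4 i hi]
      change s2.reg i = _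
      rw [k2 i (by omega), k1 i hi]
  | @ite_neg a b c e y z v _ _ hyz _ iha ihb ihc =>
    intro d s hd hc hm h0
    obtain ⟨ca, cb⟩ := CodeAt.append hc
    obtain ⟨cb, cj⟩ := CodeAt.append cb
    obtain ⟨cj, ce⟩ := CodeAt.append cj
    obtain ⟨ce, ck⟩ := CodeAt.append ce
    obtain ⟨ck, cl⟩ := CodeAt.append ck
    simp only [Ex.length_code, List.length_singleton] at cb cj ce ck cl
    obtain ⟨t, ht, s1, r1, p1, m1, e1, k1⟩ := iha d s hd ca hm h0
    obtain ⟨u, hu, s2, r2, p2, m2, e2, k2⟩ := ihb (d + 1) s1 (by omega) (by rw [p1]; exact cb)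
      (m1.trans hm) (lift hd h0 k1)
    have e1' : s2.reg d = y := by rw [k2 d (by omega), e1]
    let s3 : Config := { s2 with pc := s.pc + a.size + b.size + 1 }
    have h3 : Reach P w M 1 s2 s3 := by
      refine Reach.step (i := .jlt d (d + 1) (s.pc + a.size + b.size + 1 + e.size + 1))
        (by rw [p2, p1]; exact cj.head) (by simp) ?_
      simp [exec, e1', e2, hyz, s3, p2, p1]
    obtain ⟨u', hu', s4, r4, p4, m4, e4, k4⟩ := ihc d s3 hd ce
      (m2.trans (m1.trans hm)) (by
        change s2.reg 0 = _
        rw [k2 0 (by omega), k1 0 hd, h0])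
    let s5 : Config := { s4 with pc := s.pc + a.size + b.size + 1 + e.size + 1 + c.size }
    have h5 : Reach P w M 1 s4 s5 := by
      refine Reach.step (i := .jump (s.pc + a.size + b.size + 1 + e.size + 1 + c.size))
        (by rw [p4]; exact ck.head) (by simp) ?_
      simp [exec, s5]
    refine ⟨t + u + 1 + u' + 1, by simp [Ex.size]; omega, s5,
      (((r1.trans r2).trans h3).trans r4).trans h5, ?_, ?_, e4, ?_⟩
    · simp [s5, Ex.size]; omega
    · change s4.mem = _
      rw [m4]; exact m2.trans m1
    · intro i hi
      change s4.reg i = _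
      rw [k4 i hi]
      change s2.reg i = _
      rw [k2 i (by omega), k1 i hi]

/-- A sequence of assignments `S[a] := b`. -/
abbrev Stmts := List (Ex × Ex)

/-- The effect of a sequence of assignments on the storage. -/
inductive Exec (w M x : ℕ) : (ℕ → ℕ) → Stmts → (ℕ → ℕ) → Prop
  | nil (mem : ℕ → ℕ) : Exec w M x mem [] mem
  | cons {mem mem' : ℕ → ℕ} {a b : Ex} {y v : ℕ} {l : Stmts} : Ev w M mem x a y → y < M →
      Ev w M mem x b v → Exec w M x (Function.update mem y v) l mem' →
      Exec w M x mem ((a, b) :: l) mem'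

theorem Exec.append {w M x : ℕ} {mem mem' mem'' : ℕ → ℕ} {l l' : Stmts}
    (h : Exec w M x mem l mem') (h' : Exec w M x mem' l' mem'') :
    Exec w M x mem (l ++ l') mem'' := by
  induction h with
  | nil => exact h'
  | cons ha hy hb _ ih => exact .cons ha hy hb (ih h')

namespace Stmts

/-- The number of instructions of the code of a sequence of assignments. -/
def size : Stmts → ℕ
  | [] => 0
  | (a, b) :: l => a.size + b.size + 1 + size l

/-- The code of a sequence of assignments, placed at address `o`. -/
def code : Stmts → ℕ → List Instr
  | [], _ => []
  | (a, b) :: l, o => a.code 2 o ++ (b.code 3 (o + a.size) ++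
      ([.store 2 3] ++ code l (o + a.size + b.size + 1)))

theorem length_code (l : Stmts) : ∀ o, (code l o).length = size l := by
  induction l with
  | nil => intro o; rfl
  | cons h l ih => intro o; obtain ⟨a, b⟩ := h; simp [code, size, Ex.length_code, ih]; omega

end Stmts

theorem Exec.reach {w M x : ℕ} {P : Program} {mem mem' : ℕ → ℕ} {l : Stmts}
    (h : Exec w M x mem l mem') : ∀ s : Config, CodeAt P s.pc (Stmts.code l s.pc) →
      s.mem = mem → s.reg 0 = x →
      ∃ t ≤ Stmts.size l, ∃ s', Reach P w M t s s' ∧ s'.pc = s.pc + Stmts.size l ∧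
        s'.mem = mem' ∧ s'.reg 0 = x := by
  induction h with
  | nil mem => intro s _ hm h0; exact ⟨0, le_rfl, s, Reach.refl _ _ _ _, rfl, hm, h0⟩
  | @cons mem mem' a b y v l ha hy hb _ ih =>
    intro s hc hm h0
    obtain ⟨ca, cb⟩ := CodeAt.append hc
    obtain ⟨cb, cj⟩ := CodeAt.append cb
    obtain ⟨cj, cl⟩ := CodeAt.append cj
    simp only [Ex.length_code, List.length_singleton] at cb cj cl
    obtain ⟨t, ht, s1, r1, p1, m1, e1, k1⟩ := ha.computes 2 s (by omega) ca hm h0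
    obtain ⟨u, hu, s2, r2, p2, m2, e2, k2⟩ := hb.computes 3 s1 (by omega) (by rw [p1]; exact cb)
      (m1.trans hm) (by rw [k1 0 (by omega), h0])
    have e1' : s2.reg 2 = y := by rw [k2 2 (by omega), e1]
    let s3 : Config := { s2 with pc := s2.pc + 1, mem := Function.update s2.mem y v }
    have h3 : Reach P w M 1 s2 s3 := by
      refine Reach.step (i := .store 2 3) (by rw [p2, p1]; exact cj.head) (by simp) ?_
      simp [exec, e1', e2, hy, s3]
    have hp3 : s3.pc = s.pc + a.size + b.size + 1 := by simp [s3, p2, p1]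
    obtain ⟨u', hu', s4, r4, p4, m4, e4⟩ := ih s3 (by rw [hp3]; exact cl)
      (by simp [s3, m2, m1, hm]) (by
        change s2.reg 0 = x
        rw [k2 0 (by omega), k1 0 (by omega), h0])
    refine ⟨t + u + 1 + u', by simp [Stmts.size]; omega, s4,
      ((r1.trans r2).trans h3).trans r4, ?_, m4, e4⟩
    rw [p4, hp3]; simp [Stmts.size]; omega

/-- The program that performs the assignments `l` and returns the value of `e` in register `1`. -/
def program (l : Stmts) (e : Ex) : Program :=
  Stmts.code l 0 ++ (e.code 2 (Stmts.size l) ++ [.const 3 0, .add 1 2 3, .halt])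

/-- A time bound for `program l e`. -/
def programTime (l : Stmts) (e : Ex) : ℕ := Stmts.size l + e.size + 3

/-- The time bound is read off from the text of the program alone; it depends neither on the word
size nor on the storage. Only register 0 matters at the start, so leftovers of earlier requests are
harmless. -/
theorem serve_program {w M x r : ℕ} {mem mem' : ℕ → ℕ} {l : Stmts} {e : Ex}
    (h : Exec w M x mem l mem') (he : Ev w M mem' x e r) (hx : x < 2 ^ w) (s : Config)
    (hs : s.mem = mem) :
    ∃ s', serve (program l e) w M (programTime l e) s x = some s' ∧ s'.mem = mem' ∧
      s'.reg 1 = r := by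
  have hc : CodeAt (program l e) 0 (program l e) := fun k _ => by simp
  obtain ⟨c1, c2⟩ := CodeAt.append hc
  obtain ⟨c2, c3⟩ := CodeAt.append c2
  simp only [Ex.length_code, Stmts.length_code, zero_add] at c2 c3
  let s0 : Config := { s with pc := 0, reg := Function.update s.reg 0 (x % 2 ^ w) }
  obtain ⟨t, ht, s1, r1, p1, m1, e1⟩ := h.reach s0 c1 hs (by simp [s0, Nat.mod_eq_of_lt hx])
  have p1' : s1.pc = Stmts.size l := by simp [p1, s0]
  obtain ⟨u, hu, s2, r2, p2, m2, e2, k2⟩ := he.computes 2 s1 (by omega) (by rw [p1']; exact c2)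
    m1 e1
  rw [p1'] at p2
  have h3 : Reach (program l e) w M 1 s2 (s2.setReg w 3 0) :=
    Reach.step (by rw [p2]; exact c3.head) (by simp) rfl
  have h4 : Reach (program l e) w M 1 (s2.setReg w 3 0) ((s2.setReg w 3 0).setReg w 1 r) :=
    Reach.step (i := .add 1 2 3) (by simpa [Config.setReg, p2] using c3.tail.head) (by simp)
      (by simp [exec, Config.setReg, e2])
  let s4 := (s2.setReg w 3 0).setReg w 1 r
  have hr := ((r1.trans r2).trans h3).trans h4
  refine ⟨s4, ?_, ?_, ?_⟩
  -- The actual run may be shorter than the bound; at least one unit must remain for `halt`.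
  · obtain ⟨q, hq⟩ : ∃ q, programTime l e = (q + 1) + (t + u + 1 + 1) :=
      ⟨programTime l e - (t + u + 3), by unfold programTime; omega⟩
    have hh : (program l e)[s4.pc]? = some .halt := by
      simpa [s4, Config.setReg, p2] using c3.tail.tail.head
    unfold serve
    rw [hq]
    change run _ w M (q + 1 + (t + u + 1 + 1)) s0 = _
    rw [hr (q + 1)]
    change run _ w M (q + 1) s4 = _
    simp [run, hh]
  · simp [s4, Config.setReg, m2, m1]
  · simp [s4, Config.setReg, Nat.mod_eq_of_lt he.lt]

/-! ### Least elements with a default value -/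

/-- The least element of `S ∪ {N}`. -/
noncomputable def mn (N : ℕ) (S : Set ℕ) : ℕ := sInf (insert N S)

theorem mn_le_top (N : ℕ) (S : Set ℕ) : mn N S ≤ N := Nat.sInf_le (Set.mem_insert _ _)

theorem mn_le {N : ℕ} {S : Set ℕ} {y : ℕ} (h : y ∈ S) : mn N S ≤ y :=
  Nat.sInf_le (Set.mem_insert_of_mem _ h)

theorem mn_eq_or_mem (N : ℕ) (S : Set ℕ) : mn N S = N ∨ mn N S ∈ S :=
  Nat.sInf_mem (s := insert N S) ⟨N, Set.mem_insert _ _⟩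

theorem mn_mem_of_lt {N : ℕ} {S : Set ℕ} (h : mn N S < N) : mn N S ∈ S :=
  (mn_eq_or_mem N S).resolve_left (ne_of_lt h)

/-- Because of this, every decomposition of a set of active keys, even an overlapping one, becomes a
computation of minima. -/
theorem mn_union (N : ℕ) (S T : Set ℕ) : mn N (S ∪ T) = min (mn N S) (mn N T) := by
  apply le_antisymm
  · refine le_min ?_ ?_
    · rcases mn_eq_or_mem N S with h | h
      · rw [h]; exact mn_le_top _ _
      · exact mn_le (Or.inl h)
    · rcases mn_eq_or_mem N T with h | h
      · rw [h]; exact mn_le_top _ _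
      · exact mn_le (Or.inr h)
  · rcases mn_eq_or_mem N (S ∪ T) with h | h | h
    · rw [h]; exact (min_le_left _ _).trans (mn_le_top _ _)
    · exact (min_le_left _ _).trans (mn_le h)
    · exact (min_le_right _ _).trans (mn_le h)

/-! ### Building blocks for expressions -/

/-- Word size and storage content are compatible. -/
structure Bounded (w M : ℕ) (mem : ℕ → ℕ) : Prop where
  le : M ≤ 2 ^ w
  lt : 16 < 2 ^ w
  mem : ∀ a, mem a < 2 ^ w

theorem Bounded.update {w M y v : ℕ} {mem : ℕ → ℕ} (h : Bounded w M mem) (hv : v < 2 ^ w) :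
    Bounded w M (Function.update mem y v) :=
  ⟨h.le, h.lt, fun a => by
    by_cases ha : a = y
    · subst ha; simpa
    · simpa [Function.update_of_ne ha] using h.mem a⟩

namespace Ex

/-- The address of cell `o` of region `i`. -/
def addr (i : ℕ) (o : Ex) : Ex := .add (.mul o (.lit 16)) (.lit i)

/-- The content of cell `o` of region `i`. -/
def get (i : ℕ) (o : Ex) : Ex := .load (addr i o)

/-- The constant (or state variable) number `k` of region `i`. -/
def cst (i k : ℕ) : Ex := .load (.lit (k * 16 + i))

def min (a b : Ex) : Ex := .ite a b a b

def pow (b : Ex) : ℕ → Ex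
  | 0 => .lit 1
  | k + 1 => .mul (b.pow k) b

/-- Remainder. -/
def mod (a b : Ex) : Ex := .sub a (.mul (.div a b) b)

/-- The least of the values `e 0, …, e k`. -/
def minUpTo (e : ℕ → Ex) : ℕ → Ex
  | 0 => e 0
  | k + 1 => .min (minUpTo e k) (e (k + 1))

end Ex

section
variable {w M : ℕ} {mem : ℕ → ℕ} {x : ℕ}

theorem Ev.of_eq {e : Ex} {v v' : ℕ} (h : Ev w M mem x e v) (hv : v = v') : Ev w M mem x e v' :=
  hv ▸ h

theorem Ev.addr (hb : Bounded w M mem) {i : ℕ} {e : Ex} {o : ℕ} (h : Ev w M mem x e o)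
    (ho : o * 16 + i < M) : Ev w M mem x (.addr i e) (o * 16 + i) := by
  have := hb.le
  exact .add (.mul h (.lit hb.lt) (by omega)) (.lit (by omega)) (by omega)

theorem Ev.get (hb : Bounded w M mem) {i : ℕ} {e : Ex} {o : ℕ} (h : Ev w M mem x e o)
    (ho : o * 16 + i < M) : Ev w M mem x (.get i e) (mem (o * 16 + i)) :=
  .load (.addr hb h ho) ho (hb.mem _)

theorem Ev.cst (hb : Bounded w M mem) {i k : ℕ} (hk : k * 16 + i < M) :
    Ev w M mem x (.cst i k) (mem (k * 16 + i)) :=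
  .load (.lit (hk.trans_le hb.le)) hk (hb.mem _)

theorem Ev.min {a b : Ex} {y z : ℕ} (ha : Ev w M mem x a y) (hb : Ev w M mem x b z) :
    Ev w M mem x (.min a b) (min y z) := by
  by_cases h : y < z
  · rw [min_eq_left h.le]; exact .ite_pos ha hb h ha
  · rw [min_eq_right (not_lt.mp h)]; exact .ite_neg ha hb h hb

theorem Ev.min_mn {a b : Ex} {N : ℕ} {S T : Set ℕ} (ha : Ev w M mem x a (mn N S))
    (hb : Ev w M mem x b (mn N T)) : Ev w M mem x (.min a b) (mn N (S ∪ T)) := by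
  rw [mn_union]; exact .min ha hb

theorem Ev.minUpTo {e : ℕ → Ex} {N : ℕ} {S : ℕ → Set ℕ} (k : ℕ)
    (h : ∀ i ≤ k, Ev w M mem x (e i) (mn N (S i))) :
    Ev w M mem x (.minUpTo e k) (mn N {y | ∃ i ≤ k, y ∈ S i}) := by
  induction k with
  | zero => simpa [Ex.minUpTo] using h 0 le_rfl
  | succ k ih =>
    have h1 := Ev.min_mn (ih fun i hi => h i (by omega)) (h (k + 1) le_rfl)
    refine h1.of_eq (congrArg _ (Set.ext fun y => Iff.symm ?_))
    constructor
    · rintro ⟨i, hi, hy⟩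
      rcases Nat.lt_or_ge k i with h | h
      · obtain rfl : i = k + 1 := by omega
        exact Or.inr hy
      · exact Or.inl ⟨i, h, hy⟩
    · rintro (⟨i, hi, hy⟩ | hy)
      · exact ⟨i, by omega, hy⟩
      · exact ⟨k + 1, le_rfl, hy⟩

theorem Ev.pow {b : Ex} {B : ℕ} (hB : 0 < B) (h : Ev w M mem x b B) (k : ℕ) (hk : B ^ k < 2 ^ w) :
    Ev w M mem x (b.pow k) (B ^ k) := by
  induction k with
  | zero => exact .lit (by simpa using hk)
  | succ k ih =>
    have h1 := ih (lt_of_le_of_lt (Nat.pow_le_pow_right hB (by omega)) hk)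
    rw [pow_succ] at hk ⊢
    exact .mul h1 h hk

theorem Ev.div' {a b : Ex} {y z : ℕ} (ha : Ev w M mem x a y) (hb : Ev w M mem x b z) :
    Ev w M mem x (.div a b) (y / z) :=
  .div ha hb ((Nat.div_le_self _ _).trans_lt ha.lt)

theorem Ev.sub' {a b : Ex} {y z : ℕ} (ha : Ev w M mem x a y) (hb : Ev w M mem x b z) :
    Ev w M mem x (.sub a b) (y - z) :=
  .sub ha hb ((Nat.sub_le _ _).trans_lt ha.lt)

theorem Ev.mod {a b : Ex} {y z : ℕ} (ha : Ev w M mem x a y) (hb : Ev w M mem x b z) :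
    Ev w M mem x (.mod a b) (y % z) := by
  rw [show y % z = y - y / z * z by
    rw [Nat.mod_eq_sub_div_mul]]
  exact .sub' ha (.mul (.div' ha hb) hb ((Nat.div_mul_le_self _ _).trans_lt ha.lt))

end

/-! ### Search tries for piecewise constant functions -/

/-- Descent in a trie with fan-out `B`: `C` holds the children (`0` for none), `W` the values. -/
def trieLookup (B : ℕ) (C W : ℕ → ℕ) : ℕ → ℕ → ℕ → ℕ
  | 0, _, _ => 0
  | j + 1, cur, z =>
    if 0 < C (cur * B + z / B ^ j % B) then trieLookup B C W j (C (cur * B + z / B ^ j % B)) z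
    else W (cur * B + z / B ^ j % B)

theorem eq_of_no_break {f : ℕ → ℕ} {a b : ℕ} (hab : a ≤ b)
    (h : ∀ z, a ≤ z → z < b → f z = f (z + 1)) : f a = f b := by
  induction b, hab using Nat.le_induction with
  | base => rfl
  | succ b hb ih => rw [ih fun z h1 h2 => h z h1 (by omega), h b hb (by omega)]

/-- Apart from the root, a node is kept only for a block of length B^j that contains a breakpoint,
which makes at most L nodes per breakpoint. On any other block f is constant, and its value at the
left end of the block is stored at the parent. -/
theorem exists_trie (B L : ℕ) (hB : 0 < B) (hL : 0 < L) (f : ℕ → ℕ) (bp : Finset ℕ)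
    (hbp : ∀ z, f z ≠ f (z + 1) → z ∈ bp) :
    ∃ (C W : ℕ → ℕ) (root : ℕ), root ≤ L * bp.card + 1 ∧ (∀ i, C i ≤ L * bp.card + 1) ∧
      (∀ i, ∃ z, W i = f z) ∧ ∀ z < B ^ L, trieLookup B C W L root z = f z := by
  classical
  let S : Finset (ℕ × ℕ) :=
    insert (L, 0) ((Finset.Ico 1 L ×ˢ bp).image fun t => (t.1, t.2 / B ^ t.1))
  have hcard : S.card ≤ L * bp.card + 1 := by
    refine (Finset.card_insert_le _ _).trans ?_
    have h1 : ((Finset.Ico 1 L ×ˢ bp).image fun t => (t.1, t.2 / B ^ t.1)).card ≤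
        (L - 1) * bp.card := by
      refine Finset.card_image_le.trans ?_
      simp
    have h2 : (L - 1) * bp.card ≤ L * bp.card := Nat.mul_le_mul_right _ (by omega)
    omega
  -- Numbering from 1 keeps 0 free as the mark of a missing child.
  let num : ℕ × ℕ → ℕ := fun s => if h : s ∈ S then (S.equivFin ⟨s, h⟩ : ℕ) + 1 else 0
  have hnum : ∀ s, num s ≤ L * bp.card + 1 := by
    intro s
    by_cases h : s ∈ S
    · simp only [num, h, dif_pos]
      have := (S.equivFin ⟨s, h⟩).isLt
      omega
    · simp [num, h]
  let dec : ℕ → ℕ × ℕ := fun i =>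
    if h : i - 1 < S.card then (S.equivFin.symm ⟨i - 1, h⟩ : ℕ × ℕ) else (0, 0)
  have hdec : ∀ s ∈ S, dec (num s) = s := by
    intro s h
    have : (S.equivFin ⟨s, h⟩ : ℕ) < S.card := (S.equivFin ⟨s, h⟩).isLt
    simp [num, dec, h]
  let C : ℕ → ℕ := fun i => num ((dec (i / B)).1 - 1, (dec (i / B)).2 * B + i % B)
  let W : ℕ → ℕ := fun i => f (((dec (i / B)).2 * B + i % B) * B ^ ((dec (i / B)).1 - 1))
  refine ⟨C, W, num (L, 0), hnum _, fun i => hnum _, fun i => ⟨_, rfl⟩, ?_⟩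
  have key : ∀ j z, (j, z / B ^ j) ∈ S → trieLookup B C W j (num (j, z / B ^ j)) z = f z := by
    intro j
    induction j with
    | zero =>
      intro z hz
      simp only [S, Finset.mem_insert, Finset.mem_image, Finset.mem_product, Prod.mk.injEq,
        Finset.mem_Ico] at hz
      rcases hz with h | ⟨t, h, h'⟩ <;> omega
    | succ j ih =>
      intro z hz
      have hd : z / B ^ j % B < B := Nat.mod_lt _ hB
      have e1 : (num (j + 1, z / B ^ (j + 1)) * B + z / B ^ j % B) / B =
          num (j + 1, z / B ^ (j + 1)) := by
        rw [mul_comm, Nat.mul_add_div hB, Nat.div_eq_of_lt hd, add_zero]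
      have e2 : (num (j + 1, z / B ^ (j + 1)) * B + z / B ^ j % B) % B = z / B ^ j % B := by
        rw [mul_comm, Nat.mul_add_mod, Nat.mod_mod]
      have e3 : z / B ^ (j + 1) * B + z / B ^ j % B = z / B ^ j := by
        rw [pow_succ, ← Nat.div_div_eq_div_mul]
        exact Nat.div_add_mod' _ _
      have hC : C (num (j + 1, z / B ^ (j + 1)) * B + z / B ^ j % B) = num (j, z / B ^ j) := by
        simp only [C, e1, e2, hdec _ hz, e3, Nat.add_sub_cancel]
      have hW : W (num (j + 1, z / B ^ (j + 1)) * B + z / B ^ j % B) =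
          f (z / B ^ j * B ^ j) := by
        simp only [W, e1, e2, hdec _ hz, e3, Nat.add_sub_cancel]
      rw [trieLookup, hC, hW]
      by_cases h : (j, z / B ^ j) ∈ S
      · rw [if_pos (by simp [num, h]), ih z h]
      · rw [if_neg (by simp [num, h])]
        -- A change of f between the left end of the block and z would be a breakpoint y in this
        -- block, so the block would have a node.
        refine eq_of_no_break (Nat.div_mul_le_self _ _) fun y h1 h2 => ?_
        by_contra hne
        apply h
        have hy : y / B ^ j = z / B ^ j :=
          le_antisymm (Nat.div_le_div_right h2.le) ((Nat.le_div_iff_mul_le (by positivity)).2 h1)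
        have hj : j ≠ 0 := by
          rintro rfl
          simp at h1
          omega
        have hj2 : j < L := by
          simp only [S, Finset.mem_insert, Finset.mem_image, Finset.mem_product, Prod.mk.injEq,
            Finset.mem_Ico] at hz
          rcases hz with h | ⟨t, h, h'⟩ <;> omega
        refine Finset.mem_insert_of_mem (Finset.mem_image.2 ⟨(j, y), ?_, by simp [hy]⟩)
        simp only [Finset.mem_product, Finset.mem_Ico]
        exact ⟨⟨by omega, hj2⟩, hbp y hne⟩
  intro z hz
  have := key L z (by rw [Nat.div_eq_of_lt hz]; exact Finset.mem_insert_self _ _)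
  rwa [Nat.div_eq_of_lt hz] at this

namespace Ex

/-- Descent in a trie with children in region 6 and values in region 7. -/
def trie (eB : Ex) : ℕ → Ex → Ex → Ex
  | 0, _, _ => .lit 0
  | j + 1, cur, z =>
    .ite (.lit 0) (.get 6 (.add (.mul cur eB) (.mod (.div z (eB.pow j)) eB)))
      (trie eB j (.get 6 (.add (.mul cur eB) (.mod (.div z (eB.pow j)) eB))) z)
      (.get 7 (.add (.mul cur eB) (.mod (.div z (eB.pow j)) eB)))

end Ex

theorem Ev.trie {w M : ℕ} {mem : ℕ → ℕ} {x : ℕ} (hb : Bounded w M mem) {eB ez : Ex}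
    {B : ℕ} {C W : ℕ → ℕ} {m z : ℕ} (hB : 0 < B) (heB : Ev w M mem x eB B)
    (hC : ∀ i < (m + 1) * B, mem (i * 16 + 6) = C i) (hC' : ∀ i, C i ≤ m)
    (hW : ∀ i < (m + 1) * B, mem (i * 16 + 7) = W i)
    (hM : (m + 1) * B * 16 ≤ M) (hz : Ev w M mem x ez z) :
    ∀ (j : ℕ) (ecur : Ex) (cur : ℕ), B ^ j < 2 ^ w → Ev w M mem x ecur cur → cur ≤ m →
      Ev w M mem x (.trie eB j ecur ez) (trieLookup B C W j cur z) := by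
  intro j
  induction j with
  | zero => intro ecur cur _ _ _; exact .lit (by positivity)
  | succ j ih =>
    intro ecur cur hj hcur hle
    have hj' : B ^ j < 2 ^ w := lt_of_le_of_lt (Nat.pow_le_pow_right hB (by omega)) hj
    have hd : z / B ^ j % B < B := Nat.mod_lt _ hB
    have h1 : cur * B + z / B ^ j % B < (m + 1) * B := by
      have : cur * B ≤ m * B := Nat.mul_le_mul_right _ hle
      rw [add_mul, one_mul]; omega
    have hMw := hb.le
    have hidx : Ev w M mem x (.add (.mul ecur eB) (.mod (.div ez (eB.pow j)) eB))
        (cur * B + z / B ^ j % B) :=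
      .add (.mul hcur heB (by omega)) (.mod (.div' hz (.pow hB heB j hj')) heB) (by omega)
    have hg6 := Ev.get hb (i := 6) hidx (by omega)
    have hg7 := Ev.get hb (i := 7) hidx (by omega)
    rw [hC _ h1] at hg6
    rw [hW _ h1] at hg7
    rw [trieLookup]
    split_ifs with h
    · exact .ite_pos (.lit (by positivity)) hg6 h (ih _ _ hj' hg6 (hC' _))
    · exact .ite_neg (.lit (by positivity)) hg6 h hg7

/-! ### A static index: the least entry above a threshold in a group -/

/-- The number z stands for the group z / R and the threshold z % R. The least entry can change only
where the threshold passes an entry, or where z leaves or enters a nonempty group; this charges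
three breakpoints to each entry. -/
theorem exists_breakpoints (N R : ℕ) (hR : 0 < R) (E : Finset (ℕ × ℕ)) :
    ∃ bp : Finset ℕ, bp.card ≤ 3 * E.card ∧ ∀ z,
      mn N {y | (z / R, y) ∈ E ∧ z % R ≤ y} ≠
        mn N {y | ((z + 1) / R, y) ∈ E ∧ (z + 1) % R ≤ y} → z ∈ bp := by
  classical
  refine ⟨E.image (fun t => t.1 * R + t.2) ∪ (E.image (fun t => t.1 * R + (R - 1)) ∪
    E.image (fun t => t.1 * R - 1)), ?_, ?_⟩
  · refine (Finset.card_union_le _ _).trans ?_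
    have h1 := Finset.card_union_le (E.image (fun t => t.1 * R + (R - 1)))
      (E.image (fun t => t.1 * R - 1))
    have h2 := Finset.card_image_le (s := E) (f := fun t => t.1 * R + t.2)
    have h3 := Finset.card_image_le (s := E) (f := fun t => t.1 * R + (R - 1))
    have h4 := Finset.card_image_le (s := E) (f := fun t => t.1 * R - 1)
    omega
  · intro z hne
    by_contra hz
    apply hne
    simp only [Finset.mem_union, Finset.mem_image, not_or, not_exists, not_and] at hz
    obtain ⟨h1, h2, h3⟩ := hz
    have hdm := Nat.div_add_mod' z R
    have hlt := Nat.mod_lt z hR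
    congr 1
    ext y
    simp only [Set.mem_ofPred_eq]
    by_cases h : z % R + 1 < R
    · have e : z + 1 = R * (z / R) + (z % R + 1) := by rw [mul_comm]; omega
      rw [e, Nat.mul_add_div hR, Nat.mul_add_mod, Nat.div_eq_of_lt h, Nat.mod_eq_of_lt h, add_zero]
      refine and_congr_right fun hy => ⟨fun h4 => ?_, fun h4 => by omega⟩
      rcases Nat.lt_or_ge (z % R) y with h5 | h5
      · omega
      · have : z % R = y := by omega
        exact absurd (by simp only; omega) (h1 _ hy)
    · have e : z + 1 = R * (z / R + 1) := by rw [mul_add, mul_comm]; omega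
      have e2 : (z + 1) / R = z / R + 1 := by rw [e, Nat.mul_div_cancel_left _ hR]
      refine iff_of_false ?_ ?_
      · rintro ⟨hy, -⟩
        exact h2 _ hy (by simp only; omega)
      · rintro ⟨hy, -⟩
        rw [e2] at hy
        exact h3 _ hy (by simp only; rw [mul_comm, ← e]; rfl)

/-- The storage holds, in regions 0, 6 and 7, a search structure for the groups of `E`. -/
structure HasIndex (M B K N : ℕ) (E : Finset (List ℕ × ℕ)) (mem : ℕ → ℕ) : Prop where
  pos : 0 < B
  base : mem (0 * 16 + 0) = B
  le : 2 * 16 ≤ M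
  exists_trie : ∃ (C W : ℕ → ℕ) (m : ℕ), (∀ i < (m + 1) * B, mem (i * 16 + 6) = C i) ∧
    (∀ i, C i ≤ m) ∧ (∀ i < (m + 1) * B, mem (i * 16 + 7) = W i) ∧ (m + 1) * B * 16 ≤ M ∧
    mem (1 * 16 + 0) ≤ m ∧
    ∀ g : List ℕ, g.length = 6 → (∀ d ∈ g, d < B ^ (K + 1)) → ∀ X < B ^ (K + 1),
      trieLookup B C W (7 * (K + 1)) (mem (1 * 16 + 0)) (Nat.ofDigits (B ^ (K + 1)) (X :: g)) =
        mn N {y | (g, y) ∈ E ∧ X ≤ y}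

/-- A group name of six digits in base R = B^(K+1), with the threshold as the lowest digit, is one
number below R^7, and a single trie over base-B digits serves all groups. -/
theorem exists_index (B K N : ℕ) (hB : 2 ≤ B) (E : Finset (List ℕ × ℕ)) :
    ∃ (C W : ℕ → ℕ) (root : ℕ), root ≤ 7 * (K + 1) * (3 * E.card) + 1 ∧
      (∀ i, C i ≤ 7 * (K + 1) * (3 * E.card) + 1) ∧ (∀ i, W i ≤ N) ∧
      ∀ g : List ℕ, g.length = 6 → (∀ d ∈ g, d < B ^ (K + 1)) → ∀ X < B ^ (K + 1),
        trieLookup B C W (7 * (K + 1)) root (Nat.ofDigits (B ^ (K + 1)) (X :: g)) =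
          mn N {y | (g, y) ∈ E ∧ X ≤ y} := by
  classical
  set R := B ^ (K + 1) with hRdef
  have hR : 1 < R := Nat.one_lt_pow (by omega) (by omega)
  let E' : Finset (ℕ × ℕ) := (E.filter fun t => t.1.length = 6 ∧ ∀ d ∈ t.1, d < R).image
    fun t => (Nat.ofDigits R t.1, t.2)
  have hE' : E'.card ≤ E.card := Finset.card_image_le.trans (Finset.card_filter_le _ _)
  obtain ⟨bp, hbp, hb⟩ := exists_breakpoints N R (by omega) E'
  obtain ⟨C, W, root, h1, h2, h3, h4⟩ := exists_trie B (7 * (K + 1)) (by omega) (by omega)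
    (fun z => mn N {y | (z / R, y) ∈ E' ∧ z % R ≤ y}) bp hb
  have hle : 7 * (K + 1) * bp.card + 1 ≤ 7 * (K + 1) * (3 * E.card) + 1 :=
    Nat.add_le_add_right (Nat.mul_le_mul_left _ (by omega)) 1
  refine ⟨C, W, root, h1.trans hle, fun i => (h2 i).trans hle, fun i => ?_, ?_⟩
  · obtain ⟨z, hz⟩ := h3 i
    rw [hz]; exact mn_le_top _ _
  · intro g hg hd X hX
    have hlt : Nat.ofDigits R (X :: g) < B ^ (7 * (K + 1)) := by
      have := Nat.ofDigits_lt_base_pow_length (b := R) (l := X :: g) hR (by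
        intro d hdm
        rcases List.mem_cons.1 hdm with rfl | h
        · exact hX
        · exact hd d h)
      rw [List.length_cons, hg] at this
      rw [mul_comm, pow_mul]
      exact this
    rw [h4 _ hlt]
    have e1 : Nat.ofDigits R (X :: g) / R = Nat.ofDigits R g := by
      rw [Nat.ofDigits_cons, Nat.add_mul_div_left _ _ (by omega)]
      simp [Nat.div_eq_of_lt hX]
    have e2 : Nat.ofDigits R (X :: g) % R = X := by
      rw [Nat.ofDigits_cons, Nat.add_mul_mod_self_left]
      exact Nat.mod_eq_of_lt hX
    simp only [e1, e2]
    congr 1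
    ext y
    simp only [Set.mem_ofPred_eq]
    refine and_congr_left fun _ => ?_
    simp only [E', Finset.mem_image, Finset.mem_filter, Prod.mk.injEq]
    constructor
    · rintro ⟨t, ⟨ht, hl, hd'⟩, h5, h6⟩
      have := Nat.ofDigits_inj_of_len_eq hR (by rw [hl, hg]) hd' hd h5
      rw [← this, ← h6]
      exact ht
    · intro h
      exact ⟨(g, y), ⟨h, hg, hd⟩, rfl, rfl⟩

namespace Ex

def digits (eR : Ex) : List Ex → Ex
  | [] => .lit 0
  | d :: l => .add d (.mul eR (digits eR l))

/-- The base `B`. -/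
def base : Ex := .cst 0 0

/-- The least entry `≥ X` of the group `g`. -/
def look (K : ℕ) (g : List Ex) (X : Ex) : Ex :=
  .trie .base (7 * (K + 1)) (.cst 0 1) (.digits (base.pow (K + 1)) (X :: g))

def max (a b : Ex) : Ex := .ite a b b a

/-- `⌈a / b⌉` -/
def cdiv (a b : Ex) : Ex := .div (.sub (.add a b) (.lit 1)) b

/-- The least `y ≥ X` such that `(α, β, y)` is a point with `a₁ ≤ α < a₂`, `β < b`. -/
def range (K tag : ℕ) (a₁ a₂ b X : Ex) : Ex :=
  minUpTo (fun k => minUpTo (fun k' =>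
    .min
      (look K [.div b (base.pow k'), .min (.add (.cdiv a₁ (base.pow k)) base) (.div a₂ (base.pow k)),
        .cdiv a₁ (base.pow k), .lit k', .lit k, .lit tag] X)
      (look K [.div b (base.pow k'), .div a₂ (base.pow k),
        .max (.sub (.div a₂ (base.pow k)) base) (.cdiv a₁ (base.pow k)), .lit k', .lit k, .lit tag]
        X)) K) K

end Ex

section
variable {w M : ℕ} {mem : ℕ → ℕ} {x : ℕ}

theorem Ev.max {a b : Ex} {y z : ℕ} (ha : Ev w M mem x a y) (hb : Ev w M mem x b z) :
    Ev w M mem x (.max a b) (max y z) := by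
  by_cases h : y < z
  · rw [max_eq_right h.le]; exact .ite_pos ha hb h hb
  · rw [max_eq_left (not_lt.mp h)]; exact .ite_neg ha hb h ha

theorem Ev.cdiv {a b : Ex} {y z : ℕ} (ha : Ev w M mem x a y) (hb : Ev w M mem x b z)
    (h : y + z < 2 ^ w) (h1 : 1 < 2 ^ w) : Ev w M mem x (.cdiv a b) ((y + z - 1) / z) :=
  .div' (.sub' (.add ha hb h) (.lit h1)) hb

theorem Ev.digits {eR : Ex} {R : ℕ} (hR : 0 < R) (h : Ev w M mem x eR R) {es : List Ex}
    {ds : List ℕ} (hs : List.Forall₂ (Ev w M mem x) es ds) (hlt : Nat.ofDigits R ds < 2 ^ w) :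
    Ev w M mem x (.digits eR es) (Nat.ofDigits R ds) := by
  induction hs with
  | nil => exact .lit (by simp)
  | @cons a b l l' hab _ ih =>
    rw [Nat.ofDigits_cons] at hlt ⊢
    have h1 : R * Nat.ofDigits R l' < 2 ^ w := by
      omega
    exact .add hab (.mul h (ih ((Nat.le_mul_of_pos_left _ hR).trans_lt h1)) h1) hlt

theorem Ev.base {B K N : ℕ} {E : Finset (List ℕ × ℕ)} (hb : Bounded w M mem)
    (hi : HasIndex M B K N E mem) : Ev w M mem x .base B :=
  (Ev.cst hb (by have := hi.le; omega)).of_eq hi.base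

theorem Ev.look {B K N : ℕ} {E : Finset (List ℕ × ℕ)} (hb : Bounded w M mem)
    (hi : HasIndex M B K N E mem) (hw : B ^ (7 * (K + 1)) < 2 ^ w) {es : List Ex} {g : List ℕ}
    {eX : Ex} {X : ℕ} (hs : List.Forall₂ (Ev w M mem x) es g) (hX : Ev w M mem x eX X)
    (hg : g.length = 6) (hd : ∀ d ∈ g, d < B ^ (K + 1)) (hXR : X < B ^ (K + 1)) :
    Ev w M mem x (.look K es eX) (mn N {y | (g, y) ∈ E ∧ X ≤ y}) := by
  obtain ⟨C, W, m, h1, h2, h3, h4, h5, h6⟩ := hi.exists_trie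
  -- `HasIndex` only provides 0 < B. In base 1 all digits are 0, and the usual bound for
  -- `Nat.ofDigits` does not apply.
  have hR1 : 1 < B ^ (K + 1) ∨ B ^ (K + 1) = 1 := by
    have := Nat.pow_pos (n := K + 1) hi.pos
    omega
  have hz : Nat.ofDigits (B ^ (K + 1)) (X :: g) < 2 ^ w := by
    refine lt_of_le_of_lt ?_ hw
    rcases hR1 with hR | hR
    · have := Nat.ofDigits_lt_base_pow_length (b := B ^ (K + 1)) (l := X :: g) hR (by
        intro d hdm
        rcases List.mem_cons.1 hdm with rfl | h
        · exact hXR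
        · exact hd d h)
      rw [List.length_cons, hg] at this
      rw [mul_comm, pow_mul]
      exact this.le
    · have h0 : ∀ l : List ℕ, (∀ d ∈ l, d < 1) → Nat.ofDigits 1 l = 0 := by
        intro l
        induction l with
        | nil => intro _; rfl
        | cons a l ih =>
          intro h
          have := h a (by simp)
          rw [Nat.ofDigits_cons, ih fun d hd => h d (by simp [hd])]
          simp; omega
      rw [hR] at hd hXR ⊢
      rw [h0]
      · exact Nat.zero_le _
      · intro d hdm
        rcases List.mem_cons.1 hdm with rfl | h
        · exact hXR
        · exact hd d h
  have hwR : B ^ (K + 1) < 2 ^ w :=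
    lt_of_le_of_lt (Nat.pow_le_pow_right hi.pos (by omega)) hw
  have hbase := Ev.base (x := x) hb hi
  have hR := Ev.pow hi.pos hbase (K + 1) hwR
  have hdig := Ev.digits (Nat.pow_pos hi.pos) hR (List.Forall₂.cons hX hs) hz
  exact (Ev.trie hb hi.pos hbase h1 h2 h3 h4 hdig (7 * (K + 1)) _ _ hw
    (Ev.cst hb (by have := hi.le; omega)) h5).of_eq (h6 g hg hd X hXR)

end

/-! ### Range queries -/

/-- Take the coarsest level at which the block of α lies wholly inside [a₁, a₂). If it were far from
both ends, counted in blocks, its parent block would also lie inside; at level K there are fewer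
than B blocks to the left of a₂ anyway. -/
theorem exists_level {α a₁ a₂ B K : ℕ} (hB : 0 < B) (h1 : a₁ ≤ α) (h2 : α < a₂)
    (h3 : a₂ < B ^ (K + 1)) :
    ∃ k ≤ K, (a₁ + B ^ k - 1) / B ^ k ≤ α / B ^ k ∧ α / B ^ k < a₂ / B ^ k ∧
      (α / B ^ k < (a₁ + B ^ k - 1) / B ^ k + B ∨ a₂ / B ^ k < α / B ^ k + B + 1) := by
  classical
  let p : ℕ → Prop := fun k => (a₁ + B ^ k - 1) / B ^ k ≤ α / B ^ k ∧ α / B ^ k < a₂ / B ^ k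
  have p0 : p 0 := by simp [p]; omega
  have hk := Nat.findGreatest_spec (P := p) (Nat.zero_le K) p0
  set k := Nat.findGreatest p K with hkdef
  have hkK : k ≤ K := Nat.findGreatest_le K
  refine ⟨k, hkK, hk.1, hk.2, ?_⟩
  by_contra hcon
  push Not at hcon
  obtain ⟨hc1, hc2⟩ := hcon
  have hpos : 0 < B ^ k := Nat.pow_pos hB
  have hpos' : 0 < B ^ (k + 1) := Nat.pow_pos hB
  rcases Nat.lt_or_ge k K with hlt | hge
  · have hn : ¬ p (k + 1) := Nat.findGreatest_is_greatest (by omega) hlt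
    apply hn
    have e : ∀ y, y / B ^ (k + 1) = y / B ^ k / B := fun y => by
      rw [pow_succ, Nat.div_div_eq_div_mul]
    constructor
    -- Rounding up to the next coarser level moves the left end by less than one coarse block, that
    -- is, B fine blocks.
    · have h4 : (a₁ + B ^ (k + 1) - 1) / B ^ (k + 1) ≤ ((a₁ + B ^ k - 1) / B ^ k + B) / B := by
        rw [e]
        refine Nat.div_le_div_right ?_
        rw [← Nat.add_mul_div_left _ _ hpos, ← pow_succ]
        exact Nat.div_le_div_right (by omega)
      rw [e α]
      exact h4.trans (Nat.div_le_div_right hc1)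
    · rw [e, e, Nat.div_lt_iff_lt_mul hB]
      have h5 : α / B ^ k + B < a₂ / B ^ k := by omega
      have h6 := Nat.div_add_mod' (a₂ / B ^ k) B
      have h7 := Nat.mod_lt (a₂ / B ^ k) hB
      omega
  · have hkK' : k = K := by omega
    have : a₂ / B ^ k < B := by
      rw [Nat.div_lt_iff_lt_mul hpos, hkK', mul_comm, ← pow_succ]; exact h3
    have h0 := Nat.zero_le (α / B ^ k)
    omega

/-- The one-sided variant: at the coarsest level that still separates β from b, at most B blocks lie
between them, as otherwise the parent blocks would be separated too. -/
theorem exists_level_zero {β b B K : ℕ} (hB : 0 < B) (h2 : β < b) (h3 : b < B ^ (K + 1)) :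
    ∃ k ≤ K, b / B ^ k ≤ β / B ^ k + B ∧ β / B ^ k < b / B ^ k := by
  classical
  let p : ℕ → Prop := fun k => β / B ^ k < b / B ^ k
  have p0 : p 0 := by simpa [p] using h2
  have hk := Nat.findGreatest_spec (P := p) (Nat.zero_le K) p0
  set k := Nat.findGreatest p K with hkdef
  have hkK : k ≤ K := Nat.findGreatest_le K
  refine ⟨k, hkK, ?_, hk⟩
  by_contra hcon
  push Not at hcon
  have hpos : 0 < B ^ k := Nat.pow_pos hB
  rcases Nat.lt_or_ge k K with hlt | hge
  · have hn : ¬ p (k + 1) := Nat.findGreatest_is_greatest (by omega) hlt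
    apply hn
    have e : ∀ y, y / B ^ (k + 1) = y / B ^ k / B := fun y => by
      rw [pow_succ, Nat.div_div_eq_div_mul]
    change β / B ^ (k + 1) < b / B ^ (k + 1)
    rw [e, e, Nat.div_lt_iff_lt_mul hB]
    have h6 := Nat.div_add_mod' (b / B ^ k) B
    have h7 := Nat.mod_lt (b / B ^ k) hB
    omega
  · have hkK' : k = K := by omega
    have : b / B ^ k < B := by
      rw [Nat.div_lt_iff_lt_mul hpos, hkK', mul_comm, ← pow_succ]; exact h3
    have h0 := Nat.zero_le (β / B ^ k)
    omega

/-- The groups that serve range queries among the points `P`. -/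
def rangeGroups (B K tag : ℕ) (P : Finset (ℕ × ℕ × ℕ)) : Finset (List ℕ × ℕ) :=
  (P ×ˢ Finset.range (K + 1) ×ˢ Finset.range (K + 1) ×ˢ Finset.range B ×ˢ Finset.range B ×ˢ
    Finset.range B).image fun t =>
      ([t.1.2.1 / B ^ t.2.2.1 + 1 + t.2.2.2.1, t.1.1 / B ^ t.2.1 + 1 + t.2.2.2.2.1,
        t.1.1 / B ^ t.2.1 - t.2.2.2.2.2, t.2.2.1, t.2.1, tag], t.1.2.2)

theorem card_rangeGroups_le (B K tag : ℕ) (P : Finset (ℕ × ℕ × ℕ)) :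
    (rangeGroups B K tag P).card ≤ P.card * ((K + 1) ^ 2 * B ^ 3) := by
  refine Finset.card_image_le.trans (le_of_eq ?_)
  simp only [Finset.card_product, Finset.card_range]
  ring

/-- A group is a window [u, v) of α-blocks together with the window of the B blocks of β just below
b. A window of at most B blocks has both ends at offsets below B from any block in it, so the B
choices per offset reach all such windows. -/
theorem mem_rangeGroups {B K tag : ℕ} {P : Finset (ℕ × ℕ × ℕ)} {k k' u v b y : ℕ} (hk : k ≤ K)
    (hk' : k' ≤ K) (huv : v ≤ u + B) :
    ([b, v, u, k', k, tag], y) ∈ rangeGroups B K tag P ↔ ∃ α β, (α, β, y) ∈ P ∧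
      u ≤ α / B ^ k ∧ α / B ^ k < v ∧ b ≤ β / B ^ k' + B ∧ β / B ^ k' < b := by
  simp only [rangeGroups, Finset.mem_image, Finset.mem_product, Finset.mem_range, Prod.exists,
    Prod.mk.injEq, List.cons.injEq]
  constructor
  · rintro ⟨α, β, y', l, l', j, i, i', ⟨hP, h1, h2, h3, h4, h5⟩,
      ⟨h6, h7, h8, rfl, rfl, -⟩, rfl⟩
    have h9 := Nat.zero_le (α / B ^ l)
    exact ⟨α, β, hP, by omega, by omega, by omega, by omega⟩
  · rintro ⟨α, β, hP, h1, h2, h3, h4⟩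
    have h9 := Nat.zero_le (α / B ^ k)
    have h10 := Nat.zero_le (β / B ^ k')
    exact ⟨α, β, y, k, k', b - β / B ^ k' - 1, v - α / B ^ k - 1, α / B ^ k - u,
      ⟨hP, by omega, by omega, by omega, by omega, by omega⟩,
      ⟨by omega, by omega, by omega, rfl, rfl, trivial⟩, rfl⟩

/-- For each pair of levels two windows are inspected, one at the left and one at the right end of
[a₁, a₂). Each window contains only points of the range, and `exists_level` and `exists_level_zero`
put every point of the range into one of them; overlaps do not hurt a minimum. -/
theorem Ev.range {w M : ℕ} {mem : ℕ → ℕ} {x : ℕ} {B K N : ℕ} {E : Finset (List ℕ × ℕ)}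
    (hb : Bounded w M mem) (hi : HasIndex M B K N E mem) (hw : B ^ (7 * (K + 1)) < 2 ^ w)
    (hKB : K < B) {tag : ℕ} (htag : tag < B) {P : Finset (ℕ × ℕ × ℕ)}
    (hE : ∀ v u u' k k' y, ([v, u, u', k, k', tag], y) ∈ E ↔
      ([v, u, u', k, k', tag], y) ∈ rangeGroups B K tag P)
    {e₁ e₂ e₃ eX : Ex} {a₁ a₂ b X : ℕ} (h1 : Ev w M mem x e₁ a₁) (h2 : Ev w M mem x e₂ a₂)
    (h3 : Ev w M mem x e₃ b) (hX : Ev w M mem x eX X) (h1R : a₁ < B ^ (K + 1))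
    (h2R : a₂ < B ^ (K + 1)) (h3R : b < B ^ (K + 1)) (hXR : X < B ^ (K + 1)) :
    Ev w M mem x (.range K tag e₁ e₂ e₃ eX)
      (mn N {y | X ≤ y ∧ ∃ α β, (α, β, y) ∈ P ∧ a₁ ≤ α ∧ α < a₂ ∧ β < b}) := by
  have hB := hi.pos
  have hwR2 : B ^ (K + 1) * B ^ (K + 1) < 2 ^ w := by
    rw [← pow_add]
    exact lt_of_le_of_lt (Nat.pow_le_pow_right hB (by omega)) hw
  have hBR : B ≤ B ^ (K + 1) := Nat.le_self_pow (by omega) B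
  have hB2 : 2 * B ^ (K + 1) ≤ B ^ (K + 1) * B ^ (K + 1) ∨ B = 1 := by
    by_cases h : B = 1
    · exact Or.inr h
    · exact Or.inl (Nat.mul_le_mul_right _ (by omega))
  have h32 := hb.lt
  have hadd : ∀ y z, y ≤ B ^ (K + 1) → z ≤ B ^ (K + 1) → y + z < 2 ^ w := by
    intro y z hy hz
    rcases hB2 with h | h
    · omega
    · rw [h, one_pow] at hy hz
      omega
  have hpk : ∀ k ≤ K, B ^ k ≤ B ^ (K + 1) := fun k hk => Nat.pow_le_pow_right hB (by omega)
  have hpw : ∀ k ≤ K, Ev w M mem x (Ex.base.pow k) (B ^ k) := fun k hk =>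
    .pow hB (.base hb hi) k (by have := hpk k hk; have := hadd _ 0 this (by omega); omega)
  have hcd : ∀ k ≤ K, (a₁ + B ^ k - 1) / B ^ k ≤ a₁ := by
    intro k _
    have : 0 < B ^ k := Nat.pow_pos hB
    rw [Nat.div_le_iff_le_mul_add_pred this]
    have : a₁ ≤ B ^ k * a₁ := Nat.le_mul_of_pos_left _ this
    omega
  have hlook : ∀ k ≤ K, ∀ k' ≤ K, ∀ u v (eu ev : Ex), Ev w M mem x eu u → Ev w M mem x ev v →
      v ≤ u + B → u < B ^ (K + 1) → v < B ^ (K + 1) →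
      Ev w M mem x (.look K [.div e₃ (Ex.base.pow k'), ev, eu, .lit k', .lit k, .lit tag] eX)
        (mn N {y | X ≤ y ∧ ∃ α β, (α, β, y) ∈ P ∧ u ≤ α / B ^ k ∧ α / B ^ k < v ∧
          b / B ^ k' ≤ β / B ^ k' + B ∧ β / B ^ k' < b / B ^ k'}) := by
    intro k hk k' hk' u v eu ev hu hv huv huR hvR
    have hl : ∀ l, l < B → Ev w M mem x (.lit l) l := fun l hl => .lit (by
      have := hadd l 0 (by omega) (by omega)
      omega)
    have := Ev.look (K := K) hb hi hw (g := [b / B ^ k', v, u, k', k, tag])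
      (.cons (.div' h3 (hpw k' hk')) (.cons hv (.cons hu (.cons (hl _ (by omega))
        (.cons (hl _ (by omega)) (.cons (hl _ htag) .nil)))))) hX rfl (by
          have := Nat.div_le_self b (B ^ k')
          intro d hd
          simp only [List.mem_cons, List.not_mem_nil, or_false] at hd
          rcases hd with rfl | rfl | rfl | rfl | rfl | rfl <;> omega) hXR
    refine this.of_eq (congrArg _ (Set.ext fun y => ?_))
    simp only [Set.mem_ofPred_eq]
    rw [and_comm]
    refine and_congr_right fun _ => ?_
    rw [← mem_rangeGroups hk hk' huv, hE]
  refine (Ev.minUpTo K fun k hk => Ev.minUpTo K fun k' hk' => Ev.min_mn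
    (hlook k hk k' hk' _ _ _ _ (.cdiv h1 (hpw k hk) (hadd _ _ h1R.le (hpk k hk)) (by omega))
      (.min (.add (.cdiv h1 (hpw k hk) (hadd _ _ h1R.le (hpk k hk)) (by omega)) (.base hb hi)
        (hadd _ _ ((hcd k hk).trans h1R.le) hBR)) (.div' h2 (hpw k hk)))
      (min_le_left _ _) ((hcd k hk).trans_lt h1R)
      ((min_le_right _ _).trans_lt ((Nat.div_le_self _ _).trans_lt h2R)))
    (hlook k hk k' hk' _ _ _ _ (.max (.sub' (.div' h2 (hpw k hk)) (.base hb hi))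
      (.cdiv h1 (hpw k hk) (hadd _ _ h1R.le (hpk k hk)) (by omega))) (.div' h2 (hpw k hk))
      (by have := le_max_left (a₂ / B ^ k - B) ((a₁ + B ^ k - 1) / B ^ k); omega)
      (max_lt ((Nat.sub_le _ _).trans_lt ((Nat.div_le_self _ _).trans_lt h2R))
        ((hcd k hk).trans_lt h1R))
      ((Nat.div_le_self _ _).trans_lt h2R))).of_eq (congrArg _ (Set.ext fun y => ?_))
  have hin : ∀ k α, (a₁ + B ^ k - 1) / B ^ k ≤ α / B ^ k → a₁ ≤ α := by
    intro k α h
    have hp : 0 < B ^ k := Nat.pow_pos hB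
    by_contra hlt
    push Not at hlt
    have h4 : α / B ^ k + 1 ≤ (a₁ + B ^ k - 1) / B ^ k := by
      rw [← Nat.add_div_right _ hp]
      exact Nat.div_le_div_right (by omega)
    omega
  have hin2 : ∀ k α b, α / B ^ k < b / B ^ k → α < b := by
    intro k α b h
    by_contra hge
    push Not at hge
    have := Nat.div_le_div_right (c := B ^ k) hge
    omega
  simp only [Set.mem_ofPred_eq]
  constructor
  · rintro ⟨k, hk, k', hk', ⟨hy, α, β, hP, h4, h5, h6, h7⟩ | ⟨hy, α, β, hP, h4, h5, h6, h7⟩⟩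
    · exact ⟨hy, α, β, hP, hin k α h4, hin2 k _ _ (h5.trans_le (min_le_right _ _)), hin2 k' _ _ h7⟩
    · exact ⟨hy, α, β, hP, hin k α ((le_max_right _ _).trans h4), hin2 k _ _ h5, hin2 k' _ _ h7⟩
  · rintro ⟨hy, α, β, hP, h4, h5, h6⟩
    obtain ⟨k, hk, h7, h8, h9⟩ := exists_level hB h4 h5 h2R
    obtain ⟨k', hk', h10, h11⟩ := exists_level_zero hB h6 h3R
    refine ⟨k, hk, k', hk', ?_⟩
    rcases h9 with h9 | h9
    · exact Or.inl ⟨hy, α, β, hP, h7, lt_min h9 h8, h10, h11⟩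
    · exact Or.inr ⟨hy, α, β, hP, max_le (by have := Nat.zero_le (α / B ^ k); omega) h7, h8, h10, h11⟩

/-! ### Labelled lines -/

/-- A line of positions, each with a key and a type of request. -/
structure Line where
  key : ℕ → ℕ
  ty : ℕ → Op

namespace Line

variable (G : Line)

/-- The key `y` is inserted or deleted at a position of `[l, h)`. -/
def Occ (l h y : ℕ) : Prop := ∃ q, l ≤ q ∧ q < h ∧ G.ty q ≠ .query ∧ G.key q = y

/-- The set of active keys after the request at position `p`. -/
def step (A : Set ℕ) (p : ℕ) : Set ℕ :=
  match G.ty p with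
  | .insert => A ∪ {G.key p}
  | .delete => A \ {G.key p}
  | .query => A

variable {G}

theorem Occ.mono {l h l' h' y : ℕ} (ho : G.Occ l h y) (hl : l' ≤ l) (hh : h ≤ h') :
    G.Occ l' h' y := by
  obtain ⟨q, h1, h2, h3⟩ := ho
  exact ⟨q, hl.trans h1, h2.trans_le hh, h3⟩

theorem mem_step {A : Set ℕ} {l h p y : ℕ} (ho : ¬ G.Occ l h y) (h1 : l ≤ p) (h2 : p < h) :
    y ∈ G.step A p ↔ y ∈ A := by
  unfold step
  have hk : G.ty p ≠ .query → y ≠ G.key p := fun hq e => ho ⟨p, h1, h2, hq, e.symm⟩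
  cases ht : G.ty p <;> simp_all

theorem mem_step_self {A : Set ℕ} {p : ℕ} (h : G.ty p ≠ .query) :
    G.key p ∈ G.step A p ↔ G.ty p = .insert := by
  unfold step
  cases ht : G.ty p <;> simp_all

variable (G)

/-- Which keys at positions of `[l, c)` and of `(r, h]` are active can be read off from the line. -/
structure Claim (A : Set ℕ) (r c l h : ℕ) : Prop where
  left : ∀ q, l ≤ q → q < c → G.ty q ≠ .query → ¬ G.Occ (q + 1) (r + 1) (G.key q) →
    (G.key q ∈ A ↔ G.ty q = .insert)
  right : ∀ q, r < q → q ≤ h → G.ty q ≠ .query → ¬ G.Occ l q (G.key q) →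
    (G.key q ∈ A ↔ G.ty q = .insert)

variable {G}

/-- A request in [c, r] touches only a key that occurs there, and such keys are excluded by the side
conditions of both claims. -/
theorem Claim.step {A : Set ℕ} {r c l h p : ℕ} (hc : G.Claim A r c l h) (h1 : l ≤ c) (h2 : c ≤ p)
    (h3 : p ≤ r) : G.Claim (G.step A p) r c l h := by
  refine ⟨fun q a b d e => ?_, fun q a b d e => ?_⟩
  · rw [mem_step e (by omega) (by omega)]; exact hc.left q a b d e
  · rw [mem_step e (by omega) (by omega)]; exact hc.right q a b d e

theorem Claim.mono {A : Set ℕ} {r c c' l h : ℕ} (hc : G.Claim A r c l h) (h1 : c' ≤ c) :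
    G.Claim A r c' l h :=
  ⟨fun q a b => hc.left q a (b.trans_le h1), hc.right⟩

/-- The position p + 1 is now the latest visit and becomes the end of the left-to-right part; every
other key spoken of is absent from it and keeps its status. -/
theorem Claim.move_right {A : Set ℕ} {p l h : ℕ} (hl : l ≤ p + 1)
    (hL : ∀ q, l ≤ q → q < p + 1 → G.ty q ≠ .query → ¬ G.Occ (q + 1) (p + 1 + 1) (G.key q) →
      (G.key q ∈ A ↔ G.ty q = .insert))
    (hR : ∀ q, p + 1 < q → q ≤ h → G.ty q ≠ .query →
      ¬ G.Occ l q (G.key q) → (G.key q ∈ A ↔ G.ty q = .insert)) :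
    G.Claim (G.step A (p + 1)) (p + 1) (p + 1 + 1) l h := by
  refine ⟨fun q i1 i2 i3 i4 => ?_, fun q i1 i2 i3 i4 => ?_⟩
  · rcases Nat.lt_or_ge p q with hq | hq
    · obtain rfl : q = p + 1 := by omega
      exact mem_step_self i3
    · rw [mem_step i4 (by omega) (by omega)]
      exact hL q i1 (by omega) i3 i4
  · rw [mem_step i4 (by omega) (by omega)]
    exact hR q i1 i2 i3 i4

/-- When p becomes the left end of its interval, the left-to-right part is p alone, and everything
else belongs to the right part. -/
theorem Claim.move_left {A : Set ℕ} {p h : ℕ}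
    (hR : ∀ q, p < q → q ≤ h → G.ty q ≠ .query →
      ¬ G.Occ p q (G.key q) → (G.key q ∈ A ↔ G.ty q = .insert)) :
    G.Claim (G.step A p) p (p + 1) p h := by
  refine ⟨fun q i1 i2 i3 i4 => ?_, fun q i1 i2 i3 i4 => ?_⟩
  · obtain rfl : q = p := by omega
    exact mem_step_self i3
  · rw [mem_step i4 le_rfl (by omega)]
    exact hR q i1 i2 i3 i4

/-- What is known at the current position `p` extends to the claims on the right. -/
theorem Claim.right_self {A : Set ℕ} {p l h q : ℕ} (hc : G.Claim A p (p + 1) l h) (hl : l ≤ p)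
    (h1 : p ≤ q) (h2 : q ≤ h) (h3 : G.ty q ≠ .query) (h4 : ¬ G.Occ l q (G.key q) ∨ q = p) :
    G.key q ∈ A ↔ G.ty q = .insert := by
  by_cases hq : q = p
  · subst hq
    refine hc.left _ hl (by omega) h3 ?_
    rintro ⟨q', h1, h2, -⟩
    omega
  · exact hc.right q (by omega) h2 h3 (h4.resolve_right hq)

end Line

/-- The left end of the first interval of `st`, or `a`. -/
def nextL (a : ℕ) : List (ℕ × ℕ) → ℕ
  | [] => a
  | e :: _ => e.1

/-- The right end of the first interval of `st`, or `b`. -/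
def nextH (b : ℕ) : List (ℕ × ℕ) → ℕ
  | [] => b
  | e :: _ => e.2

/-- The intervals of `st`, and finally `[a, b]`, are nested. -/
def Nest (a b : ℕ) : List (ℕ × ℕ) → Prop
  | [] => True
  -- The default b + 1 makes right ends strictly nested within the stack, but lets the outermost one
  -- coincide with b.
  | e :: t => nextL a t < e.1 ∧ e.2 < nextH (b + 1) t ∧ Nest a b t

/-- The claims for consecutive intervals of `st`, and finally `[a, b]`. -/
def Good (G : Line) (A : Set ℕ) (a b : ℕ) : ℕ → ℕ → List (ℕ × ℕ) → Prop
  | r, c, [] => G.Claim A r c a b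
  -- The next interval has to decide only the keys that do not occur in [e.1, e.2], so its claims
  -- start outside e.
  | r, c, e :: t => G.Claim A r c e.1 e.2 ∧ Good G A a b e.2 e.1 t

theorem Nest.le_next {a b : ℕ} {e : ℕ × ℕ} {t : List (ℕ × ℕ)} (h : Nest a b (e :: t)) :
    e.2 ≤ nextH b t := by
  have := h.2.1
  cases t <;> simp only [nextH] at * <;> omega

theorem Nest.le_nextL {a b : ℕ} {st : List (ℕ × ℕ)} (h : Nest a b st) : a ≤ nextL a st := by
  induction st with
  | nil => exact le_rfl
  | cons e t ih => exact (ih h.2.2).trans h.1.le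

theorem Nest.nextH_le {a b : ℕ} {st : List (ℕ × ℕ)} (h : Nest a b st) : nextH b st ≤ b := by
  induction st with
  | nil => exact le_rfl
  | cons e t ih => exact h.le_next.trans (ih h.2.2)

theorem Good.claim {G : Line} {A : Set ℕ} {a b r c : ℕ} {st : List (ℕ × ℕ)}
    (h : Good G A a b r c st) : G.Claim A r c (nextL a st) (nextH b st) := by
  cases st with
  | nil => exact h
  | cons e t => exact h.1

theorem Good.change {G : Line} {A : Set ℕ} {a b r c r' c' : ℕ} {st : List (ℕ × ℕ)}
    (h : Good G A a b r c st) (hc : G.Claim A r' c' (nextL a st) (nextH b st)) :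
    Good G A a b r' c' st := by
  cases st with
  | nil => exact hc
  | cons e t => exact ⟨hc, h.2⟩

/-- The current position lies inside the gap [c, r] of the first claim and inside all intervals
further out, so `Claim.step` applies to every claim. -/
theorem Good.step {G : Line} {A : Set ℕ} {a b p : ℕ} {st : List (ℕ × ℕ)} :
    ∀ {r c : ℕ}, Good G A a b r c st → Nest a b st → nextL a st ≤ c → r ≤ nextH b st → c ≤ p →
      p ≤ r → Good G (G.step A p) a b r c st := by
  induction st with
  | nil => intro r c hg _ h1 _ h3 h4; exact Line.Claim.step hg h1 h3 h4
  | cons e t ih =>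
    intro r c hg hn h1 h2 h3 h4
    simp only [nextL, nextH] at h1 h2
    exact ⟨hg.1.step h1 h3 h4, ih hg.2 hn.2.2 hn.1.le hn.le_next (by omega) (by omega)⟩

theorem Good.mono {G : Line} {A : Set ℕ} {a b r c c' : ℕ} {st : List (ℕ × ℕ)}
    (h : Good G A a b r c st) (hc : c' ≤ c) : Good G A a b r c' st := by
  cases st with
  | nil => exact Line.Claim.mono h hc
  | cons e t => exact ⟨h.1.mono hc, h.2⟩

/-! ### The state of the walker -/

/-- The walker is at `p`, has visited `[a, b]`, and keeps a stack `st` of nested intervals. -/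
structure State where
  p : ℕ
  a : ℕ
  b : ℕ
  st : List (ℕ × ℕ)

namespace State

/-- The walker steps to the right. -/
def right (s : State) : State :=
  match s.st with
  | [] => if s.b = s.p then ⟨s.p + 1, s.a, s.p + 1, []⟩ else ⟨s.p + 1, s.a, s.b, []⟩
  -- At the right end of e all of e has just been passed from left to right, so it joins the left
  -- part of the next interval.
  | e :: t => if e.2 = s.p + 1 then ⟨s.p + 1, s.a, s.b, t⟩ else ⟨s.p + 1, s.a, s.b, e :: t⟩

/-- The walker steps to the left. -/
def left (s : State) : State :=
  if nextL s.a s.st < s.p then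
    -- A left turn opens a new interval, unless its left end would equal that of the first interval,
    -- which then describes the situation by itself.
    if nextL s.a s.st + 1 = s.p then ⟨s.p - 1, s.a, s.b, s.st⟩
    else ⟨s.p - 1, s.a, s.b, (s.p - 1, s.p) :: s.st⟩
  else
    match s.st with
    | [] => if s.p < s.a then ⟨s.p - 1, s.p - 1, s.p - 1, []⟩ else ⟨s.p - 1, s.p - 1, s.b, []⟩
    -- When the left end of e meets that of the next interval, e is absorbed: only the right-to-left
    -- order of its positions still matters.
    | e :: t => if nextL s.a t + 1 = s.p then ⟨s.p - 1, s.a, s.b, t⟩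
        else ⟨s.p - 1, s.a, s.b, (s.p - 1, e.2) :: t⟩

/-- At an end of the line, the walker is moved to another position of the same node. -/
def norm (n : ℕ) (s : State) : State :=
  -- At 2n the positions n + 1, …, 2n were last seen from left to right, and shifting by -n gives
  -- [1, n]. At 0 the positions 0, …, n - 1 were last seen from right to left, and shifting by n
  -- gives [n, 2n - 1].
  if s.p = 2 * n then ⟨n, 1, n, []⟩ else if s.p = 0 then ⟨n, n, 2 * n - 1, []⟩ else s

end State

/-- The invariant of the walk on the line, where `A` is the current set of active keys and `A₀` the
initial one. -/
structure Inv (G : Line) (n : ℕ) (A₀ A : Set ℕ) (s : State) : Prop where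
  nest : Nest s.a s.b s.st
  top : ∀ e t, s.st = e :: t → e.1 ≤ s.p ∧ s.p < e.2
  le_b : s.p ≤ s.b
  b_le : s.b ≤ 2 * n
  a_le : s.a ≤ s.p + 1
  -- The start node itself is not a request; before the first step the visited range is empty,
  -- encoded as a = n + 1 and b = n.
  fresh : s.a = s.p + 1 → s.st = [] ∧ s.b = s.p ∧ s.p = n
  good : Good G A s.a s.b s.p (s.p + 1) s.st
  unvisited : ∀ y, ¬ G.Occ s.a (s.b + 1) y → (y ∈ A ↔ y ∈ A₀)
  -- Either the visited range has the length of a full turn, or it still touches the start position.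
  -- At an end of the line both cases show that every node has been visited.
  cover : n ≤ s.b - s.a + 1 ∨ s.a ≤ n + 1 ∧ n ≤ s.b + 1

namespace Inv

variable {G : Line} {n : ℕ} {A₀ A : Set ℕ} {s : State}

theorem a_lt (h : Inv G n A₀ A s) {e : ℕ × ℕ} {t : List (ℕ × ℕ)} (hs : s.st = e :: t) :
    s.a < e.1 := by
  have := h.nest
  rw [hs] at this
  exact this.2.2.le_nextL.trans_lt this.1

/-- Without a pop the claims are carried over by `Claim.move_right`. With a pop, the left claims of
the first interval and those of the next one join to the left claims of the latter. -/
theorem right (h : Inv G n A₀ A s) (hp : s.p < 2 * n) :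
    Inv G n A₀ (G.step A (s.p + 1)) s.right := by
  obtain ⟨hn, ht, h1, h2, h3, h4, hg, hu, hc⟩ := h
  obtain ⟨p, a, b, st⟩ := s
  simp only at *
  cases st with
  | nil =>
    simp only [State.right]
    have hg : G.Claim A p (p + 1) a b := hg
    split_ifs with hb
    · subst hb
      refine ⟨trivial, by simp, le_rfl, by simp only; omega, by simp only; omega, ?_, ?_, ?_, ?_⟩
      · simp only; omega
      · exact Line.Claim.move_right h3 (fun q i1 i2 i3 i4 => hg.left q i1 i2 i3 fun ho =>
          i4 (ho.mono le_rfl (by omega))) (fun q i1 i2 => absurd i2 (by simp only; omega))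
      · intro y hy
        simp only at hy
        rw [Line.mem_step hy (by omega) (by omega)]
        exact hu y fun ho => hy (ho.mono le_rfl (by omega))
      · simp only; omega
    · refine ⟨trivial, by simp, by simp only; omega, h2, by simp only; omega, ?_, ?_, ?_, hc⟩
      · simp only; omega
      · exact Line.Claim.move_right h3 (fun q i1 i2 i3 i4 => hg.left q i1 i2 i3 fun ho =>
          i4 (ho.mono le_rfl (by omega))) (fun q i1 i2 => hg.right q (by omega) i2)
      · intro y hy
        simp only at hy
        have : a ≠ p + 1 := fun e => hb (h4 e).2.1
        rw [Line.mem_step hy (by omega) (by omega)]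
        exact hu y hy
  | cons e t =>
    obtain ⟨t1, t2⟩ := ht e t rfl
    have n2' := hn.le_next
    obtain ⟨n1, n2, n3⟩ := hn
    obtain ⟨g1, g2⟩ := hg
    have i1 := n3.le_nextL
    have i2 := n3.nextH_le
    have hu' : ∀ y, ¬ G.Occ a (b + 1) y → (y ∈ G.step A (p + 1) ↔ y ∈ A₀) := by
      intro y hy
      rw [Line.mem_step hy (by omega) (by omega)]
      exact hu y hy
    simp only [State.right]
    split_ifs with he
    · refine ⟨n3, ?_, by simp only; omega, h2, by simp only; omega, by simp only; omega, ?_, hu',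
        hc⟩
      · rintro e' t' rfl
        simp only [nextL, nextH] at n1 n2
        simp only
        omega
      · refine (g2.step n3 n1.le n2' (p := p + 1) (by omega) (by omega)).change
          (Line.Claim.move_right (by omega) (fun q i1 i2 i3 i4 => ?_) fun q i1 i2 => ?_)
        · rcases Nat.lt_or_ge q e.1 with hq | hq
          · exact g2.claim.left q i1 hq i3 (by rwa [he])
          · exact g1.left q hq i2 i3 fun ho => i4 (ho.mono le_rfl (by omega))
        · exact g2.claim.right q (by omega) i2
    · refine ⟨⟨n1, n2, n3⟩, ?_, by simp only; omega, h2, by simp only; omega, by simp only; omega,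
        ⟨?_, ?_⟩, hu', hc⟩
      · rintro e' t' ⟨⟩
        simp only
        omega
      · exact Line.Claim.move_right (by omega) (fun q i1 i2 i3 i4 => g1.left q i1 i2 i3 fun ho =>
          i4 (ho.mono le_rfl (by omega))) (fun q i1 i2 => g1.right q (by omega) i2)
      · exact g2.step n3 n1.le n2' (by omega) (by omega)

/-- The new position becomes the left end of the first interval in all cases: of the old one if p -
1 is already its left end, of a new one after a turn, and otherwise of the first interval or the
range, extended or absorbed. -/
theorem left (h : Inv G n A₀ A s) (hp : 0 < s.p) :
    Inv G n A₀ (G.step A (s.p - 1)) s.left := by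
  obtain ⟨hn, ht, h1, h2, h3, h4, hg, hu, hc⟩ := h
  obtain ⟨p, a, b, st⟩ := s
  simp only at *
  obtain ⟨p, rfl⟩ : ∃ p', p = p' + 1 := ⟨p - 1, by omega⟩
  simp only [State.left, Nat.add_sub_cancel]
  have l1 := hn.le_nextL
  have l2 := hn.nextH_le
  have hu' : a ≤ p → ∀ y, ¬ G.Occ a (b + 1) y → (y ∈ G.step A p ↔ y ∈ A₀) := by
    intro ha y hy
    rw [Line.mem_step hy (by omega) (by omega)]
    exact hu y hy
  have hnh : p + 1 ≤ nextH b st := by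
    cases st with
    | nil => exact h1
    | cons e t => exact (ht e t rfl).2.le
  refine dite (nextL a st < p + 1) (fun c1 => dite (nextL a st + 1 = p + 1) (fun c2 => ?_)
    fun c2 => ?_) fun c1 => ?_
  · rw [if_pos c1, if_pos c2]
    have hpl : p = nextL a st := by omega
    have key : G.Claim (G.step A p) p (p + 1) (nextL a st) (nextH b st) := by
      rw [← hpl]
      refine Line.Claim.move_left fun q i1 i2 i3 i4 => ?_
      exact hg.claim.right_self c1.le i1 i2 i3 (Or.inl (by rwa [← hpl]))
    refine ⟨hn, ?_, by simp only; omega, h2, by simp only; omega, by simp only; omega, ?_,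
      hu' (by omega), hc⟩
    · intro e t he
      simp only at he
      subst he
      have := ht e t rfl
      simp only [nextL] at c1
      simp only
      omega
    · cases st with
      | nil => exact key
      | cons e t =>
        have := ht e t rfl
        simp only [nextL] at c1 c2
        exact ⟨key, hg.2.step hn.2.2 hn.1.le hn.le_next (by omega) (by omega)⟩
  · rw [if_pos c1, if_neg c2]
    refine ⟨⟨?_, ?_, hn⟩, ?_, by simp only; omega, h2, by simp only; omega, by simp only; omega,
      ⟨?_, ?_⟩, hu' (by omega), hc⟩
    · simp only; omega
    · simp only
      cases st with
      | nil => simp only [nextH]; omega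
      | cons e t => exact (ht e t rfl).2
    · rintro e t ⟨⟩
      exact ⟨le_rfl, Nat.lt_succ_self p⟩
    -- The new interval has just two positions, so its right part is the position that was left,
    -- where the latest request decides.
    · refine Line.Claim.move_left fun q i1 i2 i3 i4 => ?_
      obtain rfl : q = p + 1 := by simp only at i2; omega
      exact hg.claim.right_self c1.le le_rfl hnh i3 (Or.inr rfl)
    · exact (hg.mono (by simp only; omega)).step hn (by simp only; omega) hnh le_rfl
        (Nat.le_succ p)
  · rw [if_neg c1]
    cases st with
    | nil =>
      simp only [nextL] at c1
      have hg : G.Claim A (p + 1) (p + 1 + 1) a b := hg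
      simp only
      split_ifs with c3
      · obtain ⟨-, h5, h6⟩ := h4 (by omega)
        refine ⟨trivial, by simp, le_rfl, by simp only; omega, by simp only; omega,
          by simp only; omega, ?_, ?_, ?_⟩
        · exact Line.Claim.move_left fun q i1 i2 => by change q ≤ p at i2; omega
        · intro y hy
          simp only at hy
          rw [Line.mem_step hy (by omega) (by omega)]
          refine hu y ?_
          rintro ⟨q, i1, i2, -⟩
          omega
        · simp only; omega
      · obtain rfl : a = p + 1 := by omega
        refine ⟨trivial, by simp, by simp only; omega, h2, by simp only; omega,
          by simp only; omega, ?_, ?_, ?_⟩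
        · refine Line.Claim.move_left fun q i1 i2 i3 i4 => ?_
          exact hg.right_self le_rfl i1 i2 i3 (Or.inl fun ho => i4 (ho.mono (by omega) le_rfl))
        · intro y hy
          simp only at hy
          rw [Line.mem_step hy (by omega) (by omega)]
          exact hu y fun ho => hy (ho.mono (by omega) le_rfl)
        · simp only; omega
    | cons e t =>
      obtain ⟨t1, t2⟩ := ht e t rfl
      simp only [nextL] at c1
      have n2' := hn.le_next
      obtain ⟨n1, n2, n3⟩ := hn
      obtain ⟨g1, g2⟩ := hg
      have i1 := n3.le_nextL
      have i2 := n3.nextH_le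
      obtain ⟨l, h⟩ := e
      simp only at *
      obtain rfl : l = p + 1 := by omega
      have g2' := (g2.mono (show p ≤ p + 1 by omega)).step n3 (by omega) n2' le_rfl (by omega)
      split_ifs with c3
      · have c4 : p = nextL a t := by omega
        refine ⟨n3, ?_, by simp only; omega, h2, by simp only; omega, by simp only; omega, ?_,
          hu' (by omega), hc⟩
        · rintro e' t' rfl
          simp only [nextL, nextH] at *
          omega
        · refine g2'.change ?_
          rw [← c4]
          refine Line.Claim.move_left fun q j1 j2 j3 j4 => ?_
          rcases Nat.lt_or_ge h q with hq | hq
          · exact g2.claim.right q hq j2 j3 (by rwa [← c4])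
          · exact g1.right_self le_rfl j1 hq j3 (Or.inl fun ho => j4 (ho.mono (by omega) le_rfl))
      · refine ⟨⟨?_, n2, n3⟩, ?_, by simp only; omega, h2, by simp only; omega,
          by simp only; omega, ⟨?_, g2'⟩, hu' (by omega), hc⟩
        · simp only; omega
        · rintro e' t' ⟨⟩
          simp only
          omega
        · refine Line.Claim.move_left fun q j1 j2 j3 j4 => ?_
          exact g1.right_self le_rfl j1 j2 j3 (Or.inl fun ho => j4 (ho.mono (by omega) le_rfl))

theorem init (G : Line) (n : ℕ) (A₀ : Set ℕ) : Inv G n A₀ A₀ ⟨n, n + 1, n, []⟩ := by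
  refine ⟨trivial, by simp, le_rfl, by simp only; omega, le_rfl, fun _ => ⟨rfl, rfl, rfl⟩, ?_,
    fun _ _ => Iff.rfl, ?_⟩
  · exact ⟨fun q h1 h2 => by
    change n + 1 ≤ q at h1; change q < n + 1 at h2; omega, fun q h1 h2 => by
    change n < q at h1; change q ≤ n at h2; omega⟩
  · simp only; omega

/-- Keys and types have period n and a whole turn has been visited, so the claims on the latest n
positions can be shifted. A key that does not occur in the shifted turn occurs nowhere, so its
status is the initial one. -/
theorem norm (hn : 2 ≤ n) (hk : ∀ q, G.key (q + n) = G.key q) (ht : ∀ q, G.ty (q + n) = G.ty q)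
    (h : Inv G n A₀ A s) : Inv G n A₀ A (s.norm n) := by
  have shift : ∀ {l h y}, G.Occ (l + n) (h + n) y ↔ G.Occ l h y := by
    intro l h y
    constructor
    · rintro ⟨q, h1, h2, h3, h4⟩
      refine ⟨q - n, by omega, by omega, ?_⟩
      rw [← hk, ← ht, Nat.sub_add_cancel (by omega)]
      exact ⟨h3, h4⟩
    · rintro ⟨q, h1, h2, h3, h4⟩
      exact ⟨q + n, by omega, by omega, by rwa [ht], by rwa [hk]⟩
  unfold State.norm
  split_ifs with c1 c2
  · obtain ⟨nest, top, h1, h2, h3, h4, hg, hu, hc⟩ := h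
    obtain ⟨p, a, b, st⟩ := s
    simp only at *
    subst c1
    have hst : st = [] := by
      cases st with
      | nil => rfl
      | cons e t =>
        have := (top e t rfl).2
        have := nest.nextH_le
        simp only [nextH] at this
        omega
    subst hst
    have hg : G.Claim A (2 * n) (2 * n + 1) a b := hg
    refine ⟨trivial, by simp, le_rfl, by simp only; omega, by simp only; omega,
      by simp only; omega, ⟨?_, ?_⟩, ?_, ?_⟩
    · intro q i1 i2 i3 i4
      simp only at i1 i2 i4
      rw [← hk, ← ht]
      refine hg.left _ (by omega) (by omega) (by rwa [ht]) ?_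
      rw [hk]
      intro ho
      apply i4
      rw [← shift]
      exact ho.mono (by omega) (by omega)
    · intro q i1 i2
      simp only at i1 i2
      omega
    · intro y hy
      refine hu y fun ho => hy ?_
      obtain ⟨q, i1, i2, i3, i4⟩ := ho
      simp only
      rcases Nat.lt_or_ge n q with hq | hq
      · rw [← shift]
        exact ⟨q, by omega, by omega, i3, i4⟩
      · rcases Nat.eq_zero_or_pos q with rfl | h0
        · exact ⟨n, by omega, by omega, by rw [← zero_add n, ht]; exact i3,
            by rw [← zero_add n, hk]; exact i4⟩
        · exact ⟨q, by omega, by omega, i3, i4⟩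
    · simp only; omega
  · obtain ⟨nest, top, h1, h2, h3, h4, hg, hu, hc⟩ := h
    obtain ⟨p, a, b, st⟩ := s
    simp only at *
    subst c2
    have hst : st = [] := by
      cases st with
      | nil => rfl
      | cons e t =>
        have := (top e t rfl).1
        have := nest.1
        omega
    subst hst
    have hg : G.Claim A 0 (0 + 1) a b := hg
    have hbn : n - 1 ≤ b := by
      rcases hc with hc | hc <;> omega
    have ha : a = 0 ∨ a = 1 := by omega
    have ha : a = 0 := by
      -- With p = 0, the value a = 1 would be the fresh state, which is possible only at position n.
      rcases ha with ha | ha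
      · exact ha
      · have := h4 (by omega); omega
    subst ha
    refine ⟨trivial, by simp, by simp only; omega, by simp only; omega, by simp only; omega,
      by simp only; omega, ⟨?_, ?_⟩, ?_, ?_⟩
    · intro q i1 i2 i3 i4
      simp only at i1 i2 i4
      obtain rfl : q = 0 + n := by omega
      rw [hk, ht]
      refine hg.left _ (by omega) (by omega) (by rwa [← ht]) ?_
      rintro ⟨q', i1, i2, -⟩
      omega
    · intro q i1 i2 i3 i4
      simp only at i1 i2 i4
      obtain ⟨q, rfl⟩ : ∃ q', q = q' + n := ⟨q - n, by omega⟩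
      rw [hk, ht]
      rw [hk] at i4
      rw [ht] at i3
      refine hg.right _ (by omega) (by omega) i3 fun ho => i4 ?_
      simpa using shift.2 ho
    · intro y hy
      refine hu y fun ho => hy ?_
      obtain ⟨q, i1, i2, i3, i4⟩ := ho
      simp only
      rcases Nat.lt_or_ge q n with hq | hq
      · exact ⟨q + n, by omega, by omega, by rwa [ht], by rwa [hk]⟩
      · rcases Nat.lt_or_ge q (2 * n) with h0 | h0
        · exact ⟨q, by omega, by omega, i3, i4⟩
        · obtain rfl : q = n + n := by omega
          exact ⟨n, by omega, by omega, by rwa [← ht], by rwa [← hk]⟩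
    · simp only; omega
  · exact h

end Inv

/-! ### Decomposition of the active keys along intervals -/

namespace Line

variable (G : Line)

/-- The active keys `≥ X` that do not occur in `[l, h]`. -/
def above (A : Set ℕ) (X l h : ℕ) : Set ℕ := {y | y ∈ A ∧ X ≤ y ∧ ¬ G.Occ l (h + 1) y}

/-- The keys `≥ X` inserted at a position of `[l, c)` that do not occur later in `[l, r]`. -/
def lastIn (X l c r : ℕ) : Set ℕ :=
  {y | X ≤ y ∧ ∃ q, l ≤ q ∧ q < c ∧ G.ty q = .insert ∧ G.key q = y ∧ ¬ G.Occ (q + 1) (r + 1) y}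

/-- The keys `≥ X` inserted at a position of `(r, h]` that do not occur before in `[l, h]`. -/
def firstIn (X r h l : ℕ) : Set ℕ :=
  {y | X ≤ y ∧ ∃ q, r < q ∧ q ≤ h ∧ G.ty q = .insert ∧ G.key q = y ∧ ¬ G.Occ l q y}

variable {G}

theorem exists_last {l h y : ℕ} (ho : G.Occ l h y) :
    ∃ q, l ≤ q ∧ q < h ∧ G.ty q ≠ .query ∧ G.key q = y ∧ ¬ G.Occ (q + 1) h y := by
  classical
  obtain ⟨q₀, h1, h2, h3, h4⟩ := ho
  obtain ⟨q, hq, hmax⟩ := Finset.exists_max_image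
    ((Finset.range h).filter fun q => l ≤ q ∧ G.ty q ≠ .query ∧ G.key q = y) id
    ⟨q₀, by simp [h1, h2, h3, h4]⟩
  simp only [Finset.mem_filter, Finset.mem_range, id] at hq hmax
  refine ⟨q, hq.2.1, hq.1, hq.2.2.1, hq.2.2.2, ?_⟩
  rintro ⟨q', i1, i2, i3, i4⟩
  have := hmax q' ⟨i2, by omega, i3, i4⟩
  omega

theorem exists_first {l h y : ℕ} (ho : G.Occ l h y) :
    ∃ q, l ≤ q ∧ q < h ∧ G.ty q ≠ .query ∧ G.key q = y ∧ ¬ G.Occ l q y := by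
  classical
  obtain ⟨h1, h2, h3, h4⟩ := Nat.find_spec ho
  refine ⟨Nat.find ho, h1, h2, h3, h4, ?_⟩
  rintro ⟨q', i1, i2, i3, i4⟩
  exact Nat.find_min ho i2 ⟨i1, by omega, i3, i4⟩

/-- A key absent from [c, r] but present in [l, h] is decided by its last occurrence left of c or,
if there is none, by its first occurrence right of r. The active ones among these are insertions at
such positions. -/
theorem above_eq {A : Set ℕ} {X r c l h : ℕ} (hc : G.Claim A r c l h) (h1 : l ≤ c) (h3 : r ≤ h) :
    G.above A X c r = G.lastIn X l c r ∪ (G.firstIn X r h l ∪ G.above A X l h) := by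
  ext y
  constructor
  · rintro ⟨hA, hX, ho⟩
    by_cases hl : G.Occ l c y
    · obtain ⟨q, i1, i2, i3, i4, i5⟩ := exists_last hl
      have i6 : ¬ G.Occ (q + 1) (r + 1) y := by
        rintro ⟨q', j1, j2, j3, j4⟩
        rcases Nat.lt_or_ge q' c with hq | hq
        · exact i5 ⟨q', j1, hq, j3, j4⟩
        · exact ho ⟨q', hq, j2, j3, j4⟩
      subst i4
      exact Or.inl ⟨hX, q, i1, i2, (hc.left q i1 i2 i3 i6).1 hA, rfl, i6⟩
    · by_cases hr : G.Occ (r + 1) (h + 1) y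
      · obtain ⟨q, i1, i2, i3, i4, i5⟩ := exists_first hr
        have i6 : ¬ G.Occ l q y := by
          rintro ⟨q', j1, j2, j3, j4⟩
          rcases Nat.lt_or_ge q' c with hq | hq
          · exact hl ⟨q', j1, hq, j3, j4⟩
          · rcases Nat.lt_or_ge r q' with hq' | hq'
            · exact i5 ⟨q', hq', j2, j3, j4⟩
            · exact ho ⟨q', hq, by omega, j3, j4⟩
        subst i4
        exact Or.inr (Or.inl ⟨hX, q, i1, by omega,
          (hc.right q i1 (by omega) i3 i6).1 hA, rfl, i6⟩)
      · refine Or.inr (Or.inr ⟨hA, hX, ?_⟩)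
        rintro ⟨q', j1, j2, j3, j4⟩
        rcases Nat.lt_or_ge q' c with hq | hq
        · exact hl ⟨q', j1, hq, j3, j4⟩
        · rcases Nat.lt_or_ge r q' with hq' | hq'
          · exact hr ⟨q', hq', j2, j3, j4⟩
          · exact ho ⟨q', hq, by omega, j3, j4⟩
  · rintro (⟨hX, q, i1, i2, i3, rfl, i5⟩ | ⟨hX, q, i1, i2, i3, rfl, i5⟩ | ⟨hA, hX, ho⟩)
    · exact ⟨(hc.left q i1 i2 (by simp [i3]) i5).2 i3, hX,
        fun ho => i5 (ho.mono (by omega) le_rfl)⟩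
    · exact ⟨(hc.right q i1 i2 (by simp [i3]) i5).2 i3, hX,
        fun ho => i5 (ho.mono h1 (by omega))⟩
    · exact ⟨hA, hX, fun h' => ho (h'.mono h1 (by omega))⟩

/-- Passing from the interval `[l, h]` to an outer interval `[l', h']` whose left end belongs to the
same block of length `m`. -/
theorem above_block {A : Set ℕ} {X l h l' h' m P : ℕ} (hl : l' ≤ l) (hh : h ≤ h') (hP : l < P) (hm : 0 < m) (hb : l' / m = l / m)
    (hr : ∀ q, h < q → q ≤ h' → G.ty q ≠ .query → ¬ G.Occ l' q (G.key q) →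
      (G.key q ∈ A ↔ G.ty q = .insert)) {Z : Set ℕ} (hZ : Z ⊆ G.above A X l h)
    (hZ' : ∀ q < P, q / m = l / m → G.ty q ≠ .query → G.key q ∈ G.above A X l h → G.key q ∈ Z) :
    G.above A X l h = G.above A X l' h' ∪ (G.firstIn X h h' (l / m * m) ∪ Z) := by
  have hlm : l / m * m ≤ l' := by rw [← hb]; exact Nat.div_mul_le_self _ _
  ext y
  constructor
  · rintro hy
    -- The stretch [l', l) lies within the block of l. A key absent from the block can thus be
    -- decided only in (h, h'], and its absence may be tested from the start of the block instead of
    -- from l'; the keys of the block are left to Z.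
    by_cases hcell : ∃ q < P, q / m = l / m ∧ G.ty q ≠ .query ∧ G.key q = y
    · obtain ⟨q, i1, i2, i3, rfl⟩ := hcell
      exact Or.inr (Or.inr (hZ' q i1 i2 i3 hy))
    · have hcell' : ¬ G.Occ (l / m * m) (l + 1) y := by
        rintro ⟨q, i1, i2, i3, i4⟩
        refine hcell ⟨q, by omega, ?_, i3, i4⟩
        refine le_antisymm (Nat.div_le_div_right (by omega)) ?_
        exact (Nat.le_div_iff_mul_le hm).2 i1
      obtain ⟨hA, hX, ho⟩ := hy
      by_cases hocc : G.Occ (h + 1) (h' + 1) y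
      · obtain ⟨q, i1, i2, i3, i4, i5⟩ := exists_first hocc
        have i6 : ¬ G.Occ (l / m * m) q y := by
          rintro ⟨q', j1, j2, j3, j4⟩
          rcases Nat.lt_or_ge q' l with hq | hq
          · exact hcell' ⟨q', j1, by omega, j3, j4⟩
          · rcases Nat.lt_or_ge h q' with hq' | hq'
            · exact i5 ⟨q', hq', j2, j3, j4⟩
            · exact ho ⟨q', hq, by omega, j3, j4⟩
        subst i4
        exact Or.inr (Or.inl ⟨hX, q, i1, by omega,
          (hr q i1 (by omega) i3 fun h => i6 (h.mono hlm le_rfl)).1 hA, rfl, i6⟩)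
      · refine Or.inl ⟨hA, hX, ?_⟩
        rintro ⟨q', j1, j2, j3, j4⟩
        rcases Nat.lt_or_ge q' l with hq | hq
        · exact hcell' ⟨q', by omega, by omega, j3, j4⟩
        · rcases Nat.lt_or_ge h q' with hq' | hq'
          · exact hocc ⟨q', hq', j2, j3, j4⟩
          · exact ho ⟨q', hq, by omega, j3, j4⟩
  · rintro (⟨hA, hX, ho⟩ | ⟨hX, q, i1, i2, i3, rfl, i5⟩ | hy)
    · exact ⟨hA, hX, fun h => ho (h.mono hl (by omega))⟩
    · refine ⟨(hr q i1 i2 (by simp [i3]) fun h => i5 (h.mono hlm le_rfl)).2 i3, hX, fun h => ?_⟩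
      exact i5 (h.mono (by omega) (by omega))
    · exact hZ hy

/-- This is why stored values need no update while the walker stays inside the interval: the
requested key occurs in it and is therefore not counted. -/
theorem above_step {A : Set ℕ} {X l h p : ℕ} (h1 : l ≤ p) (h2 : p ≤ h) :
    G.above (G.step A p) X l h = G.above A X l h := by
  ext y
  constructor
  · rintro ⟨hA, hX, ho⟩
    exact ⟨(mem_step ho h1 (by omega)).1 hA, hX, ho⟩
  · rintro ⟨hA, hX, ho⟩
    exact ⟨(mem_step ho h1 (by omega)).2 hA, hX, ho⟩

end Line

/-! ### Relations between distant intervals of the stack -/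

theorem Nest.lt_of_mem {a b : ℕ} {e : ℕ × ℕ} {t : List (ℕ × ℕ)} (h : Nest a b (e :: t))
    {F : ℕ × ℕ} (hF : F ∈ t) : F.1 < e.1 ∧ e.2 < F.2 := by
  induction t generalizing e with
  | nil => simp at hF
  | cons e' t ih =>
    have h1 : e'.1 < e.1 := h.1
    have h2 : e.2 < e'.2 := h.2.1
    rcases List.mem_cons.1 hF with rfl | hF
    · exact ⟨h1, h2⟩
    · have := ih h.2.2 hF
      omega

theorem Nest.eq_or_lt {a b : ℕ} {st : List (ℕ × ℕ)} (h : Nest a b st) {e F : ℕ × ℕ} (he : e ∈ st)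
    (hF : F ∈ st) : e = F ∨ (F.1 < e.1 ∧ e.2 < F.2) ∨ (e.1 < F.1 ∧ F.2 < e.2) := by
  induction st with
  | nil => simp at he
  | cons e' t ih =>
    rcases List.mem_cons.1 he with h1 | h1 <;> rcases List.mem_cons.1 hF with h2 | h2
    · exact Or.inl (h1.trans h2.symm)
    · exact Or.inr (Or.inl (h1 ▸ h.lt_of_mem h2))
    · exact Or.inr (Or.inr (h2 ▸ h.lt_of_mem h1))
    · exact ih h.2.2 h1 h2

/-- The position q lies between two consecutive right ends, and the claim found there starts at a
left end no smaller than F.1. Absence from F.1 on is therefore the stronger condition. -/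
theorem Good.right {G : Line} {A : Set ℕ} {a b : ℕ} {st : List (ℕ × ℕ)} :
    ∀ {r c : ℕ}, Good G A a b r c st → Nest a b st → ∀ F ∈ st, ∀ q, r < q → q ≤ F.2 →
      G.ty q ≠ .query → ¬ G.Occ F.1 q (G.key q) → (G.key q ∈ A ↔ G.ty q = .insert) := by
  induction st with
  | nil => intro r c _ _ F hF; simp at hF
  | cons e t ih =>
    intro r c hg hn F hF q h1 h2 h3 h4
    rcases Nat.lt_or_ge e.2 q with hq | hq
    · rcases List.mem_cons.1 hF with rfl | hF
      · omega
      · exact ih hg.2 hn.2.2 F hF q hq h2 h3 h4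
    · have : F.1 ≤ e.1 := by
        rcases List.mem_cons.1 hF with rfl | hF
        · exact le_rfl
        · exact (hn.lt_of_mem hF).1.le
      exact hg.1.right q h1 hq h3 fun ho => h4 (ho.mono this le_rfl)

/-- The claims beyond an interval of the stack. -/
theorem Good.right_of_mem {G : Line} {A : Set ℕ} {a b : ℕ} {st : List (ℕ × ℕ)} :
    ∀ {r c : ℕ}, Good G A a b r c st → Nest a b st → ∀ D ∈ st, ∀ F ∈ st, ∀ q, D.2 < q → q ≤ F.2 →
      G.ty q ≠ .query → ¬ G.Occ F.1 q (G.key q) → (G.key q ∈ A ↔ G.ty q = .insert) := by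
  induction st with
  | nil => intro r c _ _ D hD; simp at hD
  | cons e t ih =>
    intro r c hg hn D hD F hF q h1 h2 h3 h4
    rcases List.mem_cons.1 hF with hF' | hF'
    · subst hF'
      rcases List.mem_cons.1 hD with hD' | hD'
      · subst hD'; omega
      · have := (hn.lt_of_mem hD').2; omega
    · rcases List.mem_cons.1 hD with hD' | hD'
      · subst hD'
        exact hg.2.right hn.2.2 F hF' q h1 h2 h3 h4
      · exact ih hg.2 hn.2.2 D hD' F hF' q h1 h2 h3 h4

/-! ### Stored values -/

/-- `F` is the outermost interval of `st` whose left end is in the same block of length `m` as the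
left end of `e`. -/
structure IsOuter (m : ℕ) (st : List (ℕ × ℕ)) (e F : ℕ × ℕ) : Prop where
  mem : F ∈ st
  block : F.1 / m = e.1 / m
  le : ∀ e' ∈ st, e'.1 / m = e.1 / m → F.1 ≤ e'.1

theorem exists_isOuter (m : ℕ) {st : List (ℕ × ℕ)} {e : ℕ × ℕ} (he : e ∈ st) :
    ∃ F, IsOuter m st e F := by
  classical
  have h : ∃ l, ∃ F ∈ st, F.1 / m = e.1 / m ∧ F.1 = l := ⟨e.1, e, he, rfl, rfl⟩
  obtain ⟨F, h1, h2, h3⟩ := Nat.find_spec h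
  refine ⟨F, h1, h2, fun e' i1 i2 => ?_⟩
  rw [h3]
  exact Nat.find_min' h ⟨e', i1, i2, rfl⟩

/-- The level of the pair `q, l`. -/
def lev (B K q l : ℕ) : ℕ := Nat.findGreatest (fun k => l / B ^ k + 2 ≤ q / B ^ k) K

theorem div_pow_eq_of_le {B k k' l l' : ℕ} (hk : k ≤ k') (h : l / B ^ k = l' / B ^ k) :
    l / B ^ k' = l' / B ^ k' := by
  obtain ⟨d, rfl⟩ := Nat.exists_eq_add_of_le hk
  rw [pow_add, ← Nat.div_div_eq_div_mul, h, Nat.div_div_eq_div_mul]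

theorem lev_le (B K q l : ℕ) : lev B K q l ≤ K := Nat.findGreatest_le K

theorem lev_spec {B K q l : ℕ} (h : lev B K q l ≠ 0) :
    l / B ^ lev B K q l + 2 ≤ q / B ^ lev B K q l :=
  Nat.findGreatest_of_ne_zero (P := fun k => l / B ^ k + 2 ≤ q / B ^ k) rfl h

theorem lev_max {B K q l k : ℕ} (h : lev B K q l < k) (hk : k ≤ K) :
    ¬ l / B ^ k + 2 ≤ q / B ^ k := Nat.findGreatest_is_greatest (P := fun k => l / B ^ k + 2 ≤ q / B ^ k) h hk

theorem le_lev {B K q l k : ℕ} (hk : k ≤ K) (h : l / B ^ k + 2 ≤ q / B ^ k) : k ≤ lev B K q l :=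
  Nat.le_findGreatest (P := fun k => l / B ^ k + 2 ≤ q / B ^ k) hk h

/-- Left ends in one block at this level share their blocks at all coarser levels, so the level is
the same for both. Hence all intervals of a block use the same slot. -/
theorem lev_congr {B K q l l' : ℕ} (h : l / B ^ lev B K q l = l' / B ^ lev B K q l) :
    lev B K q l' = lev B K q l := by
  apply le_antisymm
  · by_contra hlt
    push Not at hlt
    have h1 := lev_spec (B := B) (K := K) (q := q) (l := l') (by omega)
    have h2 := lev_max hlt (lev_le _ _ _ _)
    rw [div_pow_eq_of_le hlt.le h] at h2
    exact h2 h1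
  · by_cases h0 : lev B K q l = 0
    · omega
    · refine le_lev (lev_le _ _ _ _) ?_
      rw [← h]
      exact lev_spec h0

/-- The threshold of the query number `κ` at position `q`. -/
def Line.thr (G : Line) (B q κ : ℕ) : ℕ := if κ = 0 then G.key q else G.key (q - B ^ κ)

/-- The values `sv` and `sh` stored for the entries of the stack: for the entry `e` and a position `q`
inside the entry before `e`. At position `p` the queries `≥ κ₀` of the first entry are exempt. -/
def Slots (G : Line) (N B K : ℕ) (A : Set ℕ) (p κ₀ : ℕ) (st : List (ℕ × ℕ))
    (sv sh : ℕ → ℕ → ℕ → ℕ → ℕ) : Prop :=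
  -- The slot depends on e only through the block of its left end, and so does F; intervals sharing
  -- a slot require the same content.
  ∀ e ∈ st, ∀ q, e.1 < q → (q ≤ p ∨ ∃ e' ∈ st, e.1 < e'.1 ∧ q ≤ e'.2) → ∀ κ ≤ K,
    (q < p ∨ κ < κ₀ ∨ ∃ e' ∈ st, e.1 < e'.1) → ∀ F, IsOuter (B ^ lev B K q e.1) st e F →
      sv q κ (lev B K q e.1) (q / B ^ lev B K q e.1 - e.1 / B ^ lev B K q e.1) =
        mn N (G.above A (G.thr B q κ) F.1 F.2) ∧
      sh q κ (lev B K q e.1) (q / B ^ lev B K q e.1 - e.1 / B ^ lev B K q e.1) = F.2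

theorem Slots.nil (G : Line) (N B K : ℕ) (A : Set ℕ) (p κ₀ : ℕ) (sv sh : ℕ → ℕ → ℕ → ℕ → ℕ) :
    Slots G N B K A p κ₀ [] sv sh := fun e he => by simp at he

/-- Nothing is rewritten here: every interval contains the new position, so `above_step` keeps the
values, and only the required slots and their outermost intervals have to be compared. With κ₀ = 0
the first interval is exempt at the new position until the writes. -/
theorem Slots.change {G : Line} {N B K : ℕ} {A : Set ℕ} {p p' : ℕ} {st st' : List (ℕ × ℕ)}
    {sv sh : ℕ → ℕ → ℕ → ℕ → ℕ} (h : Slots G N B K A p (K + 1) st sv sh)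
    (h1 : ∀ e ∈ st', ∀ q, e.1 < q → (q ≤ p' ∨ ∃ e' ∈ st', e.1 < e'.1 ∧ q ≤ e'.2) →
      (q < p' ∨ ∃ e' ∈ st', e.1 < e'.1) →
        e ∈ st ∧ (q ≤ p ∨ ∃ e' ∈ st, e.1 < e'.1 ∧ q ≤ e'.2) ∧
        ∀ m F, IsOuter m st' e F → IsOuter m st e F)
    (h2 : ∀ F ∈ st', F.1 ≤ p' ∧ p' ≤ F.2) : Slots G N B K (G.step A p') p' 0 st' sv sh := by
  intro e he q hq hr κ hκ hx F hF
  obtain ⟨i1, i2, i3⟩ := h1 e he q hq hr (by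
    rcases hx with h | h | h
    · exact Or.inl h
    · omega
    · exact Or.inr h)
  obtain ⟨j1, j2⟩ := h2 F hF.mem
  rw [Line.above_step j1 j2]
  exact h e i1 q hq i2 κ hκ (Or.inr (Or.inl (by omega))) F (i3 _ F hF)

section
variable {G : Line} {n : ℕ} {A₀ A : Set ℕ} {s : State} {N B K : ℕ}
  {sv sh : ℕ → ℕ → ℕ → ℕ → ℕ}

theorem Inv.contains (h : Inv G n A₀ A s) : ∀ F ∈ s.st, F.1 ≤ s.p ∧ s.p < F.2 := by
  intro F hF
  have hn := h.nest
  have ht := h.top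
  cases hs : s.st with
  | nil => simp [hs] at hF
  | cons e t =>
    have := ht e t hs
    rw [hs] at hF hn
    rcases List.mem_cons.1 hF with rfl | hF
    · exact this
    · have := hn.lt_of_mem hF
      omega

/-- After a pop, the positions up to the new one lie inside the popped interval, where the slots of
the outer intervals were already complete. The popped interval was never outermost in a block shared
with a remaining one. -/
theorem Slots.right (h : Slots G N B K A s.p (K + 1) s.st sv sh) (hi : Inv G n A₀ A s)
    (hp : s.p < 2 * n) :
    Slots G N B K (G.step A (s.p + 1)) (s.p + 1) 0 s.right.st sv sh := by
  have hi' := (hi.right hp).contains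
  have hp' : s.right.p = s.p + 1 := by
    unfold State.right
    split <;> split_ifs <;> rfl
  rw [hp'] at hi'
  refine h.change ?_ fun F hF => ⟨(hi' F hF).1, (hi' F hF).2.le⟩
  have hn := hi.nest
  have ht := hi.top
  obtain ⟨p, a, b, st⟩ := s
  simp only at *
  cases st with
  | nil =>
    intro e he
    exfalso
    revert he
    simp only [State.right]
    split_ifs <;> simp
  | cons e t =>
    have hte := ht e t rfl
    intro e' he' q hq hr hx
    simp only [State.right] at he' hr hx ⊢
    split_ifs at he' hr hx ⊢ with c
    · have hlt := hn.lt_of_mem he'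
      refine ⟨List.mem_cons_of_mem _ he', Or.inr ?_, fun m F hF => ?_⟩
      · rcases hr with hr | ⟨e'', k1, k2, k3⟩
        · exact ⟨e, List.mem_cons_self, hlt.1, by omega⟩
        · exact ⟨e'', List.mem_cons_of_mem _ k1, k2, k3⟩
      · refine ⟨List.mem_cons_of_mem _ hF.mem, hF.block, fun x hx hxm => ?_⟩
        rcases List.mem_cons.1 hx with rfl | hx
        · exact (hn.lt_of_mem hF.mem).1.le
        · exact hF.le x hx hxm
    · refine ⟨he', ?_, fun m F hF => hF⟩
      rcases hr with hr | hr
      · rcases hx with hx | ⟨e'', k1, k2⟩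
        · exact Or.inl (by omega)
        · refine Or.inr ⟨e'', k1, k2, ?_⟩
          rcases List.mem_cons.1 k1 with k1 | k1
          · rw [k1]; omega
          · have := (hn.lt_of_mem k1).2
            omega
      · exact Or.inr hr

/-- A new or extended first interval starts at the current position, so it has no slots to fill yet.
Its left end exceeds all others, so it is not outermost in any block shared with them. -/
theorem Slots.left (h : Slots G N B K A s.p (K + 1) s.st sv sh) (hi : Inv G n A₀ A s)
    (hp : 0 < s.p) :
    Slots G N B K (G.step A (s.p - 1)) (s.p - 1) 0 s.left.st sv sh := by
  have hi' := (hi.left hp).contains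
  have hp' : s.left.p = s.p - 1 := by
    unfold State.left
    split_ifs <;> (try split) <;> (try split_ifs) <;> rfl
  rw [hp'] at hi'
  refine h.change ?_ fun F hF => ⟨(hi' F hF).1, (hi' F hF).2.le⟩
  have hn := hi.nest
  have ht := hi.top
  obtain ⟨p, a, b, st⟩ := s
  simp only at *
  have same : ∀ e' ∈ st, ∀ q, e'.1 < q →
      (q ≤ p - 1 ∨ ∃ e'' ∈ st, e'.1 < e''.1 ∧ q ≤ e''.2) →
      e' ∈ st ∧ (q ≤ p ∨ ∃ e'' ∈ st, e'.1 < e''.1 ∧ q ≤ e''.2) ∧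
        ∀ m F, IsOuter m st e' F → IsOuter m st e' F := by
    intro e' he' q hq hr
    exact ⟨he', hr.imp (fun h => by omega) id, fun m F hF => hF⟩
  intro e' he' q hq hr hx
  by_cases c1 : nextL a st < p
  · by_cases c2 : nextL a st + 1 = p
    · simp only [State.left, c1, c2, if_true] at he' hr hx ⊢
      exact same e' he' q hq hr
    · simp only [State.left, c1, c2, if_true, if_false] at he' hr hx ⊢
      have hlow : ∀ e ∈ st, e.1 < p - 1 := by
        clear hr hx
        intro e he
        cases st with
        | nil => simp at he
        | cons e₁ t =>
          simp only [nextL] at c1 c2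
          rcases List.mem_cons.1 he with rfl | he
          · omega
          · have := (hn.lt_of_mem he).1
            omega
      rcases List.mem_cons.1 he' with rfl | he'
      -- No position q to the right of the new left end is required for the new interval.
      · exfalso
        simp only at hq hr hx
        rcases hr with hr | ⟨e'', k1, k2, k3⟩
        · omega
        · rcases List.mem_cons.1 k1 with rfl | k1
          · simp only at k2; omega
          · have := hlow _ k1; omega
      · refine ⟨he', ?_, fun m F hF => ?_⟩
        · rcases hr with hr | ⟨e'', k1, k2, k3⟩
          · left; omega
          · rcases List.mem_cons.1 k1 with rfl | k1
            · exact Or.inl k3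
            · exact Or.inr ⟨e'', k1, k2, k3⟩
        · have h3 := hF.le e' (List.mem_cons_of_mem _ he') rfl
          refine ⟨?_, hF.block, fun x hx => hF.le x (List.mem_cons_of_mem _ hx)⟩
          rcases List.mem_cons.1 hF.mem with h4 | h4
          · have := hlow e' he'
            rw [h4] at h3
            simp only at h3
            omega
          · exact h4
  · cases st with
    | nil =>
      exfalso
      revert he'
      simp only [State.left, if_neg c1]
      split_ifs <;> simp
    | cons e t =>
      have hte := ht e t rfl
      simp only [State.left, if_neg c1] at he' hr hx ⊢
      simp only [nextL] at c1
      have hpe : e.1 = p := by omega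
      split_ifs at he' hr hx ⊢ with c3
      · have hlt := hn.lt_of_mem he'
        refine ⟨List.mem_cons_of_mem _ he', ?_, fun m F hF => ?_⟩
        · rcases hr with hr | ⟨e'', k1, k2, k3⟩
          · left; omega
          · exact Or.inr ⟨e'', List.mem_cons_of_mem _ k1, k2, k3⟩
        · refine ⟨List.mem_cons_of_mem _ hF.mem, hF.block, fun x hx hxm => ?_⟩
          rcases List.mem_cons.1 hx with rfl | hx
          · exact (hn.lt_of_mem hF.mem).1.le
          · exact hF.le x hx hxm
      · have hlow : ∀ x ∈ t, x.1 < p - 1 := by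
          clear hr hx
          intro x hx
          have h1 := hn.1
          have h2 := hn.2.2
          cases t with
          | nil => simp at hx
          | cons e₁ t =>
            simp only [nextL] at h1 c3
            rcases List.mem_cons.1 hx with rfl | hx
            · omega
            · have := (h2.lt_of_mem hx).1
              omega
        rcases List.mem_cons.1 he' with rfl | he'
        · exfalso
          simp only at hq hr hx
          rcases hr with hr | ⟨e'', k1, k2, k3⟩
          · omega
          · rcases List.mem_cons.1 k1 with rfl | k1
            · simp only at k2; omega
            · have := hlow _ k1; omega
        · have hlt := hn.lt_of_mem he'
          refine ⟨List.mem_cons_of_mem _ he', ?_, fun m F hF => ?_⟩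
          · rcases hr with hr | ⟨e'', k1, k2, k3⟩
            · left; omega
            · rcases List.mem_cons.1 k1 with rfl | k1
              · exact Or.inr ⟨e, List.mem_cons_self, hlt.1, k3⟩
              · exact Or.inr ⟨e'', List.mem_cons_of_mem _ k1, k2, k3⟩
          · have h3 := hF.le e' (List.mem_cons_of_mem _ he') rfl
            have h5 := hlow e' he'
            refine ⟨?_, hF.block, fun x hx hxm => ?_⟩
            · rcases List.mem_cons.1 hF.mem with h4 | h4
              · rw [h4] at h3
                simp only at h3
                omega
              · exact List.mem_cons_of_mem _ h4
            · rcases List.mem_cons.1 hx with rfl | hx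
              · omega
              · exact hF.le x (List.mem_cons_of_mem _ hx) hxm

/-- The effect of storing the values for the query number `κ` of the first entry. -/
theorem Slots.write {κ : ℕ} (h : Slots G N B K A s.p κ s.st sv sh) (hi : Inv G n A₀ A s)
    (hκ : κ ≤ K) {sv' sh' : ℕ → ℕ → ℕ → ℕ → ℕ} {v r k : ℕ}
    (hk : k = lev B K s.p (nextL s.a s.st))
    (h1 : ∀ q κ' k' j, (q, κ', k', j) ≠ (s.p, κ, k, s.p / B ^ k - nextL s.a s.st / B ^ k) →
      sv' q κ' k' j = sv q κ' k' j ∧ sh' q κ' k' j = sh q κ' k' j)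
    (h2 : sv' s.p κ k (s.p / B ^ k - nextL s.a s.st / B ^ k) = v)
    (h3 : sh' s.p κ k (s.p / B ^ k - nextL s.a s.st / B ^ k) = r)
    (h4 : ∀ e e' t, s.st = e :: e' :: t → e'.1 / B ^ k = e.1 / B ^ k →
      v = sv s.p κ k (s.p / B ^ k - e.1 / B ^ k) ∧ r = sh s.p κ k (s.p / B ^ k - e.1 / B ^ k))
    (h5 : ∀ e t, s.st = e :: t → (∀ e' t', t = e' :: t' → e'.1 / B ^ k ≠ e.1 / B ^ k) →
      v = mn N (G.above A (G.thr B s.p κ) e.1 e.2) ∧ r = e.2) :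
    Slots G N B K A s.p (κ + 1) s.st sv' sh' := by
  have hn := hi.nest
  have hc := hi.contains
  obtain ⟨p, a, b, st⟩ := s
  simp only at *
  cases st with
  | nil => exact Slots.nil _ _ _ _ _ _ _ _ _
  | cons e t =>
    simp only [nextL] at *
    have hep := hc e List.mem_cons_self
    -- the written value is the right one for the first entry
    have main : ∀ F, IsOuter (B ^ k) (e :: t) e F →
        v = mn N (G.above A (G.thr B p κ) F.1 F.2) ∧ r = F.2 := by
      intro F hF
      by_cases c : ∃ e' t', t = e' :: t' ∧ e'.1 / B ^ k = e.1 / B ^ k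
      · obtain ⟨e', t', rfl, hb⟩ := c
        obtain ⟨i1, i2⟩ := h4 e e' t' rfl hb
        have hlt := hn.lt_of_mem (F := e') List.mem_cons_self
        have hl : lev B K p e'.1 = k := by
          rw [hk]; exact lev_congr (by rw [← hk, hb])
        have := h e' (by simp) p (by omega) (Or.inl le_rfl) κ hκ
          (Or.inr (Or.inr ⟨e, by simp, hlt.1⟩)) F (by
            rw [hl]
            exact ⟨hF.mem, hF.block.trans hb.symm, fun x hx hxb => hF.le x hx (hxb.trans hb)⟩)
        rw [hl, hb] at this
        rw [i1, i2]
        exact this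
      · push Not at c
        have hFe : F = e := by
          rcases List.mem_cons.1 hF.mem with h | h
          · exact h
          · exfalso
            cases t with
            | nil => simp at h
            | cons e' t' =>
              -- The left end of e' lies between those of F and e, which share a block, so it is in
              -- that block as well.
              refine c e' t' rfl ?_
              have h6 : e'.1 < e.1 := hn.1
              have h7 : F.1 ≤ e'.1 := by
                rcases List.mem_cons.1 h with rfl | h
                · exact le_rfl
                · exact (hn.2.2.lt_of_mem h).1.le
              refine le_antisymm (Nat.div_le_div_right h6.le) ?_
              rw [← hF.block]
              exact Nat.div_le_div_right h7
        subst hFe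
        exact h5 F t rfl c
    intro f hf q hq hr κ' hκ' hx F hF
    by_cases hkey : (q, κ', lev B K q f.1, q / B ^ lev B K q f.1 - f.1 / B ^ lev B K q f.1) =
        (p, κ, k, p / B ^ k - e.1 / B ^ k)
    -- Another interval that uses the slot just written has its left end in the same block, hence
    -- the same outermost interval, and the written value suits it too.
    · rw [Prod.mk.injEq, Prod.mk.injEq, Prod.mk.injEq] at hkey
      obtain ⟨rfl, rfl, hlk, hj⟩ := hkey
      rw [hlk] at hj hF ⊢
      rw [hj, h2, h3]
      have i1 : f.1 / B ^ k ≤ q / B ^ k := Nat.div_le_div_right hq.le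
      have i2 : e.1 / B ^ k ≤ q / B ^ k := Nat.div_le_div_right hep.1
      have hfe : f.1 / B ^ k = e.1 / B ^ k := by omega
      exact main F ⟨hF.mem, hF.block.trans hfe, fun x hx hxb => hF.le x hx (hxb.trans hfe.symm)⟩
    · obtain ⟨i1, i2⟩ := h1 _ _ _ _ hkey
      rw [i1, i2]
      refine h f hf q hq hr κ' hκ' ?_ F hF
      rcases hx with hx | hx | hx
      · exact Or.inl hx
      · rcases Nat.lt_or_ge κ' κ with h' | h'
        · exact Or.inr (Or.inl h')
        · have hκe : κ' = κ := by omega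
          subst hκe
          rcases List.mem_cons.1 hf with hfe | hft
          · subst hfe
            refine Or.inl ?_
            rcases hr with hr | ⟨e', k1, k2, -⟩
            · rcases Nat.lt_or_ge q p with h6 | h6
              · exact h6
              · obtain rfl : q = p := by omega
                exact absurd (by rw [← hk]) hkey
            · rcases List.mem_cons.1 k1 with rfl | k1
              · omega
              · have := (hn.lt_of_mem k1).1
                omega
          · exact Or.inr (Or.inr ⟨e, by simp, (hn.lt_of_mem hft).1⟩)
      · exact Or.inr (Or.inr hx)

end

/-! ### The static points -/

namespace Line

variable (G : Line) (N n : ℕ) (A₀ : Set ℕ)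

open Classical in
/-- The positions in `s` at which the key `y` is inserted or deleted. -/
noncomputable def occs (s : Finset ℕ) (y : ℕ) : Finset ℕ :=
  s.filter fun q => G.ty q ≠ .query ∧ G.key q = y

open Classical in
/-- Points for `firstIn`. -/
noncomputable def firstPts : Finset (ℕ × ℕ × ℕ) :=
  ((Finset.range N).filter fun q => G.ty q = .insert).image fun q =>
    (q, (G.occs (Finset.range q) (G.key q)).sup (· + 1), G.key q)

open Classical in
/-- Points for `lastIn`. -/
noncomputable def lastPts : Finset (ℕ × ℕ × ℕ) :=
  ((Finset.range N).filter fun q => G.ty q = .insert).image fun q =>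
    (q, (G.occs (Finset.Ioo q N) (G.key q)).sup (N - ·), G.key q)

/-- The point for the key `y` and the cut `c`. -/
noncomputable def cutPt (c y : ℕ) : ℕ × ℕ × ℕ :=
  ((G.occs (Finset.range c) y).sup (· + 1), (G.occs (Finset.Ico c N) y).sup (N - ·), y)

open Classical in
/-- Points for the initially active keys. -/
noncomputable def cutPts : Finset (ℕ × ℕ × ℕ) :=
  ((Finset.range n).filter (· ∈ A₀)).image (G.cutPt N 0) ∪
    ((Finset.range N).filter fun q => G.key q ∈ A₀).image fun q => G.cutPt N (q + 1) (G.key q)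

variable {G N n A₀}

/-- The second coordinate is one more than the previous occurrence of the key, or 0 without one;
being first from l on means that it is at most l. -/
theorem firstIn_eq {X r h l : ℕ} (hN : h < N) :
    {y | X ≤ y ∧ ∃ α β, (α, β, y) ∈ G.firstPts N ∧ r + 1 ≤ α ∧ α < h + 1 ∧ β < l + 1} =
      G.firstIn X r h l := by
  ext y
  simp only [firstPts, firstIn, Set.mem_ofPred_eq, Finset.mem_image, Finset.mem_filter,
    Finset.mem_range, Prod.mk.injEq]
  refine and_congr_right fun _ => ?_
  have hocc : ∀ q y, (G.occs (Finset.range q) y).sup (· + 1) < l + 1 ↔ ¬ G.Occ l q y := by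
    intro q y
    rw [Finset.sup_lt_iff (by simp)]
    simp only [occs, Finset.mem_filter, Finset.mem_range]
    constructor
    · rintro h ⟨q', h1, h2, h3⟩
      have := h q' ⟨h2, h3⟩
      omega
    · intro h q' ⟨h1, h2⟩
      by_contra h3
      exact h ⟨q', by omega, h1, h2⟩
  constructor
  · rintro ⟨α, β, ⟨q, ⟨h1, h2⟩, rfl, rfl, rfl⟩, h3, h4, h5⟩
    exact ⟨q, h3, by omega, h2, rfl, (hocc _ _).1 h5⟩
  · rintro ⟨q, h1, h2, h3, rfl, h4⟩
    exact ⟨q, _, ⟨q, ⟨by omega, h3⟩, rfl, rfl, rfl⟩, h1, by omega, (hocc _ _).2 h4⟩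

/-- The next occurrence is stored reflected, as its distance from N, or 0 without one. The condition
that it comes after r is then an upper bound, as range queries require. -/
theorem lastIn_eq {X l c r : ℕ} (hc : c ≤ N) (hr : r < N) :
    {y | X ≤ y ∧ ∃ α β, (α, β, y) ∈ G.lastPts N ∧ l ≤ α ∧ α < c ∧ β < N - r} =
      G.lastIn X l c r := by
  ext y
  simp only [lastPts, lastIn, Set.mem_ofPred_eq, Finset.mem_image, Finset.mem_filter,
    Finset.mem_range, Prod.mk.injEq]
  refine and_congr_right fun _ => ?_
  have hocc : ∀ q y, (G.occs (Finset.Ioo q N) y).sup (N - ·) < N - r ↔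
      ¬ G.Occ (q + 1) (r + 1) y := by
    intro q y
    rw [Finset.sup_lt_iff (by simp; omega)]
    simp only [occs, Finset.mem_filter, Finset.mem_Ioo]
    constructor
    · rintro h ⟨q', h1, h2, h3⟩
      have := h q' ⟨⟨h1, by omega⟩, h3⟩
      omega
    · intro h q' ⟨h1, h2⟩
      by_contra h3
      exact h ⟨q', by omega, by omega, h2⟩
  constructor
  · rintro ⟨α, β, ⟨q, ⟨h1, h2⟩, rfl, rfl, rfl⟩, h3, h4, h5⟩
    exact ⟨q, h3, by omega, h2, rfl, (hocc _ _).1 h5⟩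
  · rintro ⟨q, h1, h2, h3, rfl, h4⟩
    exact ⟨q, _, ⟨q, ⟨by omega, h3⟩, rfl, rfl, rfl⟩, h1, by omega, (hocc _ _).2 h4⟩

/-- A key avoids [a, b] exactly if the interval fits into a gap between consecutive occurrences. The
cuts at 0 and just after every occurrence provide a point for each gap. -/
theorem above_init_eq {X a b : ℕ} (hA : ∀ y ∈ A₀, y < n) (hb : b < N) (hab : a ≤ b) :
    {y | X ≤ y ∧ ∃ α β, (α, β, y) ∈ G.cutPts N n A₀ ∧ 0 ≤ α ∧ α < a + 1 ∧ β < N - b} =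
      G.above A₀ X a b := by
  have hcut : ∀ c y, (G.cutPt N c y).1 < a + 1 ∧ (G.cutPt N c y).2.1 < N - b ↔
      (∀ q < N, G.ty q ≠ .query → G.key q = y → if q < c then q < a else b < q) ∧
        (∀ q < c, N ≤ q → G.ty q ≠ .query → G.key q = y → q < a) := by
    intro c y
    simp only [cutPt]
    rw [Finset.sup_lt_iff (by simp), Finset.sup_lt_iff (by simp; omega)]
    simp only [occs, Finset.mem_filter, Finset.mem_Ico, Finset.mem_range]
    constructor
    · rintro ⟨h1, h2⟩
      refine ⟨fun q h3 h4 h5 => ?_, fun q h3 h4 h5 h6 => ?_⟩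
      · split_ifs with h
        · have := h1 q ⟨h, h4, h5⟩; omega
        · have := h2 q ⟨⟨by omega, h3⟩, h4, h5⟩; omega
      · have := h1 q ⟨h3, h5, h6⟩; omega
    · rintro ⟨h1, h2⟩
      refine ⟨fun q ⟨h3, h4, h5⟩ => ?_, fun q ⟨⟨h3, h4⟩, h5, h6⟩ => ?_⟩
      · rcases Nat.lt_or_ge q N with h | h
        · have := h1 q h h4 h5
          rw [if_pos h3] at this
          omega
        · have := h2 q h3 h h4 h5
          omega
      · have := h1 q h4 h5 h6
        rw [if_neg (by omega)] at this
        omega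
  have hsound : ∀ c y, (G.cutPt N c y).1 < a + 1 ∧ (G.cutPt N c y).2.1 < N - b →
      ¬ G.Occ a (b + 1) y := by
    rintro c y h ⟨q, h1, h2, h3, h4⟩
    have := ((hcut c y).1 h).1 q (by omega) h3 h4
    split_ifs at this <;> omega
  ext y
  simp only [cutPts, above, Set.mem_ofPred_eq, Finset.mem_union, Finset.mem_image,
    Finset.mem_filter, Finset.mem_range]
  constructor
  · rintro ⟨hX, α, β, ⟨y', ⟨h1, h2⟩, h3⟩ | ⟨q, ⟨h1, h2⟩, h3⟩, -, h4, h5⟩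
    · have e1 : (G.cutPt N 0 y').1 = α := by rw [h3]
      have e2 : (G.cutPt N 0 y').2.1 = β := by rw [h3]
      have e3 : y' = y := (congrArg (fun t => t.2.2) h3 :)
      subst e1 e2 e3
      exact ⟨h2, hX, hsound _ _ ⟨h4, h5⟩⟩
    · have e1 : (G.cutPt N (q + 1) (G.key q)).1 = α := by rw [h3]
      have e2 : (G.cutPt N (q + 1) (G.key q)).2.1 = β := by rw [h3]
      have e3 : G.key q = y := (congrArg (fun t => t.2.2) h3 :)
      subst e1 e2 e3
      exact ⟨h2, hX, hsound _ _ ⟨h4, h5⟩⟩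
  · rintro ⟨hA', hX, ho⟩
    refine ⟨hX, ?_⟩
    by_cases h : G.Occ 0 a y
    -- The gap containing [a, b] begins right after the last occurrence before a.
    · obtain ⟨q, -, h1, h2, rfl, h3⟩ := exists_last h
      refine ⟨(G.cutPt N (q + 1) (G.key q)).1, (G.cutPt N (q + 1) (G.key q)).2.1,
        Or.inr ⟨q, ⟨by omega, hA'⟩, rfl⟩, Nat.zero_le _, (hcut _ _).2 ⟨fun q' i1 i2 i3 => ?_, ?_⟩⟩
      · split_ifs with hq
        · omega
        · by_contra hb'
          rcases Nat.lt_or_ge q' a with h4 | h4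
          · exact h3 ⟨q', by omega, h4, i2, i3⟩
          · exact ho ⟨q', h4, by omega, i2, i3⟩
      · intro q' i1 i2
        omega
    · refine ⟨(G.cutPt N 0 y).1, (G.cutPt N 0 y).2.1, Or.inl ⟨y, ⟨hA y hA', hA'⟩, rfl⟩,
        Nat.zero_le _, (hcut _ _).2 ⟨fun q' i1 i2 i3 => ?_, fun q' i1 => by omega⟩⟩
      rw [if_neg (by omega)]
      by_contra hb'
      rcases Nat.lt_or_ge q' a with h4 | h4
      · exact h ⟨q', by omega, h4, i2, i3⟩
      · exact ho ⟨q', h4, by omega, i2, i3⟩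

open Classical in
theorem card_firstPts_le : (G.firstPts N).card ≤ N :=
  Finset.card_image_le.trans ((Finset.card_filter_le _ _).trans (by simp))

open Classical in
theorem card_lastPts_le : (G.lastPts N).card ≤ N :=
  Finset.card_image_le.trans ((Finset.card_filter_le _ _).trans (by simp))

open Classical in
theorem card_cutPts_le : (G.cutPts N n A₀).card ≤ n + N :=
  (Finset.card_union_le _ _).trans (add_le_add
    (Finset.card_image_le.trans ((Finset.card_filter_le _ _).trans (by simp)))
    (Finset.card_image_le.trans ((Finset.card_filter_le _ _).trans (by simp))))

variable (G N n A₀) (B K : ℕ)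

open Classical in
/-- The keys in the blocks of length `B ^ k`. -/
noncomputable def blockKeys : Finset (List ℕ × ℕ) :=
  (((Finset.range N).filter fun q => G.ty q ≠ .query) ×ˢ Finset.range (K + 1)).image fun t =>
    -- Zeros pad the group name to six digits; the last digit is a tag that keeps the five kinds of
    -- groups apart.
    ([0, 0, t.1 / B ^ t.2, 0, t.2, 3], G.key t.1)

open Classical in
/-- The positions of the keys in the blocks of length `B ^ k`. -/
noncomputable def blockPositions : Finset (List ℕ × ℕ) :=
  (((Finset.range N).filter fun q => G.ty q ≠ .query) ×ˢ Finset.range (K + 1)).image fun t =>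
    ([0, G.key t.1, t.1 / B ^ t.2, 0, t.2, 4], t.1)

/-- All entries of the static index. -/
noncomputable def entries : Finset (List ℕ × ℕ) :=
  rangeGroups B K 0 (G.firstPts N) ∪ (rangeGroups B K 1 (G.lastPts N) ∪
    (rangeGroups B K 2 (G.cutPts N n A₀) ∪ (G.blockKeys N B K ∪ G.blockPositions N B K)))

variable {G N n A₀ B K}

theorem mem_rangeGroups_tag {tag tag' v u u' k k' y : ℕ} {P : Finset (ℕ × ℕ × ℕ)}
    (h : ([v, u, u', k, k', tag'], y) ∈ rangeGroups B K tag P) : tag' = tag := by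
  simp only [rangeGroups, Finset.mem_image, Prod.mk.injEq, List.cons.injEq] at h
  obtain ⟨t, -, ⟨-, -, -, -, -, h, -⟩, -⟩ := h
  exact h.symm

theorem mem_blockKeys {v u u' k k' tag y : ℕ} :
    ([v, u, u', k, k', tag], y) ∈ G.blockKeys N B K ↔ v = 0 ∧ u = 0 ∧ k = 0 ∧ tag = 3 ∧ k' ≤ K ∧
      ∃ q < N, q / B ^ k' = u' ∧ G.ty q ≠ .query ∧ G.key q = y := by
  simp only [blockKeys, Finset.mem_image, Finset.mem_product, Finset.mem_filter, Finset.mem_range,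
    Prod.exists, Prod.mk.injEq, List.cons.injEq]
  constructor
  · rintro ⟨q, l, ⟨⟨h1, h2⟩, h3⟩, ⟨rfl, rfl, rfl, rfl, rfl, rfl, -⟩, rfl⟩
    exact ⟨rfl, rfl, rfl, rfl, by omega, q, h1, rfl, h2, rfl⟩
  · rintro ⟨rfl, rfl, rfl, rfl, h, q, h1, rfl, h2, rfl⟩
    exact ⟨q, k', ⟨⟨h1, h2⟩, by omega⟩, ⟨rfl, rfl, rfl, rfl, rfl, rfl, trivial⟩, rfl⟩

theorem mem_blockPositions {v u u' k k' tag y : ℕ} :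
    ([v, u, u', k, k', tag], y) ∈ G.blockPositions N B K ↔ v = 0 ∧ k = 0 ∧ tag = 4 ∧ k' ≤ K ∧
      y < N ∧ y / B ^ k' = u' ∧ G.ty y ≠ .query ∧ G.key y = u := by
  simp only [blockPositions, Finset.mem_image, Finset.mem_product, Finset.mem_filter,
    Finset.mem_range, Prod.exists, Prod.mk.injEq, List.cons.injEq]
  constructor
  · rintro ⟨q, l, ⟨⟨h1, h2⟩, h3⟩, ⟨rfl, rfl, rfl, rfl, rfl, rfl, -⟩, rfl⟩
    exact ⟨rfl, rfl, rfl, by omega, h1, rfl, h2, rfl⟩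
  · rintro ⟨rfl, rfl, rfl, h, h1, rfl, h2, rfl⟩
    exact ⟨y, k', ⟨⟨h1, h2⟩, by omega⟩, ⟨rfl, rfl, rfl, rfl, rfl, rfl, trivial⟩, rfl⟩

theorem mem_entries {v u u' k k' tag y : ℕ} :
    ([v, u, u', k, k', tag], y) ∈ G.entries N n A₀ B K ↔
      (tag = 0 ∧ ([v, u, u', k, k', tag], y) ∈ rangeGroups B K 0 (G.firstPts N)) ∨
      (tag = 1 ∧ ([v, u, u', k, k', tag], y) ∈ rangeGroups B K 1 (G.lastPts N)) ∨
      (tag = 2 ∧ ([v, u, u', k, k', tag], y) ∈ rangeGroups B K 2 (G.cutPts N n A₀)) ∨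
      (tag = 3 ∧ ([v, u, u', k, k', tag], y) ∈ G.blockKeys N B K) ∨
      (tag = 4 ∧ ([v, u, u', k, k', tag], y) ∈ G.blockPositions N B K) := by
  simp only [entries, Finset.mem_union]
  constructor
  · rintro (h | h | h | h | h)
    · exact Or.inl ⟨mem_rangeGroups_tag h, h⟩
    · exact Or.inr (Or.inl ⟨mem_rangeGroups_tag h, h⟩)
    · exact Or.inr (Or.inr (Or.inl ⟨mem_rangeGroups_tag h, h⟩))
    · exact Or.inr (Or.inr (Or.inr (Or.inl ⟨(mem_blockKeys.1 h).2.2.2.1, h⟩)))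
    · exact Or.inr (Or.inr (Or.inr (Or.inr ⟨(mem_blockPositions.1 h).2.2.1, h⟩)))
  · rintro (h | h | h | h | h)
    · exact Or.inl h.2
    · exact Or.inr (Or.inl h.2)
    · exact Or.inr (Or.inr (Or.inl h.2))
    · exact Or.inr (Or.inr (Or.inr (Or.inl h.2)))
    · exact Or.inr (Or.inr (Or.inr (Or.inr h.2)))

open Classical in
theorem card_entries_le (hB : 0 < B) (hn : n ≤ N) :
    (G.entries N n A₀ B K).card ≤ 6 * N * ((K + 1) ^ 2 * B ^ 3) := by
  have h1 := (card_rangeGroups_le B K 0 (G.firstPts N)).trans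
    (Nat.mul_le_mul_right _ card_firstPts_le)
  have h2 := (card_rangeGroups_le B K 1 (G.lastPts N)).trans
    (Nat.mul_le_mul_right _ card_lastPts_le)
  have h3 := (card_rangeGroups_le B K 2 (G.cutPts N n A₀)).trans
    (Nat.mul_le_mul_right _ card_cutPts_le)
  have h4 : (G.blockKeys N B K).card ≤ N * (K + 1) := by
    refine Finset.card_image_le.trans ?_
    rw [Finset.card_product, Finset.card_range]
    exact Nat.mul_le_mul_right _ ((Finset.card_filter_le _ _).trans (by simp))
  have h5 : (G.blockPositions N B K).card ≤ N * (K + 1) := by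
    refine Finset.card_image_le.trans ?_
    rw [Finset.card_product, Finset.card_range]
    exact Nat.mul_le_mul_right _ ((Finset.card_filter_le _ _).trans (by simp))
  have h6 : N * (K + 1) ≤ N * ((K + 1) ^ 2 * B ^ 3) := by
    refine Nat.mul_le_mul_left _ ?_
    calc K + 1 ≤ (K + 1) ^ 2 := Nat.le_self_pow (by omega) _
      _ ≤ (K + 1) ^ 2 * B ^ 3 := Nat.le_mul_of_pos_right _ (by positivity)
  have h7 : n * ((K + 1) ^ 2 * B ^ 3) ≤ N * ((K + 1) ^ 2 * B ^ 3) := Nat.mul_le_mul_right _ hn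
  unfold entries
  refine (Finset.card_union_le _ _).trans ?_
  have i1 := Finset.card_union_le (rangeGroups B K 1 (G.lastPts N))
    (rangeGroups B K 2 (G.cutPts N n A₀) ∪ (G.blockKeys N B K ∪ G.blockPositions N B K))
  have i2 := Finset.card_union_le (rangeGroups B K 2 (G.cutPts N n A₀))
    (G.blockKeys N B K ∪ G.blockPositions N B K)
  have i3 := Finset.card_union_le (G.blockKeys N B K) (G.blockPositions N B K)
  rw [add_mul] at h3
  rw [mul_assoc]
  generalize (K + 1) ^ 2 * B ^ 3 = c at *
  generalize N * c = d at *
  omega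

end Line

/-! ### Storage layout -/

/-- The part of the storage that changes: state variables, stack, stored values. -/
structure Store where
  vars : ℕ → ℕ
  L : ℕ → ℕ
  H : ℕ → ℕ
  V : ℕ → ℕ
  W : ℕ → ℕ

/-- The storage: cell `o` of region `i` has address `o * 16 + i`. -/
def Store.enc (rest : ℕ → ℕ → ℕ) (m : Store) (a : ℕ) : ℕ :=
  if a % 16 = 1 then m.vars (a / 16) else if a % 16 = 2 then m.L (a / 16)
  else if a % 16 = 3 then m.H (a / 16) else if a % 16 = 4 then m.V (a / 16)
  else if a % 16 = 5 then m.W (a / 16) else rest (a % 16) (a / 16)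

section enc
variable {rest : ℕ → ℕ → ℕ} {m : Store} {o : ℕ}

theorem enc_vars : m.enc rest (o * 16 + 1) = m.vars o := by
  have h1 : (o * 16 + 1) % 16 = 1 := by omega
  have h2 : (o * 16 + 1) / 16 = o := by omega
  simp [Store.enc, h1, h2]

theorem enc_L : m.enc rest (o * 16 + 2) = m.L o := by
  have h1 : (o * 16 + 2) % 16 = 2 := by omega
  have h2 : (o * 16 + 2) / 16 = o := by omega
  simp [Store.enc, h1, h2]

theorem enc_H : m.enc rest (o * 16 + 3) = m.H o := by
  have h1 : (o * 16 + 3) % 16 = 3 := by omega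
  have h2 : (o * 16 + 3) / 16 = o := by omega
  simp [Store.enc, h1, h2]

theorem enc_V : m.enc rest (o * 16 + 4) = m.V o := by
  have h1 : (o * 16 + 4) % 16 = 4 := by omega
  have h2 : (o * 16 + 4) / 16 = o := by omega
  simp [Store.enc, h1, h2]

theorem enc_W : m.enc rest (o * 16 + 5) = m.W o := by
  have h1 : (o * 16 + 5) % 16 = 5 := by omega
  have h2 : (o * 16 + 5) / 16 = o := by omega
  simp [Store.enc, h1, h2]

theorem enc_rest {i : ℕ} (hi : i = 0 ∨ 5 < i) (h : i < 16) :
    m.enc rest (o * 16 + i) = rest i o := by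
  have h1 : (o * 16 + i) % 16 = i := by omega
  have h2 : (o * 16 + i) / 16 = o := by omega
  unfold Store.enc
  rw [h1, h2, if_neg (by omega), if_neg (by omega), if_neg (by omega), if_neg (by omega),
    if_neg (by omega)]

theorem update_enc {m m' : Store} {i o v : ℕ} (hi : i < 16)
    (h : ∀ o', m'.enc rest (o' * 16 + i) = if o' = o then v else m.enc rest (o' * 16 + i))
    (h' : ∀ j < 16, j ≠ i → ∀ o', m'.enc rest (o' * 16 + j) = m.enc rest (o' * 16 + j)) :
    Function.update (m.enc rest) (o * 16 + i) v = m'.enc rest := by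
  funext a
  have ha := Nat.div_add_mod' a 16
  rw [Function.update_apply]
  by_cases hj : a % 16 = i
  · have h3 := h (a / 16)
    rw [← hj, ha] at h3
    rw [h3]
    by_cases ho : a / 16 = o
    · rw [if_pos ho, if_pos (by omega)]
    · rw [if_neg ho, if_neg (by omega)]
  · have h3 := h' (a % 16) (Nat.mod_lt _ (by omega)) hj (a / 16)
    rw [ha] at h3
    rw [h3, if_neg (by omega)]

end enc

/-- The offset of a stored value. -/
def slotOff (B K q κ k j : ℕ) : ℕ := ((q * (K + 1) + κ) * (K + 1) + k) * (2 * B) + j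

theorem mul_add_inj {c a b a' b' : ℕ} (hb : b < c) (hb' : b' < c) (h : a * c + b = a' * c + b') :
    a = a' ∧ b = b' := by
  have hc : 0 < c := by omega
  have e : ∀ x y, y < c → (x * c + y) / c = x := fun x y hy => by
    rw [mul_comm, Nat.mul_add_div hc, Nat.div_eq_of_lt hy, add_zero]
  have h1 : a = a' := by rw [← e a b hb, h, e a' b' hb']
  subst h1
  exact ⟨rfl, by omega⟩

theorem slotOff_inj {B K q κ k j q' κ' k' j' : ℕ} (h1 : κ ≤ K) (h2 : k ≤ K) (h3 : j < 2 * B)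
    (h1' : κ' ≤ K) (h2' : k' ≤ K) (h3' : j' < 2 * B)
    (h : slotOff B K q κ k j = slotOff B K q' κ' k' j') : (q, κ, k, j) = (q', κ', k', j') := by
  obtain ⟨h, e1⟩ := mul_add_inj h3 h3' h
  obtain ⟨h, e2⟩ := mul_add_inj (by omega) (by omega) h
  obtain ⟨e3, e4⟩ := mul_add_inj (by omega) (by omega) h
  rw [e1, e2, e3, e4]

/-- The number of stored values. -/
def slotCount (n B K : ℕ) : ℕ := (2 * n + 1) * (K + 1) * (K + 1) * (2 * B)

theorem slotOff_lt {B K q κ k j n : ℕ} (hq : q < 2 * n + 1) (h1 : κ ≤ K) (h2 : k ≤ K)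
    (h3 : j < 2 * B) : slotOff B K q κ k j < slotCount n B K := by
  have step : ∀ {a b c d : ℕ}, a < b → d < c → a * c + d < b * c := by
    intro a b c d hab hd
    calc a * c + d < a * c + c := by omega
      _ = (a + 1) * c := by ring
      _ ≤ b * c := Nat.mul_le_mul_right _ hab
  exact step (step (step hq (by omega)) (by omega)) h3

/-- The stored value, as a function on meaningful arguments. -/
def slotVal (B K : ℕ) (f : ℕ → ℕ) (q κ k j : ℕ) : ℕ :=
  if κ ≤ K ∧ k ≤ K ∧ j < 2 * B then f (slotOff B K q κ k j) else 0

/-- Relations between the parameters: `n` nodes, fan-out `B`, depth `K`, `M` words of `w` bits. -/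
structure Params (w M n B K : ℕ) : Prop where
  three_le : 3 ≤ n
  five_le : 5 ≤ B
  K_pos : 1 ≤ K
  K_lt : K < B
  lt_pow : 2 * n + 3 ≤ B ^ K
  pow_lt : B ^ (7 * (K + 1)) < 2 ^ w
  le_M : (slotCount n B K + (2 * n + 1) + 16) * 16 ≤ M

/-- The static part of the storage. -/
structure Static (w M n B K : ℕ) (G : Line) (A₀ : Set ℕ) (nodeOf nodeAt : ℕ → ℕ)
    (rest : ℕ → ℕ → ℕ) : Prop extends Params w M n B K where
  index : ∀ m : Store, HasIndex M B K (2 * n + 1) (G.entries (2 * n + 1) n A₀ B K) (m.enc rest)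
  two_n : rest 0 2 = 2 * n + 1
  n_eq : rest 0 3 = n
  key_eq : ∀ q < 2 * n + 1, rest 8 q = G.key q
  nodeOf_eq : ∀ r ≤ 2 * n + 1, rest 9 r = nodeOf r
  nodeAt_eq : ∀ q < 2 * n + 1, rest 10 q = nodeAt q
  key_lt : ∀ q, G.key q < n
  init_lt : ∀ y ∈ A₀, y < n

namespace Ex

/-- Least element of `firstIn X r h l`. -/
def first (K : ℕ) (r h l X : Ex) : Ex :=
  range K 0 (.add r (.lit 1)) (.add h (.lit 1)) (.add l (.lit 1)) X

/-- Least element of `lastIn X l c r`. -/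
def last (K : ℕ) (l c r X : Ex) : Ex := range K 1 l c (.sub (.cst 0 2) r) X

/-- Least initially active key `≥ X` that does not occur in `[a, b]`. -/
def initial (K : ℕ) (a b X : Ex) : Ex :=
  range K 2 (.lit 0) (.add a (.lit 1)) (.sub (.cst 0 2) b) X

def thr (q : Ex) (κ : ℕ) : Ex := if κ = 0 then .get 8 q else .get 8 (.sub q (base.pow κ))

def slotOff (K : ℕ) (q : Ex) (κ k : ℕ) (j : Ex) : Ex :=
  .add (.mul (.add (.mul (.add (.mul q (.lit (K + 1))) (.lit κ)) (.lit (K + 1))) (.lit k))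
    (.mul (.lit 2) base)) j

/-- The offset of the value stored at level `k` for position `q` and left end `l`. -/
def slot (K : ℕ) (q : Ex) (κ : ℕ) (l : Ex) (k : ℕ) : Ex :=
  slotOff K q κ k (.sub (.div q (base.pow k)) (.div l (base.pow k)))

/-- Choice of the level, from above. -/
def byLev (q l : Ex) (body : ℕ → Ex) : ℕ → Ex
  | 0 => body 0
  | k + 1 => .ite (.add (.div l (base.pow (k + 1))) (.lit 1)) (.div q (base.pow (k + 1)))
      (body (k + 1)) (byLev q l body k)

/-- Answer of the query `κ` at position `q` beyond the interval `[l, h]`, for levels up to `j`. -/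
def eval (K : ℕ) : ℕ → Ex → ℕ → Ex → Ex → Ex
  | 0, q, κ, l, _ => .get 4 (slot K q κ l 0)
  | j + 1, q, κ, l, h =>
    .ite (.add (.div l (base.pow (j + 1))) (.lit 1)) (.div q (base.pow (j + 1)))
      (.ite (look K [.lit 0, .lit 0, .div l (base.pow (j + 1)), .lit 0, .lit (j + 1), .lit 3]
          (thr q κ)) (.cst 0 2)
        (.min (.min (.get 4 (slot K q κ l (j + 1)))
            (first K h (.get 5 (slot K q κ l (j + 1)))
              (.mul (.div l (base.pow (j + 1))) (base.pow (j + 1))) (thr q κ)))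
          (eval K j (.add (look K [.lit 0,
              look K [.lit 0, .lit 0, .div l (base.pow (j + 1)), .lit 0, .lit (j + 1), .lit 3]
                (thr q κ), .div l (base.pow (j + 1)), .lit 0, .lit (j + 1), .lit 4] (.lit 0))
              (base.pow (j + 1))) (j + 1) l h))
        (.min (.get 4 (slot K q κ l (j + 1)))
            (first K h (.get 5 (slot K q κ l (j + 1)))
              (.mul (.div l (base.pow (j + 1))) (base.pow (j + 1))) (thr q κ))))
      (eval K j q κ l h)

end Ex

/-- At the next coarser level q is less than two blocks away from l, which means fewer than 2B
blocks at the level itself. Level K cannot occur, as q lies in the block 0 there. -/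
theorem lev_diff_lt {B K q l : ℕ} (hB : 0 < B) (hK : 1 ≤ K) (hq : q < B ^ K) :
    q / B ^ lev B K q l - l / B ^ lev B K q l < 2 * B := by
  rcases Nat.lt_or_ge (lev B K q l) K with h | h
  · have h1 := lev_max (Nat.lt_succ_self (lev B K q l)) h
    generalize lev B K q l = k at *
    have e : ∀ y, y / B ^ (k + 1) = y / B ^ k / B := fun y => by
      rw [pow_succ, Nat.div_div_eq_div_mul]
    rw [e, e] at h1
    generalize q / B ^ k = x at *
    generalize l / B ^ k = y at *
    have h2 := Nat.div_add_mod' x B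
    have h3 := Nat.mod_lt x hB
    have h4 := Nat.div_mul_le_self y B
    have h5 : x / B * B ≤ (y / B + 1) * B := Nat.mul_le_mul_right _ (by omega)
    rw [add_mul] at h5
    omega
  · have h0 : lev B K q l = K := le_antisymm (lev_le _ _ _ _) h
    have h1 := lev_spec (B := B) (K := K) (q := q) (l := l) (by omega)
    rw [h0, Nat.div_eq_of_lt hq] at h1
    have := Nat.zero_le (l / B ^ K)
    omega

/-! ### Machine evaluation of static queries and stored values -/

section
variable {w M n B K : ℕ} {G : Line} {A₀ A : Set ℕ} {nodeOf nodeAt : ℕ → ℕ} {rest : ℕ → ℕ → ℕ}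
  {m : Store} {x : ℕ}

theorem Ev.lit_le (hb : Bounded w M (m.enc rest)) {k : ℕ} (hk : k ≤ 16) :
    Ev w M (m.enc rest) x (.lit k) k := .lit (hk.trans_lt hb.lt)

section params
variable (E : Static w M n B K G A₀ nodeOf nodeAt rest) (hb : Bounded w M (m.enc rest))
include E

theorem Static.lt_pow_succ : 2 * n + 3 + B ≤ B ^ (K + 1) := by
  have h1 := E.lt_pow
  have h2 := E.five_le
  rw [pow_succ]
  have h3 : B ^ K * 2 ≤ B ^ K * B := Nat.mul_le_mul_left _ (by omega)
  have h4 : B ^ 1 ≤ B ^ K := Nat.pow_le_pow_right (by omega) E.K_pos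
  rw [pow_one] at h4
  omega

theorem Static.pow_succ_lt : B ^ (K + 1) < 2 ^ w :=
  lt_of_le_of_lt (Nat.pow_le_pow_right (by have := E.five_le; omega) (by omega)) E.pow_lt

theorem Static.two_mul_le : 2 * B ≤ B ^ (K + 1) := by
  have h1 := E.lt_pow
  rw [pow_succ]
  exact Nat.mul_le_mul_right _ (by omega)

theorem Static.M_ge : (2 * n + 1 + 16) * 16 ≤ M :=
  le_trans (Nat.mul_le_mul_right _ (by omega)) E.le_M

include hb

theorem Ev.base' : Ev w M (m.enc rest) x .base B := Ev.base hb (E.index m)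

theorem Ev.basePow {k : ℕ} (hk : k ≤ K) : Ev w M (m.enc rest) x (Ex.base.pow k) (B ^ k) := by
  have := E.five_le
  exact .pow (by omega) (Ev.base' E hb) k (lt_of_le_of_lt (Nat.pow_le_pow_right (by omega)
    (by omega)) E.pow_succ_lt)

theorem Ev.size : Ev w M (m.enc rest) x (.cst 0 2) (2 * n + 1) :=
  (Ev.cst hb (by have := E.M_ge; omega)).of_eq (by rw [enc_rest (by omega) (by omega), E.two_n])

theorem Ev.nodes : Ev w M (m.enc rest) x (.cst 0 3) n :=
  (Ev.cst hb (by have := E.M_ge; omega)).of_eq (by rw [enc_rest (by omega) (by omega), E.n_eq])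

theorem Ev.add_one {e : Ex} {v : ℕ} (h : Ev w M (m.enc rest) x e v) (hv : v < 2 * n + 2) :
    Ev w M (m.enc rest) x (.add e (.lit 1)) (v + 1) :=
  .add h (Ev.lit_le hb (by omega)) (by have := E.lt_pow_succ; have := E.pow_succ_lt; omega)

theorem Ev.key {e : Ex} {q : ℕ} (h : Ev w M (m.enc rest) x e q) (hq : q < 2 * n + 1) :
    Ev w M (m.enc rest) x (.get 8 e) (G.key q) :=
  (Ev.get hb h (by have := E.M_ge; omega)).of_eq (by
    rw [enc_rest (by omega) (by omega), E.key_eq q hq])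

theorem Ev.thr {e : Ex} {q κ : ℕ} (h : Ev w M (m.enc rest) x e q) (hq : q < 2 * n + 1)
    (hκ : κ ≤ K) : Ev w M (m.enc rest) x (.thr e κ) (G.thr B q κ) := by
  unfold Ex.thr Line.thr
  split_ifs with h0
  · exact Ev.key E hb h hq
  · exact Ev.key E hb (.sub' h (Ev.basePow E hb hκ)) (by omega)

omit hb in
theorem Static.thr_lt (q κ : ℕ) : G.thr B q κ < n := by
  unfold Line.thr
  split_ifs
  · exact E.key_lt _
  · exact E.key_lt _

theorem Ev.first {er eh el eX : Ex} {r h l X : ℕ} (hr : Ev w M (m.enc rest) x er r)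
    (hh : Ev w M (m.enc rest) x eh h) (hl : Ev w M (m.enc rest) x el l)
    (hX : Ev w M (m.enc rest) x eX X) (h1 : r < 2 * n + 1) (h2 : h < 2 * n + 1)
    (h3 : l < 2 * n + 1) (h4 : X < n) :
    Ev w M (m.enc rest) x (.first K er eh el eX) (mn (2 * n + 1) (G.firstIn X r h l)) := by
  have h5 := E.lt_pow_succ
  have h6 := E.five_le
  rw [← Line.firstIn_eq h2]
  refine Ev.range hb (E.index m) E.pow_lt E.K_lt (by omega) (fun v u u' k k' y => ?_)
    (Ev.add_one E hb hr (by omega)) (Ev.add_one E hb hh (by omega))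
    (Ev.add_one E hb hl (by omega)) hX (by omega) (by omega) (by omega) (by omega)
  rw [Line.mem_entries]
  simp

theorem Ev.last {el ec er eX : Ex} {l c r X : ℕ} (hl : Ev w M (m.enc rest) x el l)
    (hc : Ev w M (m.enc rest) x ec c) (hr : Ev w M (m.enc rest) x er r)
    (hX : Ev w M (m.enc rest) x eX X) (h1 : l ≤ 2 * n + 1) (h2 : c ≤ 2 * n + 1)
    (h3 : r < 2 * n + 1) (h4 : X < n) :
    Ev w M (m.enc rest) x (.last K el ec er eX) (mn (2 * n + 1) (G.lastIn X l c r)) := by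
  have h5 := E.lt_pow_succ
  have h6 := E.five_le
  rw [← Line.lastIn_eq h2 h3]
  refine Ev.range hb (E.index m) E.pow_lt E.K_lt (by omega) (fun v u u' k k' y => ?_)
    hl hc (.sub' (Ev.size E hb) hr) hX (by omega) (by omega) (by omega) (by omega)
  rw [Line.mem_entries]
  simp

theorem Ev.initial {ea eb eX : Ex} {a b X : ℕ} (ha : Ev w M (m.enc rest) x ea a)
    (hb' : Ev w M (m.enc rest) x eb b) (hX : Ev w M (m.enc rest) x eX X) (h1 : a ≤ b)
    (h2 : b < 2 * n + 1) (h4 : X < n) :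
    Ev w M (m.enc rest) x (.initial K ea eb eX) (mn (2 * n + 1) (G.above A₀ X a b)) := by
  have h5 := E.lt_pow_succ
  have h6 := E.five_le
  rw [← Line.above_init_eq E.init_lt h2 h1]
  refine Ev.range hb (E.index m) E.pow_lt E.K_lt (by omega) (fun v u u' k k' y => ?_)
    (Ev.lit_le hb (by omega)) (Ev.add_one E hb ha (by omega)) (.sub' (Ev.size E hb) hb') hX
    (by omega) (by omega) (by omega) (by omega)
  rw [Line.mem_entries]
  simp

theorem Ev.slotOff {eq ej : Ex} {q κ k j : ℕ} (hq : Ev w M (m.enc rest) x eq q)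
    (hj : Ev w M (m.enc rest) x ej j) (h1 : q < 2 * n + 1) (h2 : κ ≤ K) (h3 : k ≤ K)
    (h4 : j < 2 * B) :
    Ev w M (m.enc rest) x (.slotOff K eq κ k ej) (CycleSucc.slotOff B K q κ k j) := by
  have h5 := slotOff_lt h1 h2 h3 h4
  have h6 := E.le_M
  have h7 := hb.le
  have h8 := E.five_le
  have h9 := E.lt_pow_succ
  have h10 := E.pow_succ_lt
  have h11 := E.K_lt
  have hlt : CycleSucc.slotOff B K q κ k j < 2 ^ w := by omega
  unfold CycleSucc.slotOff at *
  have m1 : (q * (K + 1) + κ) * (K + 1) + k ≤ ((q * (K + 1) + κ) * (K + 1) + k) * (2 * B) :=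
    Nat.le_mul_of_pos_right _ (by omega)
  have m2 : q * (K + 1) + κ ≤ (q * (K + 1) + κ) * (K + 1) :=
    Nat.le_mul_of_pos_right _ (by omega)
  exact .add (.mul (.add (.mul (.add (.mul hq (.lit (by omega)) (by omega)) (.lit (by omega))
    (by omega)) (.lit (by omega)) (by omega)) (.lit (by omega)) (by omega))
    (.mul (Ev.lit_le hb (by omega)) (Ev.base' E hb) (by have := E.two_mul_le; omega)) (by omega))
    hj hlt

theorem Ev.slot {eq el : Ex} {q κ k l : ℕ} (hq : Ev w M (m.enc rest) x eq q)
    (hl : Ev w M (m.enc rest) x el l) (h1 : q < 2 * n + 1) (h2 : κ ≤ K) (h3 : k ≤ K)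
    (h4 : q / B ^ k - l / B ^ k < 2 * B) :
    Ev w M (m.enc rest) x (.slot K eq κ el k)
      (CycleSucc.slotOff B K q κ k (q / B ^ k - l / B ^ k)) :=
  Ev.slotOff E hb hq (.sub' (.div' hq (Ev.basePow E hb h3)) (.div' hl (Ev.basePow E hb h3)))
    h1 h2 h3 h4

theorem Ev.slotV {e : Ex} {q κ k j : ℕ}
    (h : Ev w M (m.enc rest) x e (CycleSucc.slotOff B K q κ k j)) (h1 : q < 2 * n + 1)
    (h2 : κ ≤ K) (h3 : k ≤ K) (h4 : j < 2 * B) :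
    Ev w M (m.enc rest) x (.get 4 e) (slotVal B K m.V q κ k j) := by
  refine (Ev.get hb h ?_).of_eq ?_
  · have := slotOff_lt h1 h2 h3 h4
    have := E.le_M
    omega
  · rw [enc_V, slotVal, if_pos ⟨h2, h3, h4⟩]

theorem Ev.slotW {e : Ex} {q κ k j : ℕ}
    (h : Ev w M (m.enc rest) x e (CycleSucc.slotOff B K q κ k j)) (h1 : q < 2 * n + 1)
    (h2 : κ ≤ K) (h3 : k ≤ K) (h4 : j < 2 * B) :
    Ev w M (m.enc rest) x (.get 5 e) (slotVal B K m.W q κ k j) := by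
  refine (Ev.get hb h ?_).of_eq ?_
  · have := slotOff_lt h1 h2 h3 h4
    have := E.le_M
    omega
  · rw [enc_W, slotVal, if_pos ⟨h2, h3, h4⟩]

/-- The program text mentions all K + 1 levels; going down from the top, the first level that passes
the test is the maximal one. Only the body for this level has to be evaluable. -/
theorem Ev.byLev {eq el : Ex} {q l : ℕ} (hq : Ev w M (m.enc rest) x eq q)
    (hl : Ev w M (m.enc rest) x el l) (hlN : l < 2 * n + 1)
    {body : ℕ → Ex} {v : ℕ} (hv : Ev w M (m.enc rest) x (body (lev B K q l)) v) :
    ∀ j ≤ K, lev B K q l ≤ j → Ev w M (m.enc rest) x (.byLev eq el body j) v := by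
  intro j
  induction j with
  | zero =>
    intro _ h
    rw [Nat.le_zero.1 h] at hv
    exact hv
  | succ j ih =>
    intro hj h
    have hp := Ev.basePow (x := x) E hb hj
    have h1 : l / B ^ (j + 1) ≤ l := Nat.div_le_self _ _
    have e1 := Ev.add_one E hb (.div' hl hp) (by omega)
    by_cases c : l / B ^ (j + 1) + 1 < q / B ^ (j + 1)
    · have : lev B K q l = j + 1 := le_antisymm h (le_lev hj c)
      rw [this] at hv
      exact .ite_pos e1 (.div' hq hp) c hv
    · refine .ite_neg e1 (.div' hq hp) c (ih (by omega) ?_)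
      by_contra hlt
      have h2 : lev B K q l = j + 1 := by omega
      have := lev_spec (B := B) (K := K) (q := q) (l := l) (by omega)
      rw [h2] at this
      exact c this

/-- The slot gives the answer beyond the outermost interval F of the block, and `above_block` leads
back to D. The keys of the block are handled by one recursive query at a smaller position and a
lower level. Since D is not the first interval, none of the slots used is exempt. -/
theorem Ev.eval {s : State} {κ₀ : ℕ} (hi : Inv G n A₀ A s)
    (hs : Slots G (2 * n + 1) B K A s.p κ₀ s.st (slotVal B K m.V) (slotVal B K m.W))
    {D e' : ℕ × ℕ} (hD : D ∈ s.st) (he' : e' ∈ s.st) (hDe : D.1 < e'.1) {el eh : Ex}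
    (hel : Ev w M (m.enc rest) x el D.1) (heh : Ev w M (m.enc rest) x eh D.2) :
    ∀ j ≤ K, ∀ (eq : Ex) (q κ : ℕ), Ev w M (m.enc rest) x eq q → D.1 < q → q ≤ e'.2 → κ ≤ K →
      lev B K q D.1 ≤ j → Ev w M (m.enc rest) x (.eval K j eq κ el eh)
        (mn (2 * n + 1) (G.above A (G.thr B q κ) D.1 D.2)) := by
  have hB : 0 < B := by have := E.five_le; omega
  have hst2 : ∀ F ∈ s.st, F.2 < 2 * n + 1 := by
    intro F hF
    have h1 := hi.nest
    have h2 := hi.b_le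
    have : ∀ st : List (ℕ × ℕ), Nest s.a s.b st → ∀ F ∈ st, F.2 ≤ s.b := by
      intro st
      induction st with
      | nil => intro _ F hF; simp at hF
      | cons e t ih =>
        intro hn F hF
        rcases List.mem_cons.1 hF with rfl | hF
        · exact hn.nextH_le
        · exact ih hn.2.2 F hF
    have := this _ h1 F hF
    omega
  have hcD := hi.contains D hD
  have hDN := hst2 D hD
  have heN := hst2 e' he'
  -- the stored value
  have stored : ∀ (eq : Ex) (q κ : ℕ), Ev w M (m.enc rest) x eq q → D.1 < q → q ≤ e'.2 → κ ≤ K →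
      ∀ F, IsOuter (B ^ lev B K q D.1) s.st D F →
        Ev w M (m.enc rest) x (.get 4 (.slot K eq κ el (lev B K q D.1)))
          (mn (2 * n + 1) (G.above A (G.thr B q κ) F.1 F.2)) ∧
        Ev w M (m.enc rest) x (.get 5 (.slot K eq κ el (lev B K q D.1))) F.2 := by
    intro eq q κ hq h1 h2 hκ F hF
    have hd := lev_diff_lt (B := B) (K := K) (q := q) (l := D.1) hB E.K_pos
      (by have := E.lt_pow; omega)
    have hso := Ev.slot E hb hq hel (by omega) hκ (lev_le B K q D.1) hd
    obtain ⟨i1, i2⟩ := hs D hD q h1 (Or.inr ⟨e', he', hDe, h2⟩) κ hκ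
      (Or.inr (Or.inr ⟨e', he', hDe⟩)) F hF
    exact ⟨(Ev.slotV E hb hso (by omega) hκ (lev_le _ _ _ _) hd).of_eq i1,
      (Ev.slotW E hb hso (by omega) hκ (lev_le _ _ _ _) hd).of_eq i2⟩
  intro j
  induction j with
  | zero =>
    intro _ eq q κ hq h1 h2 hκ hlev
    obtain ⟨F, hF⟩ := exists_isOuter (B ^ lev B K q D.1) hD
    obtain ⟨i1, -⟩ := stored eq q κ hq h1 h2 hκ F hF
    have h0 : lev B K q D.1 = 0 := by omega
    -- At level 0 the blocks are single positions, and left ends in the stack are distinct.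
    have hFD : F = D := by
      have := hF.block
      rw [h0, pow_zero, Nat.div_one, Nat.div_one] at this
      rcases hi.nest.eq_or_lt hF.mem hD with h | h | h
      · exact h
      · omega
      · omega
    rw [h0, hFD] at i1
    exact i1
  | succ j ih =>
    intro hj eq q κ hq h1 h2 hκ hlev
    have hp := Ev.basePow (x := x) E hb hj
    have h3 : D.1 / B ^ (j + 1) ≤ D.1 := Nat.div_le_self _ _
    have e1 := Ev.add_one E hb (.div' hel hp) (by omega)
    by_cases c : D.1 / B ^ (j + 1) + 1 < q / B ^ (j + 1)
    swap
    · refine .ite_neg e1 (.div' hq hp) c (ih (by omega) eq q κ hq h1 h2 hκ ?_)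
      by_contra hlt
      have h2 : lev B K q D.1 = j + 1 := by omega
      have := lev_spec (B := B) (K := K) (q := q) (l := D.1) (by omega)
      rw [h2] at this
      exact c this
    have hl : lev B K q D.1 = j + 1 := le_antisymm hlev (le_lev hj c)
    refine .ite_pos e1 (.div' hq hp) c ?_
    obtain ⟨F, hF⟩ := exists_isOuter (B ^ lev B K q D.1) hD
    obtain ⟨i1, i2⟩ := stored eq q κ hq h1 h2 hκ F hF
    rw [hl] at hF i1 i2
    have hpos : 0 < B ^ (j + 1) := Nat.pow_pos hB
    have hX := Ev.thr (κ := κ) E hb hq (by omega) hκ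
    have hXn := E.thr_lt (B := B) q κ
    set X := G.thr B q κ with hXdef
    have hFN := hst2 F hF.mem
    have hmul : D.1 / B ^ (j + 1) * B ^ (j + 1) ≤ D.1 := Nat.div_mul_le_self _ _
    have i3 := Ev.first E hb heh i2 (.mul (.div' hel hp) hp (by
      have := E.lt_pow_succ; have := E.pow_succ_lt; omega)) hX hDN hFN (by omega) hXn
    have i4 := Ev.min_mn i1 i3
    have hpw := E.lt_pow_succ
    have hKB := E.K_lt
    have h5 := E.five_le
    have hlit : ∀ k ≤ K, Ev w M (m.enc rest) x (.lit k) k := fun k hk => .lit (by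
      have := E.pow_succ_lt
      omega)
    -- the least key of the block
    have hr := Ev.look (K := K) (x := x) hb (E.index m) E.pow_lt
      (g := [0, 0, D.1 / B ^ (j + 1), 0, j + 1, 3])
      (.cons (Ev.lit_le hb (by omega)) (.cons (Ev.lit_le hb (by omega)) (.cons (.div' hel hp)
        (.cons (Ev.lit_le hb (by omega)) (.cons (hlit _ hj)
          (.cons (Ev.lit_le hb (by omega)) .nil)))))) hX rfl (by
        intro d hd
        simp only [List.mem_cons, List.not_mem_nil, or_false] at hd
        rcases hd with rfl | rfl | rfl | rfl | rfl | rfl <;> omega) (by omega)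
    set r := mn (2 * n + 1) {y | ([0, 0, D.1 / B ^ (j + 1), 0, j + 1, 3], y) ∈
      G.entries (2 * n + 1) n A₀ B K ∧ X ≤ y} with hrdef
    have hrmem : ∀ y, ([0, 0, D.1 / B ^ (j + 1), 0, j + 1, 3], y) ∈
        G.entries (2 * n + 1) n A₀ B K ↔ ∃ q < 2 * n + 1, q / B ^ (j + 1) = D.1 / B ^ (j + 1) ∧
          G.ty q ≠ .query ∧ G.key q = y := by
      intro y
      rw [Line.mem_entries]
      simp [Line.mem_blockKeys, hj]
    have hblock : ∀ Z : Set ℕ, Z ⊆ G.above A X D.1 D.2 →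
        (∀ q < 2 * n + 1, q / B ^ (j + 1) = D.1 / B ^ (j + 1) → G.ty q ≠ .query →
          G.key q ∈ G.above A X D.1 D.2 → G.key q ∈ Z) →
        G.above A X D.1 D.2 = G.above A X F.1 F.2 ∪
          (G.firstIn X D.2 F.2 (D.1 / B ^ (j + 1) * B ^ (j + 1)) ∪ Z) := by
      intro Z hZ hZ'
      have hle := hF.le D hD rfl
      refine Line.above_block hle ?_ (P := 2 * n + 1) (by omega) hpos hF.block ?_ hZ hZ'
      · rcases hi.nest.eq_or_lt hF.mem hD with h | h | h
        · rw [h]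
        · omega
        · omega
      · exact hi.good.right_of_mem hi.nest D hD F hF.mem
    by_cases hrN : r < 2 * n + 1
    · refine .ite_pos hr (Ev.size E hb) hrN ?_
      have hrm := mn_mem_of_lt hrN
      rw [← hrdef] at hrm
      obtain ⟨hrm1, hXr⟩ := hrm
      obtain ⟨o₁, ho₁, ho₂, ho₃, ho₄⟩ := (hrmem r).1 hrm1
      -- Any position o of the key r in the block will do; the least one is taken.
      have ho := Ev.look (K := K) (x := x) hb (E.index m) E.pow_lt
        (g := [0, r, D.1 / B ^ (j + 1), 0, j + 1, 4])
        (.cons (Ev.lit_le hb (by omega)) (.cons hr (.cons (.div' hel hp)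
          (.cons (Ev.lit_le hb (by omega)) (.cons (hlit _ hj)
            (.cons (Ev.lit_le hb (by omega)) .nil)))))) (Ev.lit_le (k := 0) hb (by omega)) rfl (by
          intro d hd
          simp only [List.mem_cons, List.not_mem_nil, or_false] at hd
          rcases hd with rfl | rfl | rfl | rfl | rfl | rfl <;> omega) (by omega)
      set o := mn (2 * n + 1) {y | ([0, r, D.1 / B ^ (j + 1), 0, j + 1, 4], y) ∈
        G.entries (2 * n + 1) n A₀ B K ∧ 0 ≤ y} with hodef
      have homem : ∀ y, ([0, r, D.1 / B ^ (j + 1), 0, j + 1, 4], y) ∈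
          G.entries (2 * n + 1) n A₀ B K ↔ y < 2 * n + 1 ∧
            y / B ^ (j + 1) = D.1 / B ^ (j + 1) ∧ G.ty y ≠ .query ∧ G.key y = r := by
        intro y
        rw [Line.mem_entries]
        simp [Line.mem_blockPositions, hj]
      have hoN : o < 2 * n + 1 :=
        lt_of_le_of_lt (mn_le ⟨(homem o₁).2 ⟨ho₁, ho₂, ho₃, ho₄⟩, Nat.zero_le _⟩) ho₁
      have hom := mn_mem_of_lt hoN
      rw [← hodef] at hom
      obtain ⟨-, hob, hot, hok⟩ := (homem o).1 hom.1
      have hq' : (o + B ^ (j + 1)) / B ^ (j + 1) = D.1 / B ^ (j + 1) + 1 := by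
        rw [Nat.add_div_right _ hpos, hob]
      have hDq' : D.1 < o + B ^ (j + 1) := by
        by_contra hge
        have := Nat.div_le_div_right (c := B ^ (j + 1)) (not_lt.1 hge)
        omega
      -- The new query position lies one block to the right of D.1, whereas q is at least two blocks
      -- away. It thus stays in the range of positions with stored values.
      have hq'q : o + B ^ (j + 1) < q := by
        by_contra hge
        have := Nat.div_le_div_right (c := B ^ (j + 1)) (not_lt.1 hge)
        omega
      have hlev' : lev B K (o + B ^ (j + 1)) D.1 ≤ j := by
        by_contra hlt
        push Not at hlt
        have h6 := lev_spec (B := B) (K := K) (q := o + B ^ (j + 1)) (l := D.1) (by omega)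
        obtain ⟨d, hd⟩ := Nat.exists_eq_add_of_le (show j + 1 ≤ _ from hlt)
        -- Adjacent blocks remain equal or adjacent at every coarser level, which contradicts a
        -- distance of two.
        rw [hd, pow_add, ← Nat.div_div_eq_div_mul, ← Nat.div_div_eq_div_mul, hq'] at h6
        have h7 : (D.1 / B ^ (j + 1) + 1) / B ^ d ≤ D.1 / B ^ (j + 1) / B ^ d + 1 := by
          have hpd : 0 < B ^ d := Nat.pow_pos hB
          rw [← Nat.add_div_right _ hpd]
          exact Nat.div_le_div_right (by omega)
        omega
      have i5 := ih (by omega) _ (o + B ^ (j + 1)) (j + 1) (.add ho hp (by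
        have := E.pow_succ_lt; omega)) hDq' (by omega) hj hlev'
      -- The query number j + 1 was introduced for this: stepping back by B^(j+1) reaches o, whose
      -- key is the wanted threshold.
      have hthr : G.thr B (o + B ^ (j + 1)) (j + 1) = r := by
        simp [Line.thr, hok]
      rw [hthr] at i5
      refine (Ev.min_mn i4 i5).of_eq (congrArg _ ?_)
      rw [Set.union_assoc]
      -- Raising the threshold from X to r loses no key of the block, since r is the least key ≥ X
      -- in it, and every key found is still above X.
      refine (hblock _ (fun y hy => ⟨hy.1, hXr.trans hy.2.1, hy.2.2⟩) ?_).symm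
      intro q' k1 k2 k3 k4
      exact ⟨k4.1, mn_le ⟨(hrmem _).2 ⟨q', k1, k2, k3, rfl⟩, k4.2.1⟩, k4.2.2⟩
    · refine .ite_neg hr (Ev.size E hb) hrN ?_
      refine i4.of_eq (congrArg _ ?_)
      have := hblock ∅ (Set.empty_subset _) ?_
      · rw [Set.union_empty] at this
        exact this.symm
      · intro q' k1 k2 k3 k4
        have k5 : r ≤ G.key q' := mn_le ⟨(hrmem _).2 ⟨q', k1, k2, k3, rfl⟩, k4.2.1⟩
        have := E.key_lt q'
        omega

end params
end

/-! ### The program -/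

/-- The arrays `L` and `H` hold the stack, from the bottom. -/
def StackRep (L H : ℕ → ℕ) : List (ℕ × ℕ) → Prop
  | [] => True
  | e :: t => L t.length = e.1 ∧ H t.length = e.2 ∧ StackRep L H t

theorem StackRep.congr {L H L' H' : ℕ → ℕ} {st : List (ℕ × ℕ)} (h : StackRep L H st)
    (h' : ∀ i < st.length, L' i = L i ∧ H' i = H i) : StackRep L' H' st := by
  induction st with
  | nil => trivial
  | cons e t ih =>
    have h1 := h' t.length (by simp)
    refine ⟨h1.1.trans h.1, h1.2.trans h.2.1, ih h.2.2 fun i hi => h' i ?_⟩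
    simp only [List.length_cons]
    omega

/-- The storage represents the state of the walker. -/
structure Rep (m : Store) (s : State) : Prop where
  p : m.vars 0 = s.p
  a : m.vars 1 = s.a
  b : m.vars 2 = s.b
  D : m.vars 3 = s.st.length
  stack : StackRep m.L m.H s.st

namespace Store

def setVar (m : Store) (k v : ℕ) : Store := { m with vars := Function.update m.vars k v }
def setL (m : Store) (k v : ℕ) : Store := { m with L := Function.update m.L k v }
def setH (m : Store) (k v : ℕ) : Store := { m with H := Function.update m.H k v }
def setV (m : Store) (k v : ℕ) : Store := { m with V := Function.update m.V k v }
def setW (m : Store) (k v : ℕ) : Store := { m with W := Function.update m.W k v }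

variable (rest : ℕ → ℕ → ℕ) (m : Store) (k v : ℕ)

theorem update_enc_set {m m' : Store} {i k v : ℕ}
    (hi : i < 16) (h : ∀ o, m'.enc rest (o * 16 + i) = if o = k then v else m.enc rest (o * 16 + i))
    (h1 : i ≠ 1 → m'.vars = m.vars) (h2 : i ≠ 2 → m'.L = m.L) (h3 : i ≠ 3 → m'.H = m.H)
    (h4 : i ≠ 4 → m'.V = m.V) (h5 : i ≠ 5 → m'.W = m.W) :
    Function.update (m.enc rest) (k * 16 + i) v = m'.enc rest := by
  refine update_enc hi h fun j hj hji o => ?_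
  by_cases c : j = 0 ∨ 5 < j
  · rw [enc_rest c hj, enc_rest c hj]
  · have : j = 1 ∨ j = 2 ∨ j = 3 ∨ j = 4 ∨ j = 5 := by omega
    rcases this with rfl | rfl | rfl | rfl | rfl
    · rw [enc_vars, enc_vars, h1 (by omega)]
    · rw [enc_L, enc_L, h2 (by omega)]
    · rw [enc_H, enc_H, h3 (by omega)]
    · rw [enc_V, enc_V, h4 (by omega)]
    · rw [enc_W, enc_W, h5 (by omega)]

theorem update_vars : Function.update (m.enc rest) (k * 16 + 1) v = (m.setVar k v).enc rest :=
  update_enc_set rest (by omega)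
    (fun o => by rw [enc_vars, enc_vars]; simp [setVar, Function.update_apply])
    (by simp) (fun _ => rfl) (fun _ => rfl) (fun _ => rfl) (fun _ => rfl)

theorem update_L : Function.update (m.enc rest) (k * 16 + 2) v = (m.setL k v).enc rest :=
  update_enc_set rest (by omega)
    (fun o => by rw [enc_L, enc_L]; simp [setL, Function.update_apply])
    (fun _ => rfl) (by simp) (fun _ => rfl) (fun _ => rfl) (fun _ => rfl)

theorem update_H : Function.update (m.enc rest) (k * 16 + 3) v = (m.setH k v).enc rest :=
  update_enc_set rest (by omega)
    (fun o => by rw [enc_H, enc_H]; simp [setH, Function.update_apply])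
    (fun _ => rfl) (fun _ => rfl) (by simp) (fun _ => rfl) (fun _ => rfl)

theorem update_V : Function.update (m.enc rest) (k * 16 + 4) v = (m.setV k v).enc rest :=
  update_enc_set rest (by omega)
    (fun o => by rw [enc_V, enc_V]; simp [setV, Function.update_apply])
    (fun _ => rfl) (fun _ => rfl) (fun _ => rfl) (by simp) (fun _ => rfl)

theorem update_W : Function.update (m.enc rest) (k * 16 + 5) v = (m.setW k v).enc rest :=
  update_enc_set rest (by omega)
    (fun o => by rw [enc_W, enc_W]; simp [setW, Function.update_apply])
    (fun _ => rfl) (fun _ => rfl) (fun _ => rfl) (fun _ => rfl) (by simp)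

end Store

namespace Ex

/-- `if a = b then c else e` -/
def iteEq (a b c e : Ex) : Ex := .ite a b e (.ite b a e c)

/-- Position of the walker. -/
def pos : Ex := .cst 1 0
def left : Ex := .cst 1 1
def right : Ex := .cst 1 2
/-- Height of the stack. -/
def depth : Ex := .cst 1 3

def l₁ : Ex := .ite depth (.lit 1) left (.get 2 (.sub depth (.lit 1)))
def h₁ : Ex := .ite depth (.lit 1) right (.get 3 (.sub depth (.lit 1)))
def l₂ : Ex := .ite depth (.lit 2) left (.get 2 (.sub depth (.lit 2)))
def h₂ : Ex := .ite depth (.lit 2) right (.get 3 (.sub depth (.lit 2)))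

/-- The answer beyond the first interval of the stack, for the query `κ` at the current position. -/
def beyond (K κ : ℕ) : Ex :=
  .ite depth (.lit 1) (.initial K left right (.thr pos κ))
    (.min (.last K l₂ l₁ h₁ (.thr pos κ)) (.min (.first K h₁ h₂ l₂ (.thr pos κ))
      (.ite depth (.lit 2) (.initial K left right (.thr pos κ)) (.eval K K pos κ l₂ h₂))))

/-- The answer. -/
def answer (K : ℕ) : Ex :=
  .get 9 (.min (.last K l₁ (.add pos (.lit 1)) pos (.thr pos 0))
    (.min (.first K pos h₁ l₁ (.thr pos 0)) (beyond K 0)))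

end Ex

/-! ### Evaluation of the answer -/

section
variable {w M n B K : ℕ} {G : Line} {A₀ A : Set ℕ} {nodeOf nodeAt : ℕ → ℕ} {rest : ℕ → ℕ → ℕ}
  {m : Store} {x : ℕ} {s : State}

theorem Ev.iteLt {mem : ℕ → ℕ} {a b c e : Ex} {y z v v' : ℕ} (ha : Ev w M mem x a y)
    (hb : Ev w M mem x b z) (hc : y < z → Ev w M mem x c v) (he : ¬ y < z → Ev w M mem x e v') :
    Ev w M mem x (.ite a b c e) (if y < z then v else v') := by
  split_ifs with h
  · exact .ite_pos ha hb h (hc h)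
  · exact .ite_neg ha hb h (he h)

theorem Ev.iteEq {mem : ℕ → ℕ} {a b c e : Ex} {y z v v' : ℕ} (ha : Ev w M mem x a y)
    (hb : Ev w M mem x b z) (hc : y = z → Ev w M mem x c v) (he : y ≠ z → Ev w M mem x e v') :
    Ev w M mem x (.iteEq a b c e) (if y = z then v else v') := by
  split_ifs with h
  · exact .ite_neg ha hb (by omega) (.ite_neg hb ha (by omega) (hc h))
  · rcases Nat.lt_or_gt_of_ne h with h' | h'
    · exact .ite_pos ha hb h' (he h)
    · exact .ite_neg ha hb (by omega) (.ite_pos hb ha h' (he h))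

/-- Left ends increase strictly towards the top, which bounds the depth and thus the cells that the
stack needs. -/
theorem Nest.length_le {a b : ℕ} {st : List (ℕ × ℕ)} (h : Nest a b st) :
    a + st.length ≤ nextL a st := by
  induction st with
  | nil => simp [nextL]
  | cons e t ih =>
    have h1 := ih h.2.2
    have h2 := h.1
    simp only [List.length_cons, nextL] at *
    omega

theorem Inv.length_le (hi : Inv G n A₀ A s) : s.st.length ≤ 2 * n := by
  cases hs : s.st with
  | nil => simp
  | cons e t =>
    have h1 := hi.nest.length_le
    have h2 := (hi.top e t hs).1
    have h3 := hi.le_b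
    have h4 := hi.b_le
    rw [hs] at h1
    simp only [nextL] at h1
    omega

section
variable (hb : Bounded w M (m.enc rest))
include hb

theorem Bounded.setVar {k v : ℕ} (hv : v < 2 ^ w) : Bounded w M ((m.setVar k v).enc rest) := by
  rw [← Store.update_vars]; exact hb.update hv

theorem Bounded.setL {k v : ℕ} (hv : v < 2 ^ w) : Bounded w M ((m.setL k v).enc rest) := by
  rw [← Store.update_L]; exact hb.update hv

theorem Bounded.setH {k v : ℕ} (hv : v < 2 ^ w) : Bounded w M ((m.setH k v).enc rest) := by
  rw [← Store.update_H]; exact hb.update hv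

theorem Bounded.setV {k v : ℕ} (hv : v < 2 ^ w) : Bounded w M ((m.setV k v).enc rest) := by
  rw [← Store.update_V]; exact hb.update hv

theorem Bounded.setW {k v : ℕ} (hv : v < 2 ^ w) : Bounded w M ((m.setW k v).enc rest) := by
  rw [← Store.update_W]; exact hb.update hv

end

variable (E : Static w M n B K G A₀ nodeOf nodeAt rest)
include E

section bounded
variable (hb : Bounded w M (m.enc rest))
include hb

theorem Exec.setVar {k v : ℕ} {e : Ex} {l : Stmts} {mem' : ℕ → ℕ} (hk : k ≤ 16)
    (he : Ev w M (m.enc rest) x e v) (h : Exec w M x ((m.setVar k v).enc rest) l mem') :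
    Exec w M x (m.enc rest) ((.lit (k * 16 + 1), e) :: l) mem' := by
  have h1 := E.M_ge
  have h2 := hb.le
  rw [← Store.update_vars] at h
  exact .cons (.lit (by omega)) (by omega) he h

theorem Ev.var {k : ℕ} (hk : k ≤ 16) : Ev w M (m.enc rest) x (.cst 1 k) (m.vars k) :=
  (Ev.cst hb (by have := E.M_ge; omega)).of_eq enc_vars

variable (hr : Rep m s) (hD : s.st.length ≤ 2 * n)
include hr

theorem Ev.pos : Ev w M (m.enc rest) x .pos s.p := (Ev.var E hb (by omega)).of_eq hr.p
theorem Ev.left : Ev w M (m.enc rest) x .left s.a := (Ev.var E hb (by omega)).of_eq hr.a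
theorem Ev.right : Ev w M (m.enc rest) x .right s.b := (Ev.var E hb (by omega)).of_eq hr.b
theorem Ev.depth : Ev w M (m.enc rest) x .depth s.st.length :=
  (Ev.var E hb (by omega)).of_eq hr.D

include hD

theorem Ev.l₁ : Ev w M (m.enc rest) x .l₁ (nextL s.a s.st) := by
  have hd := Ev.depth (x := x) E hb hr
  have h1 := Ev.lit_le (x := x) (k := 1) hb (by omega)
  have hs := hr.stack
  have ha := Ev.left (x := x) E hb hr
  have hM := E.M_ge
  cases hst : s.st with
  | nil => rw [hst] at hd; exact .ite_pos hd h1 (by simp) ha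
  | cons e t =>
    rw [hst] at hd hs hD
    rw [List.length_cons] at hd hD
    refine .ite_neg hd h1 (by omega) ((Ev.get hb (.sub' hd h1) (by omega)).of_eq ?_)
    rw [enc_L, Nat.add_sub_cancel]
    exact hs.1

theorem Ev.h₁ : Ev w M (m.enc rest) x .h₁ (nextH s.b s.st) := by
  have hd := Ev.depth (x := x) E hb hr
  have h1 := Ev.lit_le (x := x) (k := 1) hb (by omega)
  have hs := hr.stack
  have ha := Ev.right (x := x) E hb hr
  have hM := E.M_ge
  cases hst : s.st with
  | nil => rw [hst] at hd; exact .ite_pos hd h1 (by simp) ha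
  | cons e t =>
    rw [hst] at hd hs hD
    rw [List.length_cons] at hd hD
    refine .ite_neg hd h1 (by omega) ((Ev.get hb (.sub' hd h1) (by omega)).of_eq ?_)
    rw [enc_H, Nat.add_sub_cancel]
    exact hs.2.1

theorem Ev.l₂ : Ev w M (m.enc rest) x .l₂ (nextL s.a s.st.tail) := by
  have hd := Ev.depth (x := x) E hb hr
  have h1 := Ev.lit_le (x := x) (k := 2) hb (by omega)
  have hs := hr.stack
  have ha := Ev.left (x := x) E hb hr
  have hM := E.M_ge
  cases hst : s.st with
  | nil => rw [hst] at hd; exact .ite_pos hd h1 (by simp) ha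
  | cons e t =>
    cases t with
    | nil => rw [hst] at hd; exact .ite_pos hd h1 (by simp) ha
    | cons e' t =>
      rw [hst] at hd hs hD
      rw [List.length_cons, List.length_cons] at hd hD
      refine .ite_neg hd h1 (by omega) ((Ev.get hb (.sub' hd h1) (by omega)).of_eq ?_)
      rw [enc_L, show t.length + 1 + 1 - 2 = t.length by omega]
      exact hs.2.2.1

theorem Ev.h₂ : Ev w M (m.enc rest) x .h₂ (nextH s.b s.st.tail) := by
  have hd := Ev.depth (x := x) E hb hr
  have h1 := Ev.lit_le (x := x) (k := 2) hb (by omega)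
  have hs := hr.stack
  have ha := Ev.right (x := x) E hb hr
  have hM := E.M_ge
  cases hst : s.st with
  | nil => rw [hst] at hd; exact .ite_pos hd h1 (by simp) ha
  | cons e t =>
    cases t with
    | nil => rw [hst] at hd; exact .ite_pos hd h1 (by simp) ha
    | cons e' t =>
      rw [hst] at hd hs hD
      rw [List.length_cons, List.length_cons] at hd hD
      refine .ite_neg hd h1 (by omega) ((Ev.get hb (.sub' hd h1) (by omega)).of_eq ?_)
      rw [enc_H, show t.length + 1 + 1 - 2 = t.length by omega]
      exact hs.2.2.2.1

end bounded

section query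
variable (hb : Bounded w M (m.enc rest)) (hr : Rep m s) (hi : Inv G n A₀ A s) (ha : s.a ≤ s.p)
include hb hr hi ha

/-- One application of `above_eq` passes from the first interval to the second one or to the visited
range. Beyond the second interval stored values can be used, because its slots at the current
position are complete even while those of the first are being written. -/
theorem Ev.beyond {κ₀ κ : ℕ}
    (hs : Slots G (2 * n + 1) B K A s.p κ₀ s.st (slotVal B K m.V) (slotVal B K m.W))
    (hκ : κ ≤ K) : Ev w M (m.enc rest) x (.beyond K κ)
      (mn (2 * n + 1) (G.above A (G.thr B s.p κ) (nextL s.a s.st) (nextH s.b s.st))) := by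
  have hD := hi.length_le
  have hpb := hi.le_b
  have hbn := hi.b_le
  have ep := Ev.pos (x := x) E hb hr
  have ea := Ev.left (x := x) E hb hr
  have eb := Ev.right (x := x) E hb hr
  have ed := Ev.depth (x := x) E hb hr
  have el1 := Ev.l₁ (x := x) E hb hr hD
  have eh1 := Ev.h₁ (x := x) E hb hr hD
  have el2 := Ev.l₂ (x := x) E hb hr hD
  have eh2 := Ev.h₂ (x := x) E hb hr hD
  have eX := Ev.thr (x := x) (κ := κ) E hb ep (by omega) hκ
  have hX := E.thr_lt (B := B) s.p κ
  have hinit : Ev w M (m.enc rest) x (.initial K .left .right (.thr .pos κ))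
      (mn (2 * n + 1) (G.above A (G.thr B s.p κ) s.a s.b)) := by
    -- Keys that do not occur in the visited range still have their initial status.
    have : G.above A (G.thr B s.p κ) s.a s.b = G.above A₀ (G.thr B s.p κ) s.a s.b := by
      ext y
      refine ⟨fun h => ⟨(hi.unvisited y h.2.2).1 h.1, h.2⟩,
        fun h => ⟨(hi.unvisited y h.2.2).2 h.1, h.2⟩⟩
    rw [this]
    exact Ev.initial E hb ea eb eX (by omega) (by omega) hX
  have l1 := Ev.lit_le (x := x) (k := 1) hb (by omega)
  have l2 := Ev.lit_le (x := x) (k := 2) hb (by omega)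
  have hn := hi.nest
  have hg := hi.good
  have hc := hi.contains
  cases hst : s.st with
  | nil =>
    rw [hst] at ed
    exact .ite_pos ed l1 (by simp) hinit
  | cons e t =>
    have hall : ∀ y, y ∈ e :: t → y ∈ s.st := fun y hy => by rw [hst]; exact hy
    rw [hst] at ed el1 eh1 el2 eh2 hn hg
    rw [List.length_cons] at ed
    have hce := hc e (hall e (by simp))
    have h1 := hn.le_next
    have h2 := hn.2.2.nextH_le
    have h3 := hn.1
    have h4 := hn.2.2.le_nextL
    simp only [List.tail_cons] at el2 eh2
    simp only [nextL, nextH] at el1 eh1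
    refine .ite_neg ed l1 (by omega) ?_
    simp only [nextL, nextH]
    rw [Line.above_eq hg.2.claim h3.le h1]
    refine Ev.min_mn (Ev.last E hb el2 el1 eh1 eX (by omega) (by omega) (by omega) hX)
      (Ev.min_mn (Ev.first E hb eh1 eh2 el2 eX (by omega) (by omega) (by omega) hX) ?_)
    cases t with
    | nil => exact .ite_pos ed l2 (by simp) hinit
    | cons e' t =>
      rw [List.length_cons] at ed
      have hlt := hn.lt_of_mem (F := e') (by simp)
      refine .ite_neg ed l2 (by omega) ?_
      exact Ev.eval E hb hi hs (hall e' (by simp)) (hall e (by simp)) hlt.1 el2 eh2 K le_rfl _ _ _ ep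
        (by omega) (by omega) hκ (lev_le _ _ _ _)

/-- The set of all active keys ≥ X is `above` for the empty interval [p + 1, p], so the
decomposition of `above_eq` starts there. -/
theorem Ev.answer {κ₀ : ℕ}
    (hs : Slots G (2 * n + 1) B K A s.p κ₀ s.st (slotVal B K m.V) (slotVal B K m.W)) :
    Ev w M (m.enc rest) x (.answer K)
      (nodeOf (mn (2 * n + 1) {y | y ∈ A ∧ G.key s.p ≤ y})) := by
  have hD := hi.length_le
  have hpb := hi.le_b
  have hbn := hi.b_le
  have ep := Ev.pos (x := x) E hb hr
  have el1 := Ev.l₁ (x := x) E hb hr hD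
  have eh1 := Ev.h₁ (x := x) E hb hr hD
  have eX := Ev.thr (x := x) (κ := 0) E hb ep (by omega) (Nat.zero_le K)
  have hX := E.thr_lt (B := B) s.p 0
  have hk : G.thr B s.p 0 = G.key s.p := by simp [Line.thr]
  have h1 : nextL s.a s.st ≤ s.p := by
    cases hst : s.st with
    | nil => exact ha
    | cons e t => exact (hi.top e t hst).1
  have h2 : s.p ≤ nextH s.b s.st := by
    cases hst : s.st with
    | nil => exact hpb
    | cons e t => exact (hi.top e t hst).2.le
  have h3 := hi.nest.nextH_le
  have e1 := Ev.beyond (x := x) E hb hr hi ha hs (Nat.zero_le K)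
  have e2 := Ev.min_mn (Ev.last E hb el1 (Ev.add_one E hb ep (by omega)) ep eX (by omega) (by omega)
    (by omega) hX) (Ev.min_mn (Ev.first E hb ep eh1 el1 eX (by omega) (by omega) (by omega) hX) e1)
  rw [← Line.above_eq hi.good.claim (by omega) h2] at e2
  have h4 : G.above A (G.thr B s.p 0) (s.p + 1) s.p = {y | y ∈ A ∧ G.key s.p ≤ y} := by
    ext y
    simp only [Line.above, hk, Set.mem_ofPred_eq]
    refine ⟨fun h => ⟨h.1, h.2.1⟩, fun h => ⟨h.1, h.2, ?_⟩⟩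
    rintro ⟨q, i1, i2, -⟩
    omega
  rw [h4] at e2
  have h5 := mn_le_top (2 * n + 1) {y | y ∈ A ∧ G.key s.p ≤ y}
  refine (Ev.get hb e2 (by have := E.M_ge; omega)).of_eq ?_
  rw [enc_rest (by omega) (by omega), E.nodeOf_eq _ h5]

end query
end

namespace Ex

/-- `2 n - 1` -/
def lastPos : Ex := .sub (.cst 0 2) (.lit 2)

def normP : Ex := .ite lastPos pos (.cst 0 3) (.ite pos (.lit 1) (.cst 0 3) pos)
def normA : Ex := .ite lastPos pos (.lit 1) (.ite pos (.lit 1) (.cst 0 3) left)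
def normB : Ex := .ite lastPos pos (.cst 0 3) (.ite pos (.lit 1) lastPos right)

/-- `if` the next position on the right is requested `then r else l` -/
def iteDir (r l : Ex) : Ex := iteEq (.get 10 (.add pos (.lit 1))) .inp r l

def moveP : Ex := iteDir (.add pos (.lit 1)) (.sub pos (.lit 1))
def moveA : Ex :=
  iteDir left (.ite l₁ pos left (.ite depth (.lit 1) (.sub pos (.lit 1)) left))
def moveB : Ex :=
  iteDir (.ite depth (.lit 1) (iteEq right pos (.add pos (.lit 1)) right) right)
    (.ite l₁ pos right
      (.ite depth (.lit 1) (.ite pos left (.sub pos (.lit 1)) right) right))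
def moveD : Ex :=
  iteDir (.ite depth (.lit 1) depth
      (iteEq h₁ (.add pos (.lit 1)) (.sub depth (.lit 1)) depth))
    (.ite l₁ pos (iteEq (.add l₁ (.lit 1)) pos depth (.add depth (.lit 1)))
      (.ite depth (.lit 1) depth
        (iteEq (.add l₂ (.lit 1)) pos (.sub depth (.lit 1)) depth)))
/-- The place where the stack is changed. -/
def moveI : Ex :=
  iteDir depth (.ite l₁ pos depth
    (.ite depth (.lit 1) depth (iteEq (.add l₂ (.lit 1)) pos depth (.sub depth (.lit 1)))))
/-- The new right end at this place. -/
def moveH : Ex :=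
  iteDir pos (.ite l₁ pos pos (.ite depth (.lit 1) pos h₁))

/-- The offset of the value to be stored for the query `κ`. -/
def writeOff (K κ : ℕ) : Ex := byLev pos l₁ (slot K pos κ l₁) K

/-- The value to be stored. -/
def writeVal (K κ : ℕ) : Ex :=
  .ite depth (.lit 2) (beyond K κ) (byLev pos l₁ (fun k =>
    iteEq (.div l₂ (base.pow k)) (.div l₁ (base.pow k)) (.get 4 (slot K pos κ l₁ k))
      (beyond K κ)) K)

/-- The right end to be stored. -/
def writeEnd (K κ : ℕ) : Ex :=
  .ite depth (.lit 2) h₁ (byLev pos l₁ (fun k =>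
    iteEq (.div l₂ (base.pow k)) (.div l₁ (base.pow k)) (.get 5 (slot K pos κ l₁ k)) h₁) K)

end Ex

namespace Stmts

/-- The assignment of a state variable. -/
def setVar (k : ℕ) (e : Ex) : Ex × Ex := (.lit (k * 16 + 1), e)

def norm : Stmts :=
  -- All new values are computed from the old state before any of it is overwritten. The depth needs
  -- no assignment, as the stack is empty at both ends of the line.
  [setVar 4 .normP, setVar 5 .normA, setVar 6 .normB, setVar 0 (.cst 1 4), setVar 1 (.cst 1 5),
    setVar 2 (.cst 1 6)]

def move : Stmts :=
  -- Variables 4 to 9 hold the new values until all expressions in the old state have been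
  -- evaluated.
  [setVar 4 .moveP, setVar 5 .moveA, setVar 6 .moveB, setVar 7 .moveD, setVar 8 .moveI,
    setVar 9 .moveH, (.addr 2 (.cst 1 8), .sub .pos (.lit 1)), (.addr 3 (.cst 1 8), .cst 1 9),
    setVar 0 (.cst 1 4), setVar 1 (.cst 1 5), setVar 2 (.cst 1 6), setVar 3 (.cst 1 7)]

def write (K : ℕ) : ℕ → Stmts
  | 0 => []
  | κ + 1 => write K κ ++ [(.addr 4 (.writeOff K κ), .writeVal K κ),
      (.addr 5 (.writeOff K κ), .writeEnd K κ)]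

/-- All assignments for one request. -/
def all (K : ℕ) : Stmts := norm ++ (move ++ write K (K + 1))

end Stmts

/-- The move of the walker to the right or to the left. -/
def State.move (s : State) (r : Prop) [Decidable r] : State := if r then s.right else s.left

theorem StackRep.update {L H : ℕ → ℕ} {st : List (ℕ × ℕ)} (h : StackRep L H st) {i v v' : ℕ}
    (hi : st.length ≤ i) : StackRep (Function.update L i v) (Function.update H i v') st :=
  h.congr fun j hj => by
    rw [Function.update_of_ne (by omega), Function.update_of_ne (by omega)]
    exact ⟨rfl, rfl⟩

/-- The place where a move changes the stack. -/
def State.moveI (s : State) (r : Prop) [Decidable r] : ℕ :=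
  if r then s.st.length else if nextL s.a s.st < s.p then s.st.length
  else if s.st.length < 1 then s.st.length
  else if nextL s.a s.st.tail + 1 = s.p then s.st.length else s.st.length - 1

/-- The right end that a move stores at this place. -/
def State.moveH (s : State) (r : Prop) [Decidable r] : ℕ :=
  if r then s.p else if nextL s.a s.st < s.p then s.p
  else if s.st.length < 1 then s.p else nextH s.b s.st

/-! ### Effect of a move on the state variables and the stack -/

section spec
variable (s : State) (r : Prop) [Decidable r]

theorem State.moveI_le : s.moveI r ≤ s.st.length := by
  unfold State.moveI
  split_ifs <;> omega

theorem State.move_p : (s.move r).p = if r then s.p + 1 else s.p - 1 := by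
  unfold State.move State.right State.left
  split_ifs <;> (try split) <;> (try split_ifs) <;> rfl

theorem State.move_a : (s.move r).a = if r then s.a else if nextL s.a s.st < s.p then s.a
    else if s.st.length < 1 then s.p - 1 else s.a := by
  obtain ⟨p, a, b, st⟩ := s
  unfold State.move State.right State.left
  cases st <;> simp only [List.length_nil, List.length_cons] <;> split_ifs <;> first | rfl | omega

theorem State.move_b : (s.move r).b = if r then
      (if s.st.length < 1 then (if s.b = s.p then s.p + 1 else s.b) else s.b)
    else if nextL s.a s.st < s.p then s.b
    else if s.st.length < 1 then (if s.p < s.a then s.p - 1 else s.b) else s.b := by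
  obtain ⟨p, a, b, st⟩ := s
  unfold State.move State.right State.left
  cases st <;> simp only [List.length_nil, List.length_cons] <;> split_ifs <;> first | rfl | omega

theorem State.move_length : (s.move r).st.length = if r then
      (if s.st.length < 1 then s.st.length
        else if nextH s.b s.st = s.p + 1 then s.st.length - 1 else s.st.length)
    else if nextL s.a s.st < s.p then
      (if nextL s.a s.st + 1 = s.p then s.st.length else s.st.length + 1)
    else if s.st.length < 1 then s.st.length
    else if nextL s.a s.st.tail + 1 = s.p then s.st.length - 1 else s.st.length := by
  obtain ⟨p, a, b, st⟩ := s
  unfold State.move State.right State.left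
  by_cases hr : r
  · simp only [if_pos hr]
    cases st with
    | nil => simp only; split_ifs <;> simp_all
    | cons e t => simp only [nextH]; split_ifs <;> simp_all
  · simp only [if_neg hr]
    by_cases c : nextL a st < p
    · simp only [if_pos c]; split_ifs <;> simp
    · simp only [if_neg c]
      cases st with
      | nil => simp only; split_ifs <;> simp_all
      | cons e t => simp only [List.tail_cons]; split_ifs <;> simp_all

/-- The arrays are written at every move, without case distinction. If no interval is created or
extended, the write goes above the stack and is harmless. -/
theorem State.move_stack {L H : ℕ → ℕ} (h : StackRep L H s.st) :
    StackRep (Function.update L (s.moveI r) (s.p - 1)) (Function.update H (s.moveI r) (s.moveH r))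
      (s.move r).st := by
  obtain ⟨p, a, b, st⟩ := s
  unfold State.move State.right State.left State.moveI State.moveH
  simp only at h ⊢
  by_cases hr : r
  · simp only [if_pos hr]
    cases st with
    | nil => simp only; split_ifs <;> trivial
    | cons e t =>
      simp only
      split_ifs
      · exact h.2.2.update (by simp)
      · exact h.update le_rfl
  · simp only [if_neg hr]
    by_cases c : nextL a st < p
    · simp only [if_pos c]
      split_ifs
      · exact h.update le_rfl
      · exact ⟨by simp, by simp, h.update le_rfl⟩
    · simp only [if_neg c]
      cases st with
      | nil => simp only; split_ifs <;> trivial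
      | cons e t =>
        simp only [List.tail_cons, List.length_cons, Nat.add_sub_cancel, nextH]
        have h0 : ¬ t.length + 1 < 1 := by omega
        simp only [if_neg h0]
        split_ifs
        · exact h.2.2.update (by omega)
        · exact ⟨by simp, by simp, h.2.2.update le_rfl⟩

end spec

/-! ### Execution of the assignments for a move -/

section
variable {w M n B K : ℕ} {G : Line} {A₀ A : Set ℕ} {nodeOf nodeAt : ℕ → ℕ} {rest : ℕ → ℕ → ℕ}
  {m : Store} {x : ℕ} {s : State}

theorem Rep.setVar (h : Rep m s) {k v : ℕ} (hk : 4 ≤ k) : Rep (m.setVar k v) s := by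
  obtain ⟨h1, h2, h3, h4, h5⟩ := h
  refine ⟨?_, ?_, ?_, ?_, h5⟩ <;> simp only [Store.setVar] <;>
    rw [Function.update_of_ne (by omega)] <;> assumption

variable (E : Static w M n B K G A₀ nodeOf nodeAt rest)
include E

theorem exec_norm (hb : Bounded w M (m.enc rest)) (hr : Rep m s) (hi : Inv G n A₀ A s) :
    ∃ m' : Store, Exec w M x (m.enc rest) Stmts.norm (m'.enc rest) ∧
      Bounded w M (m'.enc rest) ∧ Rep m' (s.norm n) ∧ m'.V = m.V ∧ m'.W = m.W := by
  have hpb := hi.le_b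
  have hbn := hi.b_le
  have h3 := E.three_le
  have hst : s.p = 2 * n ∨ s.p = 0 → s.st = [] := by
    intro h
    cases hs : s.st with
    | nil => rfl
    | cons e t =>
      have h1 := (hi.top e t hs)
      have h2 := hi.a_lt hs
      have h3 := hi.nest.nextH_le
      rw [hs] at h3
      simp only [nextH] at h3
      omega
  have eLast : ∀ m : Store, Bounded w M (m.enc rest) →
      Ev w M (m.enc rest) x .lastPos (2 * n - 1) := fun m hb =>
    (Ev.sub' (Ev.size E hb) (Ev.lit_le hb (by omega))).of_eq (by omega)
  have eP : ∀ m : Store, Bounded w M (m.enc rest) → Rep m s →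
      Ev w M (m.enc rest) x .normP (s.norm n).p := by
    intro m hb hr
    refine (Ev.iteLt (eLast m hb) (Ev.pos E hb hr) (fun _ => Ev.nodes E hb) fun _ =>
      Ev.iteLt (Ev.pos E hb hr) (Ev.lit_le hb (by omega)) (fun _ => Ev.nodes E hb) fun _ =>
        Ev.pos E hb hr).of_eq ?_
    unfold State.norm
    split_ifs <;> first | rfl | omega
  have eA : ∀ m : Store, Bounded w M (m.enc rest) → Rep m s →
      Ev w M (m.enc rest) x .normA (s.norm n).a := by
    intro m hb hr
    refine (Ev.iteLt (eLast m hb) (Ev.pos E hb hr) (fun _ => Ev.lit_le (k := 1) hb (by omega)) fun _ =>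
      Ev.iteLt (Ev.pos E hb hr) (Ev.lit_le hb (by omega)) (fun _ => Ev.nodes E hb) fun _ =>
        Ev.left E hb hr).of_eq ?_
    unfold State.norm
    split_ifs <;> first | rfl | omega
  have eB : ∀ m : Store, Bounded w M (m.enc rest) → Rep m s →
      Ev w M (m.enc rest) x .normB (s.norm n).b := by
    intro m hb hr
    refine (Ev.iteLt (eLast m hb) (Ev.pos E hb hr) (fun _ => Ev.nodes E hb) fun _ =>
      Ev.iteLt (Ev.pos E hb hr) (Ev.lit_le hb (by omega)) (fun _ => eLast m hb) fun _ =>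
        Ev.right E hb hr).of_eq ?_
    unfold State.norm
    split_ifs <;> first | rfl | omega
  have hstn : (s.norm n).st = s.st := by
    unfold State.norm
    split_ifs with c1 c2
    · exact (hst (Or.inl c1)).symm
    · exact (hst (Or.inr c2)).symm
    · rfl
  generalize hs' : s.norm n = s' at *
  have e1 := eP m hb hr
  have b1 := hb.setVar (k := 4) e1.lt
  have r1 := hr.setVar (k := 4) (v := s'.p) (by omega)
  have e2 := eA _ b1 r1
  have b2 := b1.setVar (k := 5) e2.lt
  have r2 := r1.setVar (k := 5) (v := s'.a) (by omega)
  have e3 := eB _ b2 r2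
  have b3 := b2.setVar (k := 6) e3.lt
  have e4 := (Ev.var (x := x) (k := 4) E b3 (by omega)).of_eq (v' := s'.p)
    (by simp [Store.setVar])
  have b4 := b3.setVar (k := 0) e4.lt
  have e5 := (Ev.var (x := x) (k := 5) E b4 (by omega)).of_eq (v' := s'.a)
    (by simp [Store.setVar])
  have b5 := b4.setVar (k := 1) e5.lt
  have e6 := (Ev.var (x := x) (k := 6) E b5 (by omega)).of_eq (v' := s'.b)
    (by simp [Store.setVar])
  have b6 := b5.setVar (k := 2) e6.lt
  refine ⟨_, Exec.setVar E hb (by omega) e1 (Exec.setVar E b1 (by omega) e2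
    (Exec.setVar E b2 (by omega) e3 (Exec.setVar E b3 (by omega) e4 (Exec.setVar E b4 (by omega) e5
      (Exec.setVar E b5 (by omega) e6 (.nil _)))))), b6, ⟨?_, ?_, ?_, ?_, ?_⟩, rfl, rfl⟩
  · simp [Store.setVar]
  · simp [Store.setVar]
  · simp [Store.setVar]
  · simp [Store.setVar, hstn, hr.D]
  · rw [hstn]; exact hr.stack

theorem exec_move (hb : Bounded w M (m.enc rest)) (hr : Rep m s) (hi : Inv G n A₀ A s)
    (hpn : s.p < 2 * n) (hx : x < 2 ^ w) :
    ∃ m' : Store, Exec w M x (m.enc rest) Stmts.move (m'.enc rest) ∧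
      Bounded w M (m'.enc rest) ∧ Rep m' (s.move (nodeAt (s.p + 1) = x)) ∧ m'.V = m.V ∧
      m'.W = m.W := by
  have hD := hi.length_le
  have hpb := hi.le_b
  have hbn := hi.b_le
  have hM := E.M_ge
  have hl1 : nextL s.a s.st < 2 * n + 2 := by
    have h1 := hi.a_le
    cases hst : s.st with
    | nil => simp only [nextL]; omega
    | cons e t => have := hi.top e t hst; simp only [nextL]; omega
  have hl2 : nextL s.a s.st.tail < 2 * n + 2 := by
    cases hst : s.st with
    | nil => rw [hst] at hl1; exact hl1
    | cons e t =>
      have h1 := hi.nest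
      rw [hst] at h1 hl1
      exact h1.1.trans hl1
  have one : ∀ m : Store, Bounded w M (m.enc rest) → Ev w M (m.enc rest) x (.lit 1) 1 :=
    fun m hb => Ev.lit_le hb (by omega)
  have p1 : ∀ m : Store, Bounded w M (m.enc rest) → Rep m s →
      Ev w M (m.enc rest) x (.add .pos (.lit 1)) (s.p + 1) := fun m hb hr =>
    Ev.add_one E hb (Ev.pos E hb hr) (by omega)
  have pm : ∀ m : Store, Bounded w M (m.enc rest) → Rep m s →
      Ev w M (m.enc rest) x (.sub .pos (.lit 1)) (s.p - 1) := fun m hb hr =>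
    .sub' (Ev.pos E hb hr) (one m hb)
  have d1 : ∀ m : Store, Bounded w M (m.enc rest) → Rep m s →
      Ev w M (m.enc rest) x (.add .depth (.lit 1)) (s.st.length + 1) := fun m hb hr =>
    Ev.add_one E hb (Ev.depth E hb hr) (by omega)
  have dm : ∀ m : Store, Bounded w M (m.enc rest) → Rep m s →
      Ev w M (m.enc rest) x (.sub .depth (.lit 1)) (s.st.length - 1) := fun m hb hr =>
    .sub' (Ev.depth E hb hr) (one m hb)
  have dir : ∀ m : Store, Bounded w M (m.enc rest) → Rep m s → ∀ (er el : Ex) (v v' : ℕ),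
      Ev w M (m.enc rest) x er v → Ev w M (m.enc rest) x el v' →
      Ev w M (m.enc rest) x (.iteDir er el) (if nodeAt (s.p + 1) = x then v else v') := by
    intro m hb hr er el v v' h1 h2
    refine Ev.iteEq ((Ev.get hb (p1 m hb hr) (by omega)).of_eq ?_) (.inp hx) (fun _ => h1)
      fun _ => h2
    rw [enc_rest (by omega) (by omega), E.nodeAt_eq _ (by omega)]
  have eP : ∀ m : Store, Bounded w M (m.enc rest) → Rep m s → Ev w M (m.enc rest) x .moveP (s.move (nodeAt (s.p + 1) = x)).p := by
    intro m hb hr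
    rw [State.move_p]
    exact dir m hb hr _ _ _ _ (p1 m hb hr) (pm m hb hr)
  have eA : ∀ m : Store, Bounded w M (m.enc rest) → Rep m s → Ev w M (m.enc rest) x .moveA (s.move (nodeAt (s.p + 1) = x)).a := by
    intro m hb hr
    rw [State.move_a]
    exact dir m hb hr _ _ _ _ (Ev.left E hb hr)
      (Ev.iteLt (Ev.l₁ E hb hr hD) (Ev.pos E hb hr) (fun _ => Ev.left E hb hr) fun _ =>
        Ev.iteLt (Ev.depth E hb hr) (one m hb) (fun _ => pm m hb hr) fun _ => Ev.left E hb hr)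
  have eB : ∀ m : Store, Bounded w M (m.enc rest) → Rep m s → Ev w M (m.enc rest) x .moveB (s.move (nodeAt (s.p + 1) = x)).b := by
    intro m hb hr
    rw [State.move_b]
    exact dir m hb hr _ _ _ _
      (Ev.iteLt (Ev.depth E hb hr) (one m hb) (fun _ => Ev.iteEq (Ev.right E hb hr)
        (Ev.pos E hb hr) (fun _ => p1 m hb hr) fun _ => Ev.right E hb hr)
        fun _ => Ev.right E hb hr)
      (Ev.iteLt (Ev.l₁ E hb hr hD) (Ev.pos E hb hr) (fun _ => Ev.right E hb hr) fun _ =>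
        Ev.iteLt (Ev.depth E hb hr) (one m hb) (fun _ => Ev.iteLt (Ev.pos E hb hr)
          (Ev.left E hb hr) (fun _ => pm m hb hr) fun _ => Ev.right E hb hr)
          fun _ => Ev.right E hb hr)
  have l1p : ∀ m : Store, Bounded w M (m.enc rest) → Rep m s →
      Ev w M (m.enc rest) x (.add .l₁ (.lit 1)) (nextL s.a s.st + 1) := fun m hb hr =>
    Ev.add_one E hb (Ev.l₁ E hb hr hD) hl1
  have l2p : ∀ m : Store, Bounded w M (m.enc rest) → Rep m s →
      Ev w M (m.enc rest) x (.add .l₂ (.lit 1)) (nextL s.a s.st.tail + 1) := fun m hb hr =>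
    Ev.add_one E hb (Ev.l₂ E hb hr hD) hl2
  have eD : ∀ m : Store, Bounded w M (m.enc rest) → Rep m s → Ev w M (m.enc rest) x .moveD (s.move (nodeAt (s.p + 1) = x)).st.length := by
    intro m hb hr
    rw [State.move_length]
    exact dir m hb hr _ _ _ _
      (Ev.iteLt (Ev.depth E hb hr) (one m hb) (fun _ => Ev.depth E hb hr) fun _ =>
        Ev.iteEq (Ev.h₁ E hb hr hD) (p1 m hb hr) (fun _ => dm m hb hr) fun _ => Ev.depth E hb hr)
      (Ev.iteLt (Ev.l₁ E hb hr hD) (Ev.pos E hb hr) (fun _ => Ev.iteEq (l1p m hb hr)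
          (Ev.pos E hb hr) (fun _ => Ev.depth E hb hr) fun _ => d1 m hb hr) fun _ =>
        Ev.iteLt (Ev.depth E hb hr) (one m hb) (fun _ => Ev.depth E hb hr) fun _ =>
          Ev.iteEq (l2p m hb hr) (Ev.pos E hb hr) (fun _ => dm m hb hr) fun _ =>
            Ev.depth E hb hr)
  have eI : ∀ m : Store, Bounded w M (m.enc rest) → Rep m s → Ev w M (m.enc rest) x .moveI
      (s.moveI (nodeAt (s.p + 1) = x)) :=
    fun m hb hr => dir m hb hr _ _ _ _ (Ev.depth E hb hr)
      (Ev.iteLt (Ev.l₁ E hb hr hD) (Ev.pos E hb hr) (fun _ => Ev.depth E hb hr) fun _ =>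
        Ev.iteLt (Ev.depth E hb hr) (one m hb) (fun _ => Ev.depth E hb hr) fun _ =>
          Ev.iteEq (l2p m hb hr) (Ev.pos E hb hr) (fun _ => Ev.depth E hb hr) fun _ =>
            dm m hb hr)
  have eH : ∀ m : Store, Bounded w M (m.enc rest) → Rep m s → Ev w M (m.enc rest) x .moveH
      (s.moveH (nodeAt (s.p + 1) = x)) :=
    fun m hb hr => dir m hb hr _ _ _ _ (Ev.pos E hb hr)
      (Ev.iteLt (Ev.l₁ E hb hr hD) (Ev.pos E hb hr) (fun _ => Ev.pos E hb hr) fun _ =>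
        Ev.iteLt (Ev.depth E hb hr) (one m hb) (fun _ => Ev.pos E hb hr) fun _ =>
          Ev.h₁ E hb hr hD)
  have hstack := fun L H => State.move_stack (L := L) (H := H) s (nodeAt (s.p + 1) = x)
  have hI := State.moveI_le s (nodeAt (s.p + 1) = x)
  generalize s.move (nodeAt (s.p + 1) = x) = s' at *
  generalize s.moveI (nodeAt (s.p + 1) = x) = i at *
  generalize s.moveH (nodeAt (s.p + 1) = x) = h at *
  have e1 := eP m hb hr
  have b1 := hb.setVar (k := 4) e1.lt
  have r1 := hr.setVar (k := 4) (v := s'.p) (by omega)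
  have e2 := eA _ b1 r1
  have b2 := b1.setVar (k := 5) e2.lt
  have r2 := r1.setVar (k := 5) (v := s'.a) (by omega)
  have e3 := eB _ b2 r2
  have b3 := b2.setVar (k := 6) e3.lt
  have r3 := r2.setVar (k := 6) (v := s'.b) (by omega)
  have e4 := eD _ b3 r3
  have b4 := b3.setVar (k := 7) e4.lt
  have r4 := r3.setVar (k := 7) (v := s'.st.length) (by omega)
  have e5 := eI _ b4 r4
  have b5 := b4.setVar (k := 8) e5.lt
  have r5 := r4.setVar (k := 8) (v := i) (by omega)
  have e6 := eH _ b5 r5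
  have b6 := b5.setVar (k := 9) e6.lt
  have r6 := r5.setVar (k := 9) (v := h) (by omega)
  have e7 := pm _ b6 r6
  have a7 := Ev.addr (i := 2) b6 ((Ev.var (x := x) (k := 8) E b6 (by omega)).of_eq (v' := i)
    (by simp [Store.setVar])) (by omega)
  have b7 := b6.setL (k := i) e7.lt
  have e8 := (Ev.var (x := x) (k := 9) E b7 (by omega)).of_eq (v' := h)
    (by simp [Store.setVar, Store.setL])
  have a8 := Ev.addr (i := 3) b7 ((Ev.var (x := x) (k := 8) E b7 (by omega)).of_eq (v' := i)
    (by simp [Store.setVar, Store.setL])) (by omega)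
  have b8 := b7.setH (k := i) e8.lt
  have e9 := (Ev.var (x := x) (k := 4) E b8 (by omega)).of_eq (v' := s'.p)
    (by simp [Store.setVar, Store.setL, Store.setH])
  have b9 := b8.setVar (k := 0) e9.lt
  have e10 := (Ev.var (x := x) (k := 5) E b9 (by omega)).of_eq (v' := s'.a)
    (by simp [Store.setVar, Store.setL, Store.setH])
  have b10 := b9.setVar (k := 1) e10.lt
  have e11 := (Ev.var (x := x) (k := 6) E b10 (by omega)).of_eq (v' := s'.b)
    (by simp [Store.setVar, Store.setL, Store.setH])
  have b11 := b10.setVar (k := 2) e11.lt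
  have e12 := (Ev.var (x := x) (k := 7) E b11 (by omega)).of_eq (v' := s'.st.length)
    (by simp [Store.setVar, Store.setL, Store.setH])
  have b12 := b11.setVar (k := 3) e12.lt
  refine ⟨_, Exec.setVar E hb (by omega) e1 (Exec.setVar E b1 (by omega) e2
    (Exec.setVar E b2 (by omega) e3 (Exec.setVar E b3 (by omega) e4 (Exec.setVar E b4 (by omega) e5
      (Exec.setVar E b5 (by omega) e6 (.cons a7 (by omega) e7 (Store.update_L _ _ _ _ ▸
        .cons a8 (by omega) e8 (Store.update_H _ _ _ _ ▸ Exec.setVar E b8 (by omega) e9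
          (Exec.setVar E b9 (by omega) e10 (Exec.setVar E b10 (by omega) e11
            (Exec.setVar E b11 (by omega) e12 (.nil _)))))))))))), b12,
    ⟨?_, ?_, ?_, ?_, ?_⟩, rfl, rfl⟩
  · simp [Store.setVar]
  · simp [Store.setVar]
  · simp [Store.setVar]
  · simp [Store.setVar]
  · exact hstack _ _ hr.stack


end

/-! ### Execution of the writes and of a whole request -/

section
variable {w M n B K : ℕ} {G : Line} {A₀ A : Set ℕ} {nodeOf nodeAt : ℕ → ℕ} {rest : ℕ → ℕ → ℕ}
  {m : Store} {x : ℕ} {s : State}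

theorem slotVal_update {f : ℕ → ℕ} {q κ k j v : ℕ} (hκ : κ ≤ K) (hk : k ≤ K) (hj : j < 2 * B) :
    slotVal B K (Function.update f (slotOff B K q κ k j) v) q κ k j = v := by
  simp [slotVal, hκ, hk, hj]

theorem slotVal_update_of_ne {f : ℕ → ℕ} {q κ k j q' κ' k' j' v : ℕ} (hκ : κ ≤ K) (hk : k ≤ K)
    (hj : j < 2 * B) (h : (q', κ', k', j') ≠ (q, κ, k, j)) :
    slotVal B K (Function.update f (slotOff B K q κ k j) v) q' κ' k' j' =
      slotVal B K f q' κ' k' j' := by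
  unfold slotVal
  split_ifs with c
  · rw [Function.update_of_ne]
    exact fun e => h (slotOff_inj c.1 c.2.1 c.2.2 hκ hk hj e)
  · rfl

theorem Rep.setV (h : Rep m s) {k v : ℕ} : Rep (m.setV k v) s := ⟨h.p, h.a, h.b, h.D, h.stack⟩
theorem Rep.setW (h : Rep m s) {k v : ℕ} : Rep (m.setW k v) s := ⟨h.p, h.a, h.b, h.D, h.stack⟩

variable (E : Static w M n B K G A₀ nodeOf nodeAt rest)
include E

/-- If the second interval has its left end in the same block as the first, its slot is the very one
to be written and already holds the right value. Otherwise the first interval is outermost in its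
block, and the value is computed by `Ev.beyond`. -/
theorem exec_write (hi : Inv G n A₀ A s) (ha : s.a ≤ s.p) (hb : Bounded w M (m.enc rest))
    (hr : Rep m s)
    (hs : Slots G (2 * n + 1) B K A s.p 0 s.st (slotVal B K m.V) (slotVal B K m.W)) :
    ∀ κ ≤ K + 1, ∃ m' : Store, Exec w M x (m.enc rest) (Stmts.write K κ) (m'.enc rest) ∧
      Bounded w M (m'.enc rest) ∧ Rep m' s ∧
      Slots G (2 * n + 1) B K A s.p κ s.st (slotVal B K m'.V) (slotVal B K m'.W) := by
  intro κ
  induction κ with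
  | zero => exact fun _ => ⟨m, .nil _, hb, hr, hs⟩
  | succ κ ih =>
    intro hκ
    obtain ⟨m₁, hex, hb₁, hr₁, hs₁⟩ := ih (by omega)
    clear ih hs hr hb
    have hκ : κ ≤ K := by omega
    have hD := hi.length_le
    have hpb := hi.le_b
    have hbn := hi.b_le
    have h5 := E.five_le
    have hlp := E.lt_pow
    have hl1 : nextL s.a s.st ≤ s.p := by
      cases hst : s.st with
      | nil => exact ha
      | cons e t => exact (hi.top e t hst).1
    have hk := lev_le B K s.p (nextL s.a s.st)
    have hj := lev_diff_lt (B := B) (K := K) (q := s.p) (l := nextL s.a s.st) (by omega) E.K_pos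
      (by omega)
    set k := lev B K s.p (nextL s.a s.st) with hkdef
    set j := s.p / B ^ k - nextL s.a s.st / B ^ k with hjdef
    have hoff := slotOff_lt (K := K) (show s.p < 2 * n + 1 by omega) hκ hk hj
    have hM := E.le_M
    have lev_intro : ∀ (m : Store), Bounded w M (m.enc rest) → Rep m s → ∀ (body : ℕ → Ex) (v : ℕ),
        Ev w M (m.enc rest) x (body k) v →
        Ev w M (m.enc rest) x (.byLev .pos .l₁ body K) v := fun m hb hr body v hv =>
      Ev.byLev E hb (Ev.pos E hb hr) (Ev.l₁ E hb hr hD) (by omega) hv K le_rfl hk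
    have eslot : ∀ (m : Store), Bounded w M (m.enc rest) → Rep m s →
        Ev w M (m.enc rest) x (.slot K .pos κ .l₁ k) (slotOff B K s.p κ k j) := fun m hb hr =>
      Ev.slot E hb (Ev.pos E hb hr) (Ev.l₁ E hb hr hD) (by omega) hκ hk hj
    have eoff : ∀ (m : Store), Bounded w M (m.enc rest) → Rep m s →
        Ev w M (m.enc rest) x (.writeOff K κ) (slotOff B K s.p κ k j) := fun m hb hr =>
      lev_intro m hb hr _ _ (eslot m hb hr)
    have eite : ∀ (m : Store), Bounded w M (m.enc rest) → Rep m s → ∀ (f g : Ex) (u v : ℕ),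
        Ev w M (m.enc rest) x f u → Ev w M (m.enc rest) x g v →
        Ev w M (m.enc rest) x (.iteEq (.div .l₂ (Ex.base.pow k)) (.div .l₁ (Ex.base.pow k)) f g)
          (if nextL s.a s.st.tail / B ^ k = nextL s.a s.st / B ^ k then u else v) :=
      fun m hb hr f g u v hu hv =>
        Ev.iteEq (.div' (Ev.l₂ E hb hr hD) (Ev.basePow E hb hk))
          (.div' (Ev.l₁ E hb hr hD) (Ev.basePow E hb hk)) (fun _ => hu) fun _ => hv
    have ebey := Ev.beyond (x := x) E hb₁ hr₁ hi ha hs₁ hκ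
    have two : ∀ (m : Store), Bounded w M (m.enc rest) → Ev w M (m.enc rest) x (.lit 2) 2 :=
      fun m hb => Ev.lit_le hb (by omega)
    have eval : Ev w M (m₁.enc rest) x (.writeVal K κ) _ :=
      Ev.iteLt (Ev.depth E hb₁ hr₁) (two m₁ hb₁) (fun _ => ebey) fun _ =>
        lev_intro m₁ hb₁ hr₁ _ _ (eite m₁ hb₁ hr₁ _ _ _ _
          (Ev.slotV E hb₁ (eslot m₁ hb₁ hr₁) (by omega) hκ hk hj) ebey)
    set v := if s.st.length < 2 then
        mn (2 * n + 1) (G.above A (G.thr B s.p κ) (nextL s.a s.st) (nextH s.b s.st))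
      else if nextL s.a s.st.tail / B ^ k = nextL s.a s.st / B ^ k then
        slotVal B K m₁.V s.p κ k j
      else mn (2 * n + 1) (G.above A (G.thr B s.p κ) (nextL s.a s.st) (nextH s.b s.st)) with hv
    have hb₂ := hb₁.setV (k := slotOff B K s.p κ k j) eval.lt
    have hr₂ := hr₁.setV (k := slotOff B K s.p κ k j) (v := v)
    have eend : Ev w M ((m₁.setV (slotOff B K s.p κ k j) v).enc rest) x (.writeEnd K κ) _ :=
      Ev.iteLt (Ev.depth E hb₂ hr₂) (two _ hb₂) (fun _ => Ev.h₁ E hb₂ hr₂ hD) fun _ =>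
        lev_intro _ hb₂ hr₂ _ _ (eite _ hb₂ hr₂ _ _ _ _
          (Ev.slotW E hb₂ (eslot _ hb₂ hr₂) (by omega) hκ hk hj) (Ev.h₁ E hb₂ hr₂ hD))
    set r := if s.st.length < 2 then nextH s.b s.st
      else if nextL s.a s.st.tail / B ^ k = nextL s.a s.st / B ^ k then
        slotVal B K m₁.W s.p κ k j
      else nextH s.b s.st with hrdef
    have hb₃ := hb₂.setW (k := slotOff B K s.p κ k j) eend.lt
    have hr₃ := hr₂.setW (k := slotOff B K s.p κ k j) (v := r)
    refine ⟨_, hex.append (.cons (Ev.addr (i := 4) hb₁ (eoff _ hb₁ hr₁) (by omega)) (by omega) eval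
      (Store.update_V _ _ _ _ ▸ .cons (Ev.addr (i := 5) hb₂ (eoff _ hb₂ hr₂) (by omega)) (by omega)
        eend (Store.update_W _ _ _ _ ▸ .nil _))), hb₃, hr₃, ?_⟩
    refine hs₁.write hi hκ hkdef (v := v) (r := r) (fun q κ' k' j' hne => ⟨?_, ?_⟩) ?_ ?_ ?_ ?_
    · exact slotVal_update_of_ne hκ hk hj hne
    · exact slotVal_update_of_ne hκ hk hj hne
    · exact slotVal_update hκ hk hj
    · exact slotVal_update hκ hk hj
    · intro e e' t hst he
      have hlen : ¬ s.st.length < 2 := by rw [hst]; simp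
      rw [if_neg hlen] at hv hrdef
      have hj' : j = s.p / B ^ k - e.1 / B ^ k := by rw [hjdef, hst]; rfl
      have hc : nextL s.a s.st.tail / B ^ k = nextL s.a s.st / B ^ k := by
        rw [hst]; exact he
      rw [if_pos hc] at hv hrdef
      rw [← hj']
      exact ⟨hv, hrdef⟩
    · intro e t hst he
      have hv' : v = mn (2 * n + 1)
          (G.above A (G.thr B s.p κ) (nextL s.a s.st) (nextH s.b s.st)) ∧ r = nextH s.b s.st := by
        cases t with
        | nil =>
          have hlen : s.st.length < 2 := by rw [hst]; simp
          rw [if_pos hlen] at hv hrdef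
          exact ⟨hv, hrdef⟩
        | cons e' t' =>
          have hlen : ¬ s.st.length < 2 := by rw [hst]; simp
          have hc : ¬ nextL s.a s.st.tail / B ^ k = nextL s.a s.st / B ^ k := by
            rw [hst]; exact he e' t' rfl
          rw [if_neg hlen, if_neg hc] at hv hrdef
          exact ⟨hv, hrdef⟩
      rw [hst] at hv'
      exact hv'

theorem exec_all (h2 : ∀ q, G.key (q + n) = G.key q) (h3 : ∀ q, G.ty (q + n) = G.ty q)
    (hx : x < 2 ^ w) (hb : Bounded w M (m.enc rest)) (hr : Rep m s) (hi : Inv G n A₀ A s)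
    (hs : Slots G (2 * n + 1) B K A s.p (K + 1) s.st (slotVal B K m.V) (slotVal B K m.W))
    (hmove : nodeAt ((s.norm n).p + 1) = x ∨ nodeAt ((s.norm n).p - 1) = x) :
    ∃ (m' : Store) (s' : State), Exec w M x (m.enc rest) (Stmts.all K) (m'.enc rest) ∧
      Bounded w M (m'.enc rest) ∧ Rep m' s' ∧ Inv G n A₀ (G.step A s'.p) s' ∧
      Slots G (2 * n + 1) B K (G.step A s'.p) s'.p (K + 1) s'.st (slotVal B K m'.V)
        (slotVal B K m'.W) ∧
      nodeAt s'.p = x ∧ Ev w M (m'.enc rest) x (.answer K)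
        (nodeOf (mn (2 * n + 1) {y | y ∈ G.step A s'.p ∧ G.key s'.p ≤ y})) := by
  have hn := E.three_le
  obtain ⟨m₁, hex₁, hb₁, hr₁, hV, hW⟩ := exec_norm (x := x) E hb hr hi
  have hi₁ := hi.norm (by omega) h2 h3
  have hs₁ : Slots G (2 * n + 1) B K A (s.norm n).p (K + 1) (s.norm n).st (slotVal B K m₁.V)
      (slotVal B K m₁.W) := by
    rw [hV, hW]
    unfold State.norm
    split_ifs
    · exact Slots.nil _ _ _ _ _ _ _ _ _
    · exact Slots.nil _ _ _ _ _ _ _ _ _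
    · exact hs
  -- After normalization both neighbouring positions are on the line.
  have hp : 0 < (s.norm n).p ∧ (s.norm n).p < 2 * n := by
    have h4 := hi.le_b
    have h5 := hi.b_le
    unfold State.norm
    split_ifs
    · simp only; omega
    · simp only; omega
    · omega
  generalize s.norm n = s₁ at *
  obtain ⟨m₂, hex₂, hb₂, hr₂, hV, hW⟩ := exec_move (x := x) E hb₁ hr₁ hi₁ hp.2 hx
  set s₂ := s₁.move (nodeAt (s₁.p + 1) = x) with hs₂
  have main : Inv G n A₀ (G.step A s₂.p) s₂ ∧ s₂.a ≤ s₂.p ∧ nodeAt s₂.p = x ∧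
      Slots G (2 * n + 1) B K (G.step A s₂.p) s₂.p 0 s₂.st (slotVal B K m₁.V)
        (slotVal B K m₁.W) := by
    have ep := State.move_p s₁ (nodeAt (s₁.p + 1) = x)
    have ea := State.move_a s₁ (nodeAt (s₁.p + 1) = x)
    rw [← hs₂] at ep ea
    by_cases c : nodeAt (s₁.p + 1) = x
    · rw [if_pos c] at ep ea
      rw [ep, ea]
      have e : s₂ = s₁.right := by rw [hs₂, State.move, if_pos c]
      rw [e]
      exact ⟨hi₁.right hp.2, hi₁.a_le, c, hs₁.right hi₁ hp.2⟩
    · rw [if_neg c] at ep ea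
      rw [ep]
      have e : s₂ = s₁.left := by rw [hs₂, State.move, if_neg c]
      refine ⟨e ▸ hi₁.left hp.1, ?_, hmove.resolve_left c, e ▸ hs₁.left hi₁ hp.1⟩
      rw [ea]
      have h4 := hi₁.nest.le_nextL
      split_ifs with c1 c2
      · omega
      · omega
      · cases hst : s₁.st with
        | nil => rw [hst] at c2; simp at c2
        | cons e t =>
          have h5 := hi₁.a_lt hst
          have h6 := (hi₁.top e t hst).1
          omega
  clear_value s₂
  obtain ⟨hi₂, ha₂, hat, hsl⟩ := main
  rw [← hV, ← hW] at hsl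
  obtain ⟨m₃, hex₃, hb₃, hr₃, hs₃⟩ := exec_write (x := x) E hi₂ ha₂ hb₂ hr₂ hsl (K + 1) le_rfl
  exact ⟨m₃, s₂, hex₁.append (hex₂.append hex₃), hb₃, hr₃, hi₂, hs₃, hat,
    Ev.answer E hb₃ hr₃ hi₂ ha₂ hs₃⟩

end

/-! ### Choice of the parameters -/

theorem exists_fanout {K n : ℕ} (hK : 1 ≤ K) (hn : 3 ≤ n) :
    ∃ B : ℕ, 5 ≤ B ∧ K < B ∧ 2 * n + 3 ≤ B ^ K ∧ B ≤ (10 + K) * n ∧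
      (B : ℝ) ≤ (10 + K) * (n : ℝ) ^ (1 / (K : ℝ)) := by
  have hn1 : (1 : ℝ) ≤ n := by exact_mod_cast (by omega : 1 ≤ n)
  have hK1 : (1 : ℝ) ≤ K := by exact_mod_cast hK
  set y := (n : ℝ) ^ (1 / (K : ℝ)) with hy
  have hy1 : 1 ≤ y := Real.one_le_rpow hn1 (by positivity)
  have hyn : y ≤ n := by
    calc y ≤ (n : ℝ) ^ (1 : ℝ) := Real.rpow_le_rpow_of_exponent_le hn1 (by
          rw [div_le_one (by linarith)]; exact hK1)
      _ = n := Real.rpow_one _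
  have hyK : y ^ K = n := by
    rw [hy, one_div]
    exact Real.rpow_inv_natCast_pow (by linarith) (by omega)
  have hc1 : y ≤ ⌈y⌉₊ := Nat.le_ceil y
  have hc2 : (⌈y⌉₊ : ℝ) ≤ y + 1 := (Nat.ceil_lt_add_one (by linarith)).le
  have hc3 : ⌈y⌉₊ ≤ n := Nat.ceil_le.2 hyn
  have hc4 : 1 ≤ ⌈y⌉₊ := Nat.one_le_ceil_iff.2 (by linarith)
  -- The factor 5 absorbs 2n + 3 ≤ 5n, and the summand K ensures K < B.
  refine ⟨5 * ⌈y⌉₊ + K, by omega, by omega, ?_, ?_, ?_⟩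
  · have h1 : n ≤ ⌈y⌉₊ ^ K := by
      have : (n : ℝ) ≤ (⌈y⌉₊ : ℝ) ^ K := by
        rw [← hyK]; exact pow_le_pow_left₀ (by linarith) hc1 K
      exact_mod_cast this
    calc 2 * n + 3 ≤ 5 * n := by omega
      _ ≤ 5 ^ K * ⌈y⌉₊ ^ K := Nat.mul_le_mul (Nat.le_self_pow (by omega) 5) h1
      _ = (5 * ⌈y⌉₊) ^ K := (mul_pow _ _ _).symm
      _ ≤ (5 * ⌈y⌉₊ + K) ^ K := Nat.pow_le_pow_left (by omega) K
  · have : K * 1 ≤ K * n := Nat.mul_le_mul_left _ (by omega)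
    rw [add_mul]
    omega
  · push_cast
    nlinarith

/-- The number of nodes of the search structure. -/
def trieSize (n B K : ℕ) : ℕ := 7 * (K + 1) * (3 * (6 * (2 * n + 1) * ((K + 1) ^ 2 * B ^ 3))) + 1

/-- The size of the storage. -/
def storageSize (n B K : ℕ) : ℕ :=
  (slotCount n B K + (2 * n + 1) + 16 + (trieSize n B K + 1) * B) * 16

theorem storageSize_le {n B K : ℕ} (hn : 1 ≤ n) (hB : 1 ≤ B) :
    storageSize n B K ≤ 6480 * (K + 1) ^ 3 * (n * B ^ 4) := by
  have e1 : slotCount n B K ≤ 6 * ((K + 1) ^ 3 * (n * B ^ 4)) := by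
    calc slotCount n B K = 2 * ((K + 1) ^ 2 * ((2 * n + 1) * B ^ 1)) := by unfold slotCount; ring
      _ ≤ 2 * ((K + 1) ^ 3 * ((3 * n) * B ^ 4)) := by
        gcongr <;> omega
      _ = _ := by ring
  have e2 : 1 ≤ (K + 1) ^ 3 := Nat.one_le_pow _ _ (by omega)
  have e3 : n * 1 ≤ n * B ^ 4 := Nat.mul_le_mul_left _ (Nat.one_le_pow _ _ hB)
  have e4 : 1 * (n * B ^ 4) ≤ (K + 1) ^ 3 * (n * B ^ 4) := Nat.mul_le_mul_right _ e2
  have e5 : (trieSize n B K + 1) * B ≤ 380 * ((K + 1) ^ 3 * (n * B ^ 4)) := by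
    calc (trieSize n B K + 1) * B =
        126 * ((K + 1) ^ 3 * ((2 * n + 1) * B ^ 4)) + 2 * (1 * (1 * B ^ 1)) := by
          unfold trieSize; ring
      _ ≤ 126 * ((K + 1) ^ 3 * ((3 * n) * B ^ 4)) + 2 * ((K + 1) ^ 3 * (n * B ^ 4)) := by
        gcongr <;> omega
      _ = _ := by ring
  unfold storageSize
  rw [mul_assoc]
  omega

/-- The number of words of `⌈log₂ n⌉` bits that one word of the machine consists of. -/
def wordFactor (K : ℕ) : ℕ := (11 + K) * (7 * (K + 1)) + (58 + 7 * K) + 1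

/-- A word must hold the search keys of the trie and all addresses. Both are bounded by powers of n
with exponents depending on K only; constants such as 10 + K are absorbed through k ≤ n^k. -/
theorem le_word {K n B : ℕ} (hn : 3 ≤ n) (hB1 : 1 ≤ B) (hB : B ≤ (10 + K) * n) :
    B ^ (7 * (K + 1)) < 2 ^ (wordFactor K * Nat.clog 2 n) ∧
      storageSize n B K ≤ 2 ^ (wordFactor K * Nat.clog 2 n) := by
  have hpow : ∀ k, k ≤ n ^ k := fun k =>
    (Nat.lt_two_pow_self (n := k)).le.trans (Nat.pow_le_pow_left (by omega) k)
  have hB' : B ≤ n ^ (11 + K) := by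
    calc B ≤ n ^ (10 + K) * n := hB.trans (Nat.mul_le_mul_right _ (hpow _))
      _ = n ^ (11 + K) := by ring
  have hw : n ^ wordFactor K ≤ 2 ^ (wordFactor K * Nat.clog 2 n) := by
    rw [mul_comm, pow_mul]
    exact Nat.pow_le_pow_left (Nat.le_pow_clog (by omega) n) _
  constructor
  · refine lt_of_lt_of_le ?_ hw
    calc B ^ (7 * (K + 1)) ≤ (n ^ (11 + K)) ^ (7 * (K + 1)) := Nat.pow_le_pow_left hB' _
      _ = n ^ ((11 + K) * (7 * (K + 1))) := (pow_mul _ _ _).symm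
      _ < n ^ wordFactor K := Nat.pow_lt_pow_right (by omega) (by unfold wordFactor; omega)
  · refine le_trans ?_ hw
    have hK : K + 1 ≤ n ^ K :=
      Nat.lt_two_pow_self.trans_le (Nat.pow_le_pow_left (by omega) K)
    have h13 : 6480 ≤ n ^ 13 := le_trans (by norm_num) (Nat.pow_le_pow_left hn 13)
    calc storageSize n B K ≤ 6480 * (K + 1) ^ 3 * (n * B ^ 4) := storageSize_le (by omega) hB1
      _ ≤ n ^ 13 * (n ^ K) ^ 3 * (n * (n ^ (11 + K)) ^ 4) := by gcongr
      _ = n ^ (58 + 7 * K) := by ring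
      _ ≤ n ^ wordFactor K := Nat.pow_le_pow_right (by omega) (by unfold wordFactor; omega)

/-! ### The line of a labelled cycle -/

section cycle
variable {n : ℕ} (op : Fin n → Op) (x : Fin n → ℝ) (start : Fin n)

/-- The number of items that are smaller than the item at `u`. -/
noncomputable def rk (u : Fin n) : ℕ := (Finset.univ.filter fun w => x w < x u).card

variable {x}

theorem rk_lt (u : Fin n) : rk x u < n := by
  have h : (Finset.univ.filter fun w => x w < x u) ⊂ Finset.univ := by
    refine (Finset.filter_subset _ _).ssubset_of_ne fun h => ?_
    have := h ▸ Finset.mem_univ u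
    simp at this
  simpa [rk] using Finset.card_lt_card h

theorem rk_lt_rk {u w : Fin n} (h : x u < x w) : rk x u < rk x w := by
  refine Finset.card_lt_card ((Finset.ssubset_iff_of_subset fun v hv => ?_).2 ⟨u, ?_, ?_⟩)
  · simp only [Finset.mem_filter, Finset.mem_univ, true_and] at *
    exact hv.trans h
  · simpa using h
  · simp

theorem rk_le_rk {u w : Fin n} : rk x u ≤ rk x w ↔ x u ≤ x w := by
  constructor
  · intro h
    by_contra hc
    exact absurd (rk_lt_rk (not_le.1 hc)) (by omega)
  · intro h
    rcases h.lt_or_eq with h | h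
    · exact (rk_lt_rk h).le
    · simp [rk, h]

/-- Nodes with equal items get the same key, so keys stand for items rather than for nodes. -/
theorem rk_eq_rk {u w : Fin n} : rk x u = rk x w ↔ x u = x w := by
  rw [le_antisymm_iff, rk_le_rk, rk_le_rk, ← le_antisymm_iff]

variable (x)

/-- The ranks of the items in `X`. -/
def ranks (X : Set ℝ) : Set ℕ := {r | ∃ u, x u ∈ X ∧ rk x u = r}

variable {x}

theorem rk_mem_ranks {X : Set ℝ} {u : Fin n} : rk x u ∈ ranks x X ↔ x u ∈ X :=
  ⟨fun ⟨_, h1, h2⟩ => rk_eq_rk.1 h2 ▸ h1, fun h => ⟨u, h, rfl⟩⟩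

theorem ranks_lt {X : Set ℝ} : ∀ y ∈ ranks x X, y < n := by
  rintro y ⟨u, -, rfl⟩
  exact rk_lt u

/-- The node at a position of the line; the start node is at position `n`. -/
def nodeAt (q : ℕ) : Fin n := ⟨(q + start) % n, Nat.mod_lt _ start.pos⟩

variable (x)

/-- The cycle, unrolled to a line. -/
noncomputable def cycleLine : Line := ⟨fun q => rk x (nodeAt start q), fun q => op (nodeAt start q)⟩

open Classical in
/-- A node whose item has rank `r`, or `n`. -/
noncomputable def nodeOf (r : ℕ) : ℕ := if h : ∃ u, rk x u = r then h.choose else n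

theorem nodeOf_le (r : ℕ) : nodeOf x r ≤ n := by
  unfold nodeOf
  split_ifs with h
  · exact h.choose.isLt.le
  · exact le_rfl

variable {x}

theorem nodeAt_add (q : ℕ) : nodeAt start (q + n) = nodeAt start q := by
  simp [nodeAt, add_right_comm q n]

theorem nodeAt_size : nodeAt start n = start := by
  simp [nodeAt, Nat.mod_eq_of_lt start.isLt]

theorem nodeAt_norm (s : State) : nodeAt start (s.norm n).p = nodeAt start s.p := by
  unfold State.norm
  split_ifs with h1 h2
  · rw [h1, two_mul, nodeAt_add]
  · rw [h2, ← nodeAt_add start 0, zero_add]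
  · rfl

/-- Walks on the cycle lift to the line: adjacency means a difference of 1 modulo n in one of the
two directions. -/
theorem nodeAt_neighbor {v : Fin n} {p : ℕ} (hp : 0 < p)
    (h : (SimpleGraph.cycleGraph n).Adj (nodeAt start p) v) :
    nodeAt start (p + 1) = v ∨ nodeAt start (p - 1) = v := by
  have hn : 0 < n := start.pos
  have key : ∀ u w : Fin n, (w - u).val = 1 → (u.val + 1) % n = w.val := by
    intro u w huw
    rw [Fin.sub_def] at huw
    simp only at huw
    have h1 := u.isLt
    have h2 := w.isLt
    rcases Nat.lt_or_ge w.val u.val with c | c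
    · rw [Nat.mod_eq_of_lt (by omega)] at huw
      rw [show u.val + 1 = n + w.val by omega, Nat.add_mod_left, Nat.mod_eq_of_lt h2]
    · rw [show n - u.val + w.val = n + (w.val - u.val) by omega, Nat.add_mod_left,
        Nat.mod_eq_of_lt (by omega)] at huw
      rw [show u.val + 1 = w.val by omega, Nat.mod_eq_of_lt h2]
  rw [SimpleGraph.cycleGraph_adj'] at h
  rcases h with h | h
  · right
    have h1 := key _ _ h
    apply Fin.ext
    simp only [nodeAt] at h1 ⊢
    have h2 : (v.val + 1) ≡ (p - 1 + start) + 1 [MOD n] := by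
      rw [show p - 1 + start.val + 1 = p + start by omega]
      exact h1.trans (Nat.mod_mod _ _).symm |>.trans (Nat.mod_mod _ _)
    have h3 := Nat.ModEq.add_right_cancel' 1 h2
    rw [Nat.ModEq, Nat.mod_eq_of_lt v.isLt] at h3
    exact h3.symm
  · left
    have h1 := key _ _ h
    apply Fin.ext
    simp only [nodeAt] at h1 ⊢
    rw [← h1, Nat.mod_add_mod]
    congr 1
    omega

theorem activeSet_subset {v : ℕ → Fin n} {X₀ : Set ℝ} (hX : X₀ ⊆ Set.range x) (t : ℕ) :
    activeSet op x v X₀ t ⊆ Set.range x := by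
  induction t with
  | zero => exact hX
  | succ t ih =>
    simp only [activeSet]
    split
    · exact Set.union_subset ih (by simp)
    · exact Set.sdiff_subset.trans ih
    · exact ih

theorem step_ranks {v : ℕ → Fin n} {X₀ : Set ℝ} {t p : ℕ} (h : nodeAt start p = v (t + 1)) :
    (cycleLine op x start).step (ranks x (activeSet op x v X₀ t)) p =
      ranks x (activeSet op x v X₀ (t + 1)) := by
  have ht : (cycleLine op x start).ty p = op (v (t + 1)) := by rw [← h]; rfl
  have hk : (cycleLine op x start).key p = rk x (v (t + 1)) := by rw [← h]; rfl
  unfold Line.step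
  rw [ht, hk]
  simp only [activeSet]
  cases op (v (t + 1)) with
  | query => rfl
  | insert =>
    ext y
    constructor
    · rintro (⟨u, h1, h2⟩ | rfl)
      · exact ⟨u, Or.inl h1, h2⟩
      · exact ⟨_, Or.inr rfl, rfl⟩
    · rintro ⟨u, h1 | h1, rfl⟩
      · exact Or.inl ⟨u, h1, rfl⟩
      · exact Or.inr (rk_eq_rk.2 h1)
  | delete =>
    ext y
    constructor
    · rintro ⟨⟨u, h1, rfl⟩, h2⟩
      exact ⟨u, ⟨h1, fun h3 => h2 (rk_eq_rk.2 h3)⟩, rfl⟩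
    · rintro ⟨u, h1, rfl⟩
      exact ⟨⟨u, h1.1, rfl⟩, fun h3 => h1.2 (rk_eq_rk.1 h3)⟩

theorem representsSucc_nodeOf {X : Set ℝ} (hX : X ⊆ Set.range x) (u : Fin n) :
    RepresentsSucc x X (x u) (nodeOf x (mn (2 * n + 1) {y | y ∈ ranks x X ∧ rk x u ≤ y})) := by
  rcases mn_eq_or_mem (2 * n + 1) {y | y ∈ ranks x X ∧ rk x u ≤ y} with h | h
  · right
    constructor
    · rw [h, nodeOf, dif_neg]
      rintro ⟨w, hw⟩
      have := rk_lt (x := x) w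
      omega
    · rintro ⟨y, hy, hq⟩
      obtain ⟨w, rfl⟩ := hX hy
      have h1 := mn_le (N := 2 * n + 1) (S := {y | y ∈ ranks x X ∧ rk x u ≤ y})
        (y := rk x w) ⟨rk_mem_ranks.2 hy, rk_le_rk.2 hq⟩
      have := rk_lt (x := x) w
      omega
  · left
    obtain ⟨⟨w, h1, h2⟩, h3⟩ := h
    have hex : ∃ k, rk x k = mn (2 * n + 1) {y | y ∈ ranks x X ∧ rk x u ≤ y} := ⟨w, h2⟩
    refine ⟨hex.choose, ?_, ?_⟩
    · rw [nodeOf, dif_pos hex]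
    · have hk := hex.choose_spec
      generalize hex.choose = k at hk
      have hxk : x k = x w := rk_eq_rk.1 (hk.trans h2.symm)
      refine ⟨⟨hxk ▸ h1, ?_⟩, ?_⟩
      · rw [← rk_le_rk, hk]; exact h3
      · rintro y ⟨hy, hq⟩
        obtain ⟨z, rfl⟩ := hX hy
        rw [← rk_le_rk, hk]
        exact mn_le ⟨rk_mem_ranks.2 hy, rk_le_rk.2 hq⟩

end cycle

/-! ### The initial storage -/

/-- The static part of the storage, from tables for the search structure and the line. -/
def staticRest (n B root : ℕ) (C W key nodeOf nodeAt : ℕ → ℕ) (i o : ℕ) : ℕ :=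
  if i = 0 then
    if o = 0 then B else if o = 1 then root else if o = 2 then 2 * n + 1
    else if o = 3 then n else 0
  else if i = 6 then C o else if i = 7 then W o else if i = 8 then key o
  else if i = 9 then nodeOf o else if i = 10 then nodeAt o else 0

/-- The changing part of the storage at the start. -/
def Store.start (n : ℕ) : Store :=
  ⟨fun k => if k = 0 then n else if k = 1 then n + 1 else if k = 2 then n else 0,
    fun _ => 0, fun _ => 0, fun _ => 0, fun _ => 0⟩

/-! ### From the initial storage to arbitrary walks -/

section
variable {n : ℕ} (op : Fin n → Op) (x : Fin n → ℝ) (start : Fin n) (X₀ : Set ℝ)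

theorem exists_static {w B K : ℕ} (hn : 3 ≤ n) (hB : 5 ≤ B) (hK : 1 ≤ K) (hKB : K < B)
    (hpow : 2 * n + 3 ≤ B ^ K) (hw : B ^ (7 * (K + 1)) < 2 ^ w) (hM : storageSize n B K ≤ 2 ^ w) :
    ∃ rest : ℕ → ℕ → ℕ,
      Static w (storageSize n B K) n B K (cycleLine op x start) (ranks x X₀) (nodeOf x)
        (fun q => (nodeAt start q).val) rest ∧
      Bounded w (storageSize n B K) ((Store.start n).enc rest) := by
  set G := cycleLine op x start with hG
  obtain ⟨C, W, root, h1, h2, h3, h4⟩ :=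
    exists_index B K (2 * n + 1) (by omega) (G.entries (2 * n + 1) n (ranks x X₀) B K)
  have hcard : 7 * (K + 1) *
      (3 * (G.entries (2 * n + 1) n (ranks x X₀) B K).card) + 1 ≤ trieSize n B K := by
    have := G.card_entries_le (A₀ := ranks x X₀) (K := K) (show 0 < B by omega)
      (show n ≤ 2 * n + 1 by omega)
    unfold trieSize
    gcongr
  have hsize : storageSize n B K =
      (slotCount n B K + (2 * n + 1) + 16 + (trieSize n B K + 1) * B) * 16 := rfl
  have hBsize : B ≤ (trieSize n B K + 1) * B := Nat.le_mul_of_pos_left _ (by omega)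
  have htsize : trieSize n B K + 1 ≤ (trieSize n B K + 1) * B :=
    Nat.le_mul_of_pos_right _ (by omega)
  have hkey : ∀ q, G.key q < n := fun q => rk_lt _
  have hat : ∀ q, (nodeAt start q).val < n := fun q => (nodeAt start q).isLt
  refine ⟨staticRest n B root C W G.key (nodeOf x) fun q => (nodeAt start q).val, ?_, ?_⟩
  · refine
      { three_le := hn, five_le := hB, K_pos := hK, K_lt := hKB, lt_pow := hpow, pow_lt := hw,
        le_M := by rw [hsize]; exact Nat.mul_le_mul_right _ (by omega)
        two_n := rfl, n_eq := rfl, key_eq := fun _ _ => rfl, nodeOf_eq := fun _ _ => rfl,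
        nodeAt_eq := fun _ _ => rfl, key_lt := hkey, init_lt := ranks_lt, index := fun m => ?_ }
    have hroot : m.enc (staticRest n B root C W G.key (nodeOf x)
        fun q => (nodeAt start q).val) (1 * 16 + 0) = root := by
      rw [enc_rest (by omega) (by omega)]; rfl
    refine ⟨by omega, ?_, by omega, C, W, trieSize n B K, fun i _ => ?_,
      fun i => (h2 i).trans hcard, fun i _ => ?_, ?_, ?_, ?_⟩
    · rw [enc_rest (by omega) (by omega)]; rfl
    · rw [enc_rest (by omega) (by omega)]; rfl
    · rw [enc_rest (by omega) (by omega)]; rfl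
    · rw [hsize]; exact Nat.mul_le_mul_right _ (by omega)
    · rw [hroot]; exact h1.trans hcard
    · rw [hroot]; exact h4
  · refine ⟨hM, by omega, fun a => ?_⟩
    have hrest : ∀ i o, staticRest n B root C W G.key (nodeOf x)
        (fun q => (nodeAt start q).val) i o < 2 ^ w := by
      intro i o
      have i1 := h2 o
      have i2 := h3 o
      have i3 := hkey o
      have i4 := hat o
      have i5 := nodeOf_le x o
      simp only [staticRest]
      generalize 2 ^ w = z at *
      split_ifs <;> omega
    have hvars : ∀ o, (Store.start n).vars o < 2 ^ w := by
      intro o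
      simp only [Store.start]
      generalize 2 ^ w = z at *
      split_ifs <;> omega
    have hpos : 0 < 2 ^ w := Nat.two_pow_pos w
    unfold Store.enc
    split_ifs
    · exact hvars _
    · exact hpos
    · exact hpos
    · exact hpos
    · exact hpos
    · exact hrest _ _

/-- The configuration after the first `t` requests. -/
def Invariant (w B K : ℕ) (rest : ℕ → ℕ → ℕ) (v : ℕ → Fin n) (t : ℕ) (s : Config) : Prop :=
  ∃ (m : Store) (σ : State), s.mem = m.enc rest ∧ Bounded w (storageSize n B K) (m.enc rest) ∧
    Rep m σ ∧ Inv (cycleLine op x start) n (ranks x X₀) (ranks x (activeSet op x v X₀ t)) σ ∧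
    Slots (cycleLine op x start) (2 * n + 1) B K (ranks x (activeSet op x v X₀ t)) σ.p (K + 1) σ.st
      (slotVal B K m.V) (slotVal B K m.W) ∧
    nodeAt start σ.p = v t

variable {op x start X₀}

theorem Invariant.serve {w B K : ℕ} {rest : ℕ → ℕ → ℕ} {v : ℕ → Fin n} {t : ℕ} {s : Config}
    (h : Invariant op x start X₀ w B K rest v t s)
    (E : Static w (storageSize n B K) n B K (cycleLine op x start) (ranks x X₀) (nodeOf x)
      (fun q => (nodeAt start q).val) rest) (hX : X₀ ⊆ Set.range x)
    (hv : (SimpleGraph.cycleGraph n).Adj (v t) (v (t + 1))) :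
    ∃ s', serve (program (Stmts.all K) (.answer K)) w (storageSize n B K)
        (programTime (Stmts.all K) (.answer K)) s (v (t + 1)) = some s' ∧
      Invariant op x start X₀ w B K rest v (t + 1) s' ∧
      RepresentsSucc x (activeSet op x v X₀ (t + 1)) (x (v (t + 1))) (s'.reg 1) := by
  obtain ⟨m, σ, hm, hb, hr, hi, hs, hat⟩ := h
  have hn := E.three_le
  have hlt : (v (t + 1)).val < 2 ^ w := by
    have h1 := E.M_ge
    have h2 := hb.le
    have h3 := (v (t + 1)).isLt
    omega
  have hnorm : 0 < (σ.norm n).p := by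
    unfold State.norm
    split_ifs
    · simp only; omega
    · simp only; omega
    · omega
  have key : ∀ q, (cycleLine op x start).key (q + n) = (cycleLine op x start).key q := fun q => by
    simp only [cycleLine, nodeAt_add]
  have ty : ∀ q, (cycleLine op x start).ty (q + n) = (cycleLine op x start).ty q := fun q => by
    simp only [cycleLine, nodeAt_add]
  -- Normalization changes the position but not the node, so adjacency can be read at the normalized
  -- position.
  rw [← hat, ← nodeAt_norm] at hv
  obtain ⟨m', σ', hex, hb', hr', hi', hs', hat', hans⟩ :=
    exec_all E key ty hlt hb hr hi hs ((nodeAt_neighbor start hnorm hv).imp (congrArg Fin.val)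
      (congrArg Fin.val))
  have hat' : nodeAt start σ'.p = v (t + 1) := Fin.ext hat'
  have hk : (cycleLine op x start).key σ'.p = rk x (v (t + 1)) := by rw [← hat']; rfl
  rw [step_ranks op start hat'] at hi' hs' hans
  rw [hk] at hans
  obtain ⟨s', e1, e2, e3⟩ := serve_program hex hans hlt s hm
  refine ⟨s', e1, ⟨m', σ', e2, hb', hr', hi', hs', hat'⟩, ?_⟩
  rw [e3]
  exact representsSucc_nodeOf (activeSet_subset op hX _) _

theorem servesWalk_of_static {w B K : ℕ} {rest : ℕ → ℕ → ℕ}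
    (E : Static w (storageSize n B K) n B K (cycleLine op x start) (ranks x X₀) (nodeOf x)
      (fun q => (nodeAt start q).val) rest)
    (hb : Bounded w (storageSize n B K) ((Store.start n).enc rest)) (hX : X₀ ⊆ Set.range x)
    {v : ℕ → Fin n} (h0 : v 0 = start)
    (hv : ∀ t, (SimpleGraph.cycleGraph n).Adj (v t) (v (t + 1))) :
    ServesWalk (program (Stmts.all K) (.answer K)) w (storageSize n B K)
      (programTime (Stmts.all K) (.answer K)) ((Store.start n).enc rest) op x X₀ v := by
  -- A successor is chosen for every configuration, with content only under the invariant, so that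
  -- the run can be defined by recursion.
  have next : ∀ (t : ℕ) (s : Config), ∃ s', Invariant op x start X₀ w B K rest v t s →
      serve (program (Stmts.all K) (.answer K)) w (storageSize n B K)
        (programTime (Stmts.all K) (.answer K)) s (v (t + 1)) = some s' ∧
      Invariant op x start X₀ w B K rest v (t + 1) s' ∧
      RepresentsSucc x (activeSet op x v X₀ (t + 1)) (x (v (t + 1))) (s'.reg 1) := by
    intro t s
    by_cases h : Invariant op x start X₀ w B K rest v t s
    · obtain ⟨s', hs'⟩ := h.serve E hX (hv t)
      exact ⟨s', fun _ => hs'⟩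
    · exact ⟨s, fun h' => absurd h' h⟩
  choose f hf using next
  let s : ℕ → Config := fun t => Nat.rec (Config.init ((Store.start n).enc rest)) f t
  have hs : ∀ t, Invariant op x start X₀ w B K rest v t (s t) := by
    intro t
    induction t with
    | zero =>
      exact ⟨Store.start n, ⟨n, n + 1, n, []⟩, rfl, hb, ⟨rfl, rfl, rfl, rfl, trivial⟩,
        Inv.init _ _ _, Slots.nil _ _ _ _ _ _ _ _ _, (nodeAt_size start).trans h0.symm⟩
    | succ t ih => exact (hf t (s t) ih).2.1
  exact ⟨s, rfl, fun t => ⟨(hf t (s t) (hs t)).1, fun _ => (hf t (s t) (hs t)).2.2⟩⟩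

end

/-- The tables contain B to the fourth power, and B is of order n^(1/K), so 4/K ≤ ε is what is
needed. -/
theorem storageSize_le_rpow {ε : ℝ} {K n B : ℕ} (hε : 0 < ε) (hK : 4 / ε ≤ K) (hn : 1 ≤ n)
    (hB : 1 ≤ B) (h : (B : ℝ) ≤ (10 + K) * (n : ℝ) ^ (1 / (K : ℝ))) :
    (storageSize n B K : ℝ) ≤ 6480 * (K + 1) ^ 3 * (10 + K) ^ 4 * (n : ℝ) ^ (1 + ε) := by
  have hn1 : (1 : ℝ) ≤ n := by exact_mod_cast hn
  have hKpos : (0 : ℝ) < K := lt_of_lt_of_le (by positivity) hK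
  have h4 : ((n : ℝ) ^ (1 / (K : ℝ))) ^ 4 ≤ (n : ℝ) ^ ε := by
    rw [← Real.rpow_natCast, ← Real.rpow_mul (by linarith)]
    refine Real.rpow_le_rpow_of_exponent_le hn1 ?_
    rw [div_le_iff₀ hε] at hK
    push_cast
    rw [one_div, inv_mul_eq_div, div_le_iff₀ hKpos]
    linarith
  calc (storageSize n B K : ℝ) ≤ ((6480 * (K + 1) ^ 3 * (n * B ^ 4) : ℕ) : ℝ) := by
        exact_mod_cast storageSize_le hn hB
    _ = 6480 * (K + 1) ^ 3 * (n * (B : ℝ) ^ 4) := by push_cast; ring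
    _ ≤ 6480 * (K + 1) ^ 3 * (n * ((10 + K) * (n : ℝ) ^ (1 / (K : ℝ))) ^ 4) := by gcongr
    _ = 6480 * (K + 1) ^ 3 * (10 + K) ^ 4 * (n * ((n : ℝ) ^ (1 / (K : ℝ))) ^ 4) := by ring
    _ ≤ 6480 * (K + 1) ^ 3 * (10 + K) ^ 4 * (n * (n : ℝ) ^ ε) := by gcongr
    _ = 6480 * (K + 1) ^ 3 * (10 + K) ^ 4 * (n : ℝ) ^ (1 + ε) := by
        rw [Real.rpow_add (by linarith), Real.rpow_one]

end CycleSucc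

theorem mainTheorem4 (ε : ℝ) (hε : 0 < ε) :
    ∃ (P : CycleSucc.Program) (T c : ℕ) (K : ℝ),
      ∀ n : ℕ, 3 ≤ n →
      ∀ (op : Fin n → CycleSucc.Op) (x : Fin n → ℝ) (start : Fin n) (X₀ : Set ℝ),
        X₀ ⊆ Set.range x →
        ∃ (M : ℕ) (mem : ℕ → ℕ),
          (M : ℝ) ≤ K * (n : ℝ) ^ (1 + ε) ∧
          (∀ a, mem a < 2 ^ (c * Nat.clog 2 n)) ∧
          ∀ v : ℕ → Fin n, v 0 = start →
            (∀ t, (SimpleGraph.cycleGraph n).Adj (v t) (v (t + 1))) →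
            CycleSucc.ServesWalk P (c * Nat.clog 2 n) M T mem op x X₀ v := by
  -- K is fixed by ε alone and determines the program; the fan-out B depends on n and is read from
  -- the storage.
  obtain ⟨K, hK⟩ := exists_nat_ge (4 / ε)
  have hK1 : 1 ≤ K := by
    have : (0 : ℝ) < K := lt_of_lt_of_le (by positivity) hK
    exact_mod_cast this
  refine ⟨CycleSucc.program (CycleSucc.Stmts.all K) (.answer K),
    CycleSucc.programTime (CycleSucc.Stmts.all K) (.answer K), CycleSucc.wordFactor K,
    6480 * (K + 1) ^ 3 * (10 + K) ^ 4, fun n hn op x start X₀ hX => ?_⟩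
  obtain ⟨B, hB, hKB, hpow, hBn, hBr⟩ := CycleSucc.exists_fanout hK1 hn
  obtain ⟨hw, hM⟩ := CycleSucc.le_word (K := K) hn (by omega) hBn
  obtain ⟨rest, E, hb⟩ := CycleSucc.exists_static op x start X₀ hn hB hK1 hKB hpow hw hM
  exact ⟨_, _, CycleSucc.storageSize_le_rpow hε hK (by omega) (by omega) hBr, hb.mem,
    fun v h0 hv => CycleSucc.servesWalk_of_static E hb hX h0 hv⟩
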